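/- Let $p\ge 2$ be an integer. For $1\le j\le p-1$ and $\tau\in\mathbb H$ put, with $q=e^{2\pi i\tau}$ and $\operatorname{sgn}(n)=1$ for $n\ge 0$, $\operatorname{sgn}(n)=-1$ for $n<0$, $$F_{j,p}(\tau)=\sum_{n\in\mathbb Z}\operatorname{sgn}(n)\,q^{p(n+\frac{j}{2p})^2},\qquad f_{j,p}(\tau)=\sum_{n\in\mathbb Z}\Big(n+\frac{j}{2p}\Big)q^{p(n+\frac{j}{2p})^2}.$$ For $\tau$ in the lower half-plane $\overline{\mathbb H}=\{\operatorname{Im}\tau<0\}$ let $F_{j,p}(\tau)$ be the non-holomorphic Eichler integral $$F_{j,p}(\tau)=\sqrt{2p/i}\int_{\bar\tau}^{i\infty}\frac{f_{j,p}(z)}{(z-\tau)^{1/2}}\,dz$$ (vertical path), and for $x\in\mathbb Q$ let $F_{j,p}(x)=\lim_{y\to0^+}F_{j,p}(x+iy)$. Let ${\bf F}=(F_{1,p},\dots,F_{p-1,p})$, let ${\bf S}(p)$ be the $(p-1)\times(p-1)$ matrix with entries ${\bf S}(p)_{c,j}=\sqrt{2/p}\,\sin(\pi cj/p)$, and put $$g(w)=-\sqrt{2p/i}\int_0^{i\infty}\frac{f(u)}{\sqrt{u-w}}\,du,\qquad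 f=(f_{1,p},\dots,f_{p-1,p}),$$ the integral being along the imaginary axis with $\sqrt{u-w}:=\sqrt{i}\,\sqrt{-i(u-w)}$. All other roots, and the two on the right here, are principal, with argument in $(-\pi,\pi]$. (For $w\in\overline{\mathbb H}\cup\mathbb R$ this is the principal root of $u-w$.) Then all these series and integrals converge (that for $g(w)$ for every $w\in\mathbb C$), and: 1. ${\bf F}$ is a vector-valued (strong) quantum modular form of weight $\frac12$ with quantum set $\mathbb Q$. That is: (a) ${\bf F}$ is holomorphic on $\mathbb H$ and real-analytic on $\overline{\mathbb H}$. For each $x\in\mathbb Q$ there are vectors $a_0={\bf F}(x),a_1,a_2,\dots$ such that ${\bf F}(x+iy)=\sum_{n<N}a_n(iy)^n+O(|y|^N)$ for every $N\ge0$, as $y\to0$ through positive and through negative real values; so the limits from the two sides agree to all orders. (b) For $\gamma=\begin{pmatrix}a&b\\c&d\end{pmatrix}\in SL(2,\mathbb Z)$ let $(cw+d)^{1/2}$ be the principal root for $w\in\overline{\mathbb H}$, extended continuously to real $w$ with $cw+d\neq0$. There are invertible matrices $E(\gamma)$, $\gamma\in SL(2,\mathbb Z)$, such that the matrices $j(\gamma,w):=(cw+d)^{-1/2}E(\gamma)$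 satisfy $j(\gamma_1\gamma_2,w)=j(\gamma_2,w)\,j(\gamma_1,\gamma_2w)$ for $w\in\overline{\mathbb H}$, and such that for every $\gamma$ the function $$h_\gamma(x)={\bf F}(x)-(cx+d)^{-1/2}E(\gamma)\,{\bf F}\Big(\frac{ax+b}{cx+d}\Big),\qquad x\in\mathbb Q,\ cx+d\ne0,$$ is the restriction of a $C^\infty$ function on $\mathbb R$ that is real-analytic at every $x\in\mathbb R$ with $cx+d\neq0$. Moreover $E\begin{pmatrix}0&-1\\1&0\end{pmatrix}=-e^{-\pi i/4}\,{\bf S}(p)$. 2. For every $w\in\mathbb H\cup\overline{\mathbb H}\cup\mathbb Q$, $w\neq0$, $$\frac{1}{\sqrt{wi}}\,{\bf F}\Big(-\frac1w\Big)+{\bf S}(p)\,{\bf F}(w)=-{\bf S}(p)\,g(w).$$ 3. The function $g$ is holomorphic on $\mathbb C\setminus i[0,\infty)$, its restriction to $\mathbb R$ is $C^\infty$, and this restriction is real-analytic on $\mathbb R\setminus\{0\}$. 4. ${\bf S}(p)$ is the $S$-matrix of $A_1^{(1)}$ at level $k=p-2$: if $$\chi_a(\tau)=\eta(\tau)^{-3}\sum_{n\in\mathbb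 Z}(a+1+2n(k+2))\,q^{\frac{(a+1+2n(k+2))^2}{4(k+2)}},\qquad 0\le a\le k,$$ are the characters of the integrable highest weight modules of level $k$, then $\chi_a(-1/\tau)=\sum_{b=0}^{k}{\bf S}(p)_{a+1,b+1}\,\chi_b(\tau)$ for all $\tau\in\mathbb H$. -/

import Mathlib

open Complex Matrix Filter Topology Asymptotics MeasureTheory
open scoped MatrixGroups ContDiff

noncomputable section

namespace QMF

/-! ### Vector-valued quantum modular forms -/

/-- The denominator `c w + d` attached to `γ = (a b; c d)`. -/
def den (γ : SL(2, ℤ)) (w : ℂ) : ℂ := ((γ 1 0 : ℤ) : ℂ) * w + ((γ 1 1 : ℤ) : ℂ)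

/-- The Möbius action `w ↦ (a w + b) / (c w + d)`. -/
def moeb (γ : SL(2, ℤ)) (w : ℂ) : ℂ :=
  (((γ 0 0 : ℤ) : ℂ) * w + ((γ 0 1 : ℤ) : ℂ)) / den γ w

/-- The automorphy factor `(c w + d) ^ k` for `w` in the lower half-plane or real: the principal
power on the lower half-plane, and its continuous extension to the real points with `c w + d ≠ 0`.
If `c > 0`, then `c w + d` lies in the closed lower half-plane and the argument is taken in
`[-π, π)`; otherwise it is taken in `(-π, π]`. -/
def autFactor (k : ℝ) (γ : SL(2, ℤ)) (w : ℂ) : ℂ :=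
  if 0 < γ 1 0 then
    (starRingEnd ℂ) (((starRingEnd ℂ) (den γ w)) ^ (k : ℂ))
  else (den γ w) ^ (k : ℂ)

variable {ι : Type} [Fintype ι] [DecidableEq ι]

/-- `E` is a (matrix-valued) multiplier system of weight `k` on `SL(2, ℤ)`: the matrices
`(c w + d) ^ (-k) E(γ)` satisfy the cocycle identity that makes
`(f|γ)(w) = (c w + d) ^ (-k) E(γ) f(γ w)` a right action, `f|(γ₁ γ₂) = (f|γ₁)|γ₂`. -/
def IsMultiplierSystem (k : ℝ) (E : SL(2, ℤ) → GL ι ℂ) : Prop :=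
  ∀ (γ₁ γ₂ : SL(2, ℤ)) (w : ℂ), w.im < 0 →
    (autFactor k (γ₁ * γ₂) w)⁻¹ • (E (γ₁ * γ₂) : Matrix ι ι ℂ) =
      ((autFactor k γ₂ w)⁻¹ * (autFactor k γ₁ (moeb γ₂ w))⁻¹) •
        ((E γ₂ : Matrix ι ι ℂ) * (E γ₁ : Matrix ι ι ℂ))

/-- `F : ℚ → ℂ^ι` is a vector-valued quantum modular form of weight `k` for `SL(2, ℤ)`, with
quantum set `ℚ` and multiplier system `E`: for every `γ` the error of modularity
`h_γ(x) = F(x) - (c x + d) ^ (-k) E(γ) F(γ x)` is the restriction to the rationals with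
`c x + d ≠ 0` of a `C^∞` function on `ℝ` that is real-analytic wherever `c x + d ≠ 0`. -/
structure IsQuantumModularForm (k : ℝ) (E : SL(2, ℤ) → GL ι ℂ) (F : ℚ → ι → ℂ) : Prop where
  multiplier : IsMultiplierSystem k E
  error : ∀ γ : SL(2, ℤ), ∃ h : ℝ → ι → ℂ,
    ContDiff ℝ ∞ h ∧
    (∀ x : ℝ, den γ (x : ℂ) ≠ 0 → AnalyticAt ℝ h x) ∧
    ∀ x y : ℚ, den γ (x : ℂ) ≠ 0 → (y : ℂ) = moeb γ (x : ℂ) →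
      F x - (autFactor k γ (x : ℂ))⁻¹ • ((E γ : Matrix ι ι ℂ) *ᵥ F y) = h (x : ℝ)

/-- `F`, of which only the values on `ℍ ∪ ℍ⁻ ∪ ℚ` matter, is a strong quantum modular form: it is
a quantum modular form on `ℚ`, it is holomorphic on the upper half-plane, real-analytic on the
lower half-plane, and at every rational `x` the two vertical limits exist, are equal to `F x`
and agree to all orders, that is, `F(x + i y)` has one and the same asymptotic expansion
`∑ aₙ (i y)ⁿ` as `y → 0⁺` and as `y → 0⁻`. -/
structure IsStrongQuantumModularForm (k : ℝ) (E : SL(2, ℤ) → GL ι ℂ) (F : ℂ → ι → ℂ) :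
    Prop where
  quantum : IsQuantumModularForm k E (fun x : ℚ => F (x : ℂ))
  upper : DifferentiableOn ℂ F {w : ℂ | 0 < w.im}
  lower : AnalyticOnNhd ℝ F {w : ℂ | w.im < 0}
  expansion : ∀ x : ℚ, ∃ a : ℕ → ι → ℂ, a 0 = F (x : ℂ) ∧ ∀ N : ℕ,
    (fun y : ℝ => F ((x : ℂ) + I * (y : ℂ)) - ∑ n ∈ Finset.range N, (I * (y : ℂ)) ^ n • a n)
      =O[𝓝[≠] (0 : ℝ)] (fun y : ℝ => y ^ N)

/-! ### False theta functions, unary theta functions and Eichler integrals -/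

/-- The shifted index `n + j / (2p)`. -/
def shift (p j : ℕ) (n : ℤ) : ℂ := (n : ℂ) + (j : ℂ) / (2 * (p : ℂ))

/-- `q ^ (p (n + j/(2p))²)` with `q = e ^ (2 π i τ)`. -/
def qTerm (p j : ℕ) (τ : ℂ) (n : ℤ) : ℂ :=
  cexp (2 * (Real.pi : ℂ) * I * τ * ((p : ℂ) * shift p j n ^ 2))

/-- The sign with the convention `sgn n = 1` for `n ≥ 0` and `-1` otherwise. -/
def sgn (n : ℤ) : ℂ := if 0 ≤ n then 1 else -1

/-- The false theta function `F_{j,p}(τ)`, for `τ` in the upper half-plane. -/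
def falseTheta (p j : ℕ) (τ : ℂ) : ℂ := ∑' n : ℤ, sgn n * qTerm p j τ n

/-- The unary theta function `f_{j,p}(τ)` of weight `3/2`, for `τ` in the upper half-plane. -/
def unaryTheta (p j : ℕ) (τ : ℂ) : ℂ := ∑' n : ℤ, shift p j n * qTerm p j τ n

/-- The normalising constant `√(2p/i)` of the Eichler integrals. -/
def eichlerConst (p : ℕ) : ℂ := (2 * (p : ℂ) / I) ^ (1 / 2 : ℂ)

/-- The integrand `f_{j,p}(z) (z - τ)^{-1/2} dz` on the vertical path `z = conj τ + i s`. -/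
def eichlerIntegrand (p j : ℕ) (τ : ℂ) (s : ℝ) : ℂ :=
  unaryTheta p j ((starRingEnd ℂ) τ + I * (s : ℂ)) /
    ((starRingEnd ℂ) τ + I * (s : ℂ) - τ) ^ (1 / 2 : ℂ) * I

/-- The non-holomorphic Eichler integral `√(2p/i) ∫_{conj τ}^{i∞} f_{j,p}(z) (z - τ)^{-1/2} dz`,
for `τ` in the lower half-plane. -/
def eichler (p j : ℕ) (τ : ℂ) : ℂ :=
  eichlerConst p * ∫ s in Set.Ioi (0 : ℝ), eichlerIntegrand p j τ s

/-- The function `F_{j,p}` on `ℍ ∪ ℍ⁻ ∪ ℚ`: the false theta function above the real line, the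
Eichler integral below, and on the real line the vertical limit from above. -/
def extF (p j : ℕ) (w : ℂ) : ℂ :=
  if 0 < w.im then falseTheta p j w
  else if w.im < 0 then eichler p j w
  else limUnder (𝓝[>] (0 : ℝ)) (fun y : ℝ => falseTheta p j (w + I * (y : ℂ)))

/-- The vector `(F_{1,p}, …, F_{p-1,p})`. -/
def vecF (p : ℕ) (w : ℂ) : Fin (p - 1) → ℂ := fun j => extF p (j + 1) w

/-- The integrand `f_{j,p}(u) (u - w)^{-1/2} du` on the path `u = i s`, `s > 0`. The root is
`√(u - w) = √i √(s + i w)`: the principal one if `w` is real or in the lower half-plane, and its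
analytic continuation in `w` to the complement of the path. -/
def errorIntegrand (p j : ℕ) (w : ℂ) (s : ℝ) : ℂ :=
  unaryTheta p j (I * (s : ℂ)) /
    (I ^ (1 / 2 : ℂ) * ((s : ℂ) + I * w) ^ (1 / 2 : ℂ)) * I

/-- The error integral `g(w) = -√(2p/i) ∫_0^{i∞} f(u) (u - w)^{-1/2} du`, componentwise. -/
def errorG (p : ℕ) (w : ℂ) : Fin (p - 1) → ℂ := fun j =>
  -eichlerConst p * ∫ s in Set.Ioi (0 : ℝ), errorIntegrand p (j + 1) w s

/-! ### The `S`-matrix -/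

/-- The matrix `S(p)` with entries `√(2/p) sin (π c j / p)`, `1 ≤ c, j ≤ p - 1`. -/
def matS (p : ℕ) : Matrix (Fin (p - 1)) (Fin (p - 1)) ℂ := fun c j =>
  ((Real.sqrt (2 / (p : ℝ)) *
    Real.sin (Real.pi * ((c : ℕ) + 1 : ℝ) * ((j : ℕ) + 1 : ℝ) / (p : ℝ)) : ℝ) : ℂ)

/-- The character of the integrable highest weight module of `A_1^{(1)}` at level `k` whose top
component is the `sl₂`-module of highest weight `a`, `0 ≤ a ≤ k`, as a function of `τ` in the
upper half-plane (the Weyl–Kac character formula, specialised to `q`-characters):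
`η(τ)⁻³ ∑ₙ (a + 1 + 2 n (k+2)) q ^ ((a + 1 + 2 n (k+2))² / (4 (k+2)))`. -/
def affineChar (k a : ℕ) (τ : ℂ) : ℂ :=
  (∑' n : ℤ, ((a : ℂ) + 1 + 2 * (n : ℂ) * ((k : ℂ) + 2)) *
    cexp (2 * (Real.pi : ℂ) * I * τ *
      (((a : ℂ) + 1 + 2 * (n : ℂ) * ((k : ℂ) + 2)) ^ 2 / (4 * ((k : ℂ) + 2))))) /
    ModularForm.eta τ ^ 3

/-- `S` is the `S`-matrix of `A_1^{(1)}` at level `k` (rows and columns indexed by the weights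
`0, …, m - 1` with `m = k + 1`): it is the matrix of `τ ↦ -1/τ` on the characters. -/
def IsAffineSMatrix (k m : ℕ) (S : Matrix (Fin m) (Fin m) ℂ) : Prop :=
  m = k + 1 ∧ ∀ (a : Fin m) (τ : ℂ), 0 < τ.im →
    affineChar k a (-1 / τ) = ∑ b : Fin m, S a b * affineChar k b τ

end QMF

end

namespace QMF

/-! ### The theta series -/

section Theta

variable {p j : ℕ} {τ : ℂ}

/-! Everything rests on the weight 3/2 vector f = `thetaVec`. Splitting the summation index modulo
2p in the functional equation of `jacobiTheta₂'`, and using that f_j is odd under j ↦ 2p - j, gives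
f(-1/τ) = (-iτ)^{3/2} S(p) f(τ) (`thetaVec_neg_inv`). The components have distinct leading
exponents, so they are linearly independent, and matrix identities can be tested on them. This
yields S(p)² = 1 and the uniqueness of the matrix E(γ) with `upperRoot γ u ^ 3` f(u) = E(γ) f(γu).
The signs in the cocycle of square roots pass into E, which becomes a multiplier system
(`isMultiplierSystem_mult`).

For w in the lower half-plane or in ℚ, the form f(u) (u - w)^{-1/2} du is carried by γ to the one
for γw, up to the weight 1/2 factor and E(γ) (`kernelTheta_moeb`). Hence F(w) is an integral from
conj w to i∞, its γ-transform is the integral of the same form from conj w to γ⁻¹∞, and the error is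
the integral from γ⁻¹∞ to i∞ (`eichlerVec_sub`). At every cusp f decays faster than any power
(`rapidDecay_thetaVec`). So this error, a `cuspIntegral`, is smooth in real w, even at the cusp, and
real-analytic away from it.

The two definitions of F meet on ℚ because a termwise Gamma integral turns the false theta series
into a half-order integral of f: the sign in the series is the sign of n + j/(2p). Above and below x
alike, F(x + iy) is √(2p) ∫_{|y|}^∞ f(x + it) (t - y)^{-1/2} dt (`vecF_vertical`). Expanding the
kernel in powers of y/t gives one asymptotic expansion for both sides
(`RapidDecay.exists_expansion`).

For w in ℍ the branch point u = w lies inside the domain of f. The substitution u = w + iζ² removes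
it, and one primitive in ζ then compares three paths: the vertical line from w, the geodesic from w
to 0, and the imaginary axis (`vecF_neg_inv_upper_of_re_ne_zero`). Points on the axis follow by a
one-sided limit. Analyticity on the lower half-plane comes from holomorphic families with values in
a Banach space (`analyticOnNhd_vecF_lower`), and the characters are the components of f divided by
η³. -/

lemma qTerm_eq (hp : p ≠ 0) (n : ℤ) :
    qTerm p j τ n = cexp (Real.pi * I * j ^ 2 / (2 * p) * τ) *
      jacobiTheta₂_term n (j * τ) (2 * p * τ) := by
  have : (p : ℂ) ≠ 0 := by exact_mod_cast hp
  rw [qTerm, shift, jacobiTheta₂_term, ← Complex.exp_add]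
  congr 1
  field_simp
  ring

lemma im_two_mul_nat_mul_pos (hp : p ≠ 0) (hτ : 0 < τ.im) : 0 < (2 * p * τ : ℂ).im := by
  have : (0 : ℝ) < p := by exact_mod_cast Nat.pos_of_ne_zero hp
  have h : (2 * p * τ : ℂ).im = 2 * p * τ.im := by
    simp [Complex.mul_im]
  rw [h]; positivity

lemma summable_qTerm (hp : p ≠ 0) (hτ : 0 < τ.im) : Summable (qTerm p j τ) := by
  simp_rw [funext (qTerm_eq (j := j) (τ := τ) hp)]
  exact ((summable_jacobiTheta₂_term_iff _ _).2 (im_two_mul_nat_mul_pos hp hτ)).mul_left _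

lemma summable_intCast_mul_qTerm (hp : p ≠ 0) (hτ : 0 < τ.im) :
    Summable (fun n : ℤ => (n : ℂ) * qTerm p j τ n) := by
  have h := ((summable_jacobiTheta₂'_term_iff (j * τ) _).2
    (im_two_mul_nat_mul_pos hp hτ)).mul_left
    (cexp (Real.pi * I * j ^ 2 / (2 * p) * τ) / (2 * Real.pi * I))
  refine h.congr fun n => ?_
  rw [qTerm_eq hp, jacobiTheta₂'_term]
  have := Complex.two_pi_I_ne_zero
  field_simp

lemma summable_shift_mul_qTerm (hp : p ≠ 0) (hτ : 0 < τ.im) :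
    Summable (fun n : ℤ => shift p j n * qTerm p j τ n) := by
  simp_rw [shift, add_mul]
  exact (summable_intCast_mul_qTerm hp hτ).add ((summable_qTerm hp hτ).mul_left _)

lemma norm_sgn (n : ℤ) : ‖sgn n‖ = 1 := by
  unfold sgn; split_ifs <;> simp

lemma summable_sgn_mul_qTerm (hp : p ≠ 0) (hτ : 0 < τ.im) :
    Summable (fun n : ℤ => sgn n * qTerm p j τ n) := by
  refine Summable.of_norm ?_
  simp_rw [norm_mul, norm_sgn, one_mul]
  exact (summable_qTerm hp hτ).norm

/-- The real number `n + j / (2p)`. -/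
noncomputable def rshift (p j : ℕ) (n : ℤ) : ℝ := (n : ℝ) + (j : ℝ) / (2 * (p : ℝ))

lemma shift_eq_ofReal (p j : ℕ) (n : ℤ) : shift p j n = (rshift p j n : ℂ) := by
  simp [shift, rshift]

lemma norm_qTerm (p j : ℕ) (τ : ℂ) (n : ℤ) :
    ‖qTerm p j τ n‖ = Real.exp (-(2 * Real.pi * p * rshift p j n ^ 2) * τ.im) := by
  rw [qTerm, Complex.norm_exp, shift_eq_ofReal]
  congr 1
  have : (2 * (Real.pi : ℂ) * I * τ * ((p : ℂ) * (rshift p j n : ℂ) ^ 2)) =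
      ((2 * Real.pi * p * rshift p j n ^ 2 : ℝ) : ℂ) * (τ * I) := by
    push_cast; ring
  rw [this, Complex.re_ofReal_mul]
  simp

/-- The integer 2pn + j is nonzero because j is not a multiple of 2p. This gap at 0 is the source of
the decay rate 2πp/(4p²) = π/(2p) at i∞. -/
lemma rshift_sq_ge (hp : p ≠ 0) (hj : 1 ≤ j) (hj' : j ≤ 2 * p - 1) (n : ℤ) :
    1 / (4 * (p : ℝ) ^ 2) ≤ rshift p j n ^ 2 := by
  have hp0 : (0 : ℝ) < p := by exact_mod_cast Nat.pos_of_ne_zero hp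
  have h1 : rshift p j n = ((2 * p * n + j : ℤ) : ℝ) / (2 * p) := by
    rw [rshift]; push_cast; field_simp
  have h2 : (2 * p * n + j : ℤ) ≠ 0 := by
    intro h
    have hd : (2 * p : ℤ) ∣ j := ⟨-n, by linarith⟩
    have := Int.le_of_dvd (by omega) hd
    omega
  have h3 : (1 : ℝ) ≤ ((2 * p * n + j : ℤ) : ℝ) ^ 2 := by
    have : (1 : ℤ) ≤ (2 * p * n + j : ℤ) ^ 2 := by
      have := sq_nonneg (2 * p * n + j : ℤ)
      have h4 : (2 * p * n + j : ℤ) ^ 2 ≠ 0 := pow_ne_zero _ h2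
      omega
    exact_mod_cast this
  rw [h1, div_pow, div_le_div_iff₀ (by positivity) (by positivity)]
  nlinarith

/-- The exponential rate at which the theta functions decay at `i∞`. -/
noncomputable def decayRate (p : ℕ) : ℝ := Real.pi / (2 * p)

lemma decayRate_pos (hp : p ≠ 0) : 0 < decayRate p := by
  have hp0 : (0 : ℝ) < p := by exact_mod_cast Nat.pos_of_ne_zero hp
  unfold decayRate; positivity

lemma norm_qTerm_le {δ : ℝ} (hτ : δ ≤ τ.im) (n : ℤ) :
    ‖qTerm p j τ n‖ ≤ ‖qTerm p j (I * δ) n‖ := by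
  rw [norm_qTerm, norm_qTerm, Real.exp_le_exp]
  simp only [mul_im, I_re, ofReal_im, mul_zero, I_im, ofReal_re, one_mul, zero_add]
  have : 0 ≤ 2 * Real.pi * p * rshift p j n ^ 2 := by positivity
  nlinarith

lemma norm_qTerm_le_exp {δ : ℝ} (hp : p ≠ 0) (hj : 1 ≤ j) (hj' : j ≤ 2 * p - 1)
    (hτ : δ ≤ τ.im) (n : ℤ) :
    ‖qTerm p j τ n‖ ≤ ‖qTerm p j (I * δ) n‖ * Real.exp (-decayRate p * (τ.im - δ)) := by
  rw [norm_qTerm, norm_qTerm, ← Real.exp_add, Real.exp_le_exp]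
  simp only [mul_im, I_re, ofReal_im, mul_zero, I_im, ofReal_re, one_mul, zero_add]
  have hp0 : (0 : ℝ) < p := by exact_mod_cast Nat.pos_of_ne_zero hp
  have h1 : decayRate p ≤ 2 * Real.pi * p * rshift p j n ^ 2 := by
    have := rshift_sq_ge hp hj hj' n
    calc decayRate p = 2 * Real.pi * p * (1 / (4 * (p : ℝ) ^ 2)) := by
          unfold decayRate; field_simp; norm_num
      _ ≤ _ := by gcongr
  nlinarith

/-- Each term is dominated by its value at iδ times one common exponential, which makes the bound
uniform in the real part. -/
lemma exists_norm_unaryTheta_le (hp : p ≠ 0) (hj : 1 ≤ j) (hj' : j ≤ 2 * p - 1)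
    {δ : ℝ} (hδ : 0 < δ) :
    ∃ K : ℝ, 0 ≤ K ∧ ∀ τ : ℂ, δ ≤ τ.im →
      ‖unaryTheta p j τ‖ ≤ K * Real.exp (-decayRate p * τ.im) := by
  have hs : Summable (fun n : ℤ => ‖shift p j n * qTerm p j (I * δ) n‖) :=
    (summable_shift_mul_qTerm hp (by simpa using hδ)).norm
  refine ⟨(∑' n : ℤ, ‖shift p j n * qTerm p j (I * δ) n‖) * Real.exp (decayRate p * δ),
    by positivity, fun τ hτ => ?_⟩
  rw [mul_assoc, ← Real.exp_add, ← tsum_mul_right, unaryTheta]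
  refine tsum_of_norm_bounded (hs.mul_right _).hasSum fun n => ?_
  rw [norm_mul, norm_mul, mul_assoc]
  gcongr
  refine (norm_qTerm_le_exp hp hj hj' hτ n).trans_eq ?_
  congr 2
  ring

lemma differentiable_qTerm (n : ℤ) : Differentiable ℂ (fun τ => qTerm p j τ n) := by
  unfold qTerm; fun_prop

lemma differentiableOn_tsum_mul_qTerm (c : ℤ → ℂ)
    (hc : ∀ τ : ℂ, 0 < τ.im → Summable (fun n : ℤ => c n * qTerm p j τ n)) :
    DifferentiableOn ℂ (fun τ => ∑' n : ℤ, c n * qTerm p j τ n) {τ | 0 < τ.im} := by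
  intro τ hτ
  have hτ' : 0 < τ.im := hτ
  -- On this half-plane the series is dominated termwise by its value at i Im τ / 2, so Weierstrass'
  -- theorem applies.
  have ho : IsOpen {z : ℂ | τ.im / 2 < z.im} := isOpen_lt continuous_const Complex.continuous_im
  have h := differentiableOn_tsum_of_summable_norm (U := {z : ℂ | τ.im / 2 < z.im})
    (F := fun (n : ℤ) z => c n * qTerm p j z n)
    (hc (I * (τ.im / 2 : ℝ)) (by simpa using hτ')).norm
    (fun n => ((differentiable_qTerm n).const_mul _).differentiableOn)
    ho (fun n z hz => by
      rw [norm_mul, norm_mul]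
      gcongr
      exact norm_qTerm_le (le_of_lt hz) n)
  exact ((h τ (by simpa using hτ')).differentiableAt
    (ho.mem_nhds (by simpa using hτ'))).differentiableWithinAt

lemma differentiableOn_unaryTheta (hp : p ≠ 0) :
    DifferentiableOn ℂ (unaryTheta p j) {τ | 0 < τ.im} :=
  differentiableOn_tsum_mul_qTerm _ fun _ hτ => summable_shift_mul_qTerm hp hτ

lemma differentiableOn_falseTheta (hp : p ≠ 0) :
    DifferentiableOn ℂ (falseTheta p j) {τ | 0 < τ.im} :=
  differentiableOn_tsum_mul_qTerm _ fun _ hτ => summable_sgn_mul_qTerm hp hτ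

lemma unaryTheta_add_one (hp : p ≠ 0) (τ : ℂ) :
    unaryTheta p j (τ + 1) = cexp (2 * Real.pi * I * (j ^ 2 / (4 * p))) * unaryTheta p j τ := by
  have hp' : (p : ℂ) ≠ 0 := by exact_mod_cast hp
  rw [unaryTheta, unaryTheta, ← tsum_mul_left]
  congr 1; ext n
  rw [mul_left_comm]
  congr 1
  rw [qTerm, qTerm, ← Complex.exp_add, Complex.exp_eq_exp_iff_exists_int]
  -- This is the integral part of p (n + j/(2p))²; the remainder j²/(4p) gives the phase.
  refine ⟨p * n ^ 2 + n * j, ?_⟩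
  rw [shift]
  push_cast
  field_simp
  ring

/-- In the coefficient n + j/(2p) the summand n comes from the z-derivative `jacobiTheta₂'` and the
constant from `jacobiTheta₂`. -/
lemma unaryTheta_eq_jacobi (hp : p ≠ 0) (hτ : 0 < τ.im) :
    unaryTheta p j τ = cexp (Real.pi * I * j ^ 2 / (2 * p) * τ) *
      (1 / (2 * Real.pi * I) * jacobiTheta₂' (j * τ) (2 * p * τ) +
        j / (2 * p) * jacobiTheta₂ (j * τ) (2 * p * τ)) := by
  have h2 := im_two_mul_nat_mul_pos hp hτ
  have h := (((hasSum_jacobiTheta₂'_term (j * τ) h2).mul_left (1 / (2 * Real.pi * I))).add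
    ((hasSum_jacobiTheta₂_term (j * τ) h2).mul_left (j / (2 * p) : ℂ))).mul_left
    (cexp (Real.pi * I * j ^ 2 / (2 * p) * τ))
  rw [← h.tsum_eq, unaryTheta]
  congr 1; ext n
  rw [qTerm_eq hp, jacobiTheta₂'_term, shift]
  have := Complex.two_pi_I_ne_zero
  field_simp

/-- The reflection n ↦ -1 - n negates the shifted index, in which the summand is odd. This leaves
only the residues 1, …, p - 1 modulo 2p. -/
lemma unaryTheta_reflect (hp : p ≠ 0) (hj : j ≤ 2 * p) (τ : ℂ) :
    unaryTheta p (2 * p - j) τ = -unaryTheta p j τ := by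
  have hp' : (p : ℂ) ≠ 0 := by exact_mod_cast hp
  have hs : ∀ n : ℤ, shift p (2 * p - j) n = -shift p j (-1 - n) := by
    intro n
    rw [shift, shift, Nat.cast_sub hj]
    push_cast
    field_simp
    ring
  rw [unaryTheta, unaryTheta, ← tsum_neg,
    ← (Equiv.subLeft (-1 : ℤ)).tsum_eq (fun n => -(shift p j n * qTerm p j τ n))]
  congr 1; ext n
  simp only [Equiv.subLeft_apply, qTerm, hs, neg_sq, neg_mul]

lemma unaryTheta_zero (τ : ℂ) : unaryTheta p 0 τ = 0 := by
  have h : unaryTheta p 0 τ = -unaryTheta p 0 τ := by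
    conv_lhs => rw [unaryTheta]
    rw [unaryTheta, ← tsum_neg,
      ← (Equiv.neg ℤ).tsum_eq (fun n => -(shift p 0 n * qTerm p 0 τ n))]
    congr 1; ext n
    simp [shift, qTerm]
  exact self_eq_neg.mp h

lemma unaryTheta_self (hp : p ≠ 0) (τ : ℂ) : unaryTheta p p τ = 0 := by
  have h := unaryTheta_reflect hp (show p ≤ 2 * p by omega) τ
  rw [show 2 * p - p = p by omega] at h
  exact self_eq_neg.mp h

end Theta

/-! ### Splitting the theta derivative by residues modulo 2p -/

section Inversion

variable {p j : ℕ} {τ : ℂ}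

/-- With the index written as 2pn + r, the quadratic exponent becomes p (n + r/(2p))² and the linear
phase depends on r alone. -/
lemma jacobiTheta₂'_eq_sum (hp : p ≠ 0) (hτ : 0 < τ.im) :
    jacobiTheta₂' (j / (2 * p)) (τ / (2 * p)) = 4 * Real.pi * I * p *
      ∑ r : Fin (2 * p), cexp (Real.pi * I * r * j / p) * unaryTheta p r τ := by
  have hp' : (p : ℂ) ≠ 0 := by exact_mod_cast hp
  have : NeZero (2 * p) := ⟨by omega⟩
  have him : 0 < (τ / (2 * p) : ℂ).im := by
    have h : (τ / (2 * p) : ℂ) = ((1 / (2 * p) : ℝ) : ℂ) * τ := by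
      push_cast; field_simp
    have hp0 : (0 : ℝ) < p := by exact_mod_cast Nat.pos_of_ne_zero hp
    rw [h, Complex.im_ofReal_mul]; positivity
  have hs : Summable (fun n : ℤ => jacobiTheta₂'_term n (j / (2 * p)) (τ / (2 * p))) :=
    (summable_jacobiTheta₂'_term_iff _ _).2 him
  rw [jacobiTheta₂', ← (Int.divModEquiv (2 * p)).symm.tsum_eq]
  have hs' := (Int.divModEquiv (2 * p)).symm.summable_iff.2 hs
  rw [← (Equiv.prodComm _ _).tsum_eq]
  refine (((Equiv.prodComm _ _).summable_iff).2 hs').tsum_prod.trans ?_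
  rw [tsum_fintype, Finset.mul_sum]
  refine Finset.sum_congr rfl fun r _ => ?_
  rw [unaryTheta, ← tsum_mul_left, ← tsum_mul_left]
  congr 1; ext n
  simp only [Function.comp_apply, Equiv.prodComm_apply, Prod.swap_prod_mk,
    Int.divModEquiv_symm_apply, jacobiTheta₂'_term, jacobiTheta₂_term, qTerm, shift]
  have h1 : cexp (2 * Real.pi * I * ((((n * ((2 * p : ℕ) : ℤ) + (r : ℕ) : ℤ)) : ℂ)) *
      (j / (2 * p)) + Real.pi * I * ((((n * ((2 * p : ℕ) : ℤ) + (r : ℕ) : ℤ)) : ℂ)) ^ 2 *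
        (τ / (2 * p))) =
      cexp (Real.pi * I * r * j / p) *
        cexp (2 * Real.pi * I * τ * (p * (n + (r : ℕ) / (2 * p)) ^ 2)) := by
    rw [← Complex.exp_add, Complex.exp_eq_exp_iff_exists_int]
    -- The phase (2pn + r) j/(2p) differs from rj/(2p) by the integer nj.
    refine ⟨n * j, ?_⟩
    push_cast
    field_simp
    ring
  simp only [Int.cast_natCast, Int.cast_add, Int.cast_mul] at h1 ⊢
  rw [h1]
  push_cast
  field_simp
  ring

/-- Pairs r with 2p - r; the two fixed residues 0 and p contribute nothing. -/
lemma sum_fin_two_mul (hp : p ≠ 0) (F : ℕ → ℂ) (h0 : F 0 = 0) (h1 : F p = 0) :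
    ∑ r : Fin (2 * p), F r = ∑ c : Fin (p - 1), (F (c + 1) + F (2 * p - (c + 1))) := by
  rw [Fin.sum_univ_eq_sum_range, Fin.sum_univ_eq_sum_range
    (fun c => F (c + 1) + F (2 * p - (c + 1))), Finset.sum_add_distrib]
  obtain ⟨q, rfl⟩ : ∃ q, p = q + 1 := ⟨p - 1, by omega⟩
  rw [show 2 * (q + 1) = (q + 1) + (q + 1) by ring, Finset.sum_range_add,
    Finset.sum_range_succ', h0, Finset.sum_range_succ' (fun x => F (q + 1 + x))]
  simp only [add_zero, h1, Nat.add_sub_cancel]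
  congr 1
  rw [← Finset.sum_range_reflect]
  refine Finset.sum_congr rfl fun x hx => ?_
  congr 1
  have := Finset.mem_range.1 hx
  omega

/-- The components at r and 2p - r are opposite and their phases conjugate, so each pair produces a
sine. -/
lemma jacobiTheta₂'_eq_sum_sin (hp : p ≠ 0) (hτ : 0 < τ.im) :
    jacobiTheta₂' (j / (2 * p)) (τ / (2 * p)) = -8 * Real.pi * p *
      ∑ c : Fin (p - 1), (Real.sin (Real.pi * j * ((c : ℕ) + 1) / p) : ℂ) *
        unaryTheta p (c + 1) τ := by
  have hp' : (p : ℂ) ≠ 0 := by exact_mod_cast hp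
  rw [jacobiTheta₂'_eq_sum hp hτ, sum_fin_two_mul hp
    (fun r => cexp (Real.pi * I * r * j / p) * unaryTheta p r τ)
    (by simp [unaryTheta_zero]) (by simp [unaryTheta_self hp]), Finset.mul_sum, Finset.mul_sum]
  refine Finset.sum_congr rfl fun c _ => ?_
  have hc : (c : ℕ) + 1 ≤ 2 * p := by have := c.2; omega
  rw [unaryTheta_reflect hp hc]
  have h2 : cexp (Real.pi * I * ((2 * p - ((c : ℕ) + 1) : ℕ) : ℂ) * j / p) =
      cexp (-(Real.pi * j * ((c : ℕ) + 1) / p * I)) := by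
    rw [Complex.exp_eq_exp_iff_exists_int]
    refine ⟨j, ?_⟩
    rw [Nat.cast_sub hc]
    push_cast
    field_simp
    ring
  rw [h2, Complex.ofReal_sin, Complex.sin]
  push_cast
  rw [show Real.pi * I * ((c : ℂ) + 1) * j / p = Real.pi * j * ((c : ℂ) + 1) / p * I by ring,
    show -((Real.pi : ℂ) * j * ((c : ℂ) + 1) / p) * I =
      -((Real.pi : ℂ) * j * ((c : ℂ) + 1) / p * I) by ring]
  ring_nf

end Inversion

/-! ### Square roots -/

section Roots

variable {z w s : ℂ}

lemma cpow_half_sq (z : ℂ) : (z ^ (1 / 2 : ℂ)) ^ 2 = z := by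
  simp

lemma cpow_half_mul_self (z : ℂ) : z ^ (1 / 2 : ℂ) * z ^ (1 / 2 : ℂ) = z := by
  rw [← sq, cpow_half_sq]

lemma cpow_half_ne_zero (hz : z ≠ 0) : z ^ (1 / 2 : ℂ) ≠ 0 := by
  intro h
  have := cpow_half_sq z
  rw [h] at this
  exact hz (by simpa using this.symm)

lemma sq_cpow_half_of_arg (h1 : -(Real.pi / 2) < s.arg) (h2 : s.arg ≤ Real.pi / 2) :
    (s ^ 2) ^ (1 / 2 : ℂ) = s := by
  have := Complex.pow_cpow_nat_inv (x := s) (n := 2) two_ne_zero (by simpa using h1)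
    (by simpa using h2)
  simpa using this

lemma cpow_half_eq_of_re_pos (h : s ^ 2 = z) (hs : 0 < s.re) : z ^ (1 / 2 : ℂ) = s := by
  have := Complex.abs_arg_lt_pi_div_two_iff.2 (Or.inl hs)
  rw [abs_lt] at this
  rw [← h, sq_cpow_half_of_arg this.1 this.2.le]

lemma cpow_half_eq_of_re_zero (h : s ^ 2 = z) (hs : s.re = 0) (hs' : 0 ≤ s.im) :
    z ^ (1 / 2 : ℂ) = s := by
  rcases hs'.eq_or_lt with h0 | h0
  · have : s = 0 := Complex.ext hs h0.symm
    rw [← h, this]; simp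
  · have h1 : s.arg = Real.pi / 2 := Complex.arg_eq_pi_div_two_iff.2 ⟨hs, h0⟩
    rw [← h, sq_cpow_half_of_arg (by rw [h1]; linarith [Real.pi_pos]) h1.le]

lemma cpow_half_re_pos (hz : z ∈ slitPlane) : 0 < (z ^ (1 / 2 : ℂ)).re := by
  have h0 := slitPlane_ne_zero hz
  rw [mem_slitPlane_iff_arg] at hz
  rw [Complex.cpow_def_of_ne_zero h0, Complex.exp_re]
  refine mul_pos (Real.exp_pos _) (Real.cos_pos_of_mem_Ioo ?_)
  have h1 := Complex.neg_pi_lt_arg z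
  have h2 := lt_of_le_of_ne (Complex.arg_le_pi z) hz.1
  have h3 : (Complex.log z * (1 / 2)).im = z.arg / 2 := by
    rw [show (1 / 2 : ℂ) = ((1 / 2 : ℝ) : ℂ) by push_cast; rfl, Complex.im_mul_ofReal,
      Complex.log_im]; ring
  rw [h3]
  constructor <;> linarith

lemma im_eq_two_mul_re_mul_im (z : ℂ) :
    z.im = 2 * (z ^ (1 / 2 : ℂ)).re * (z ^ (1 / 2 : ℂ)).im := by
  conv_lhs => rw [← cpow_half_mul_self z, Complex.mul_im]
  ring

lemma cpow_half_im_pos (hz : 0 < z.im) : 0 < (z ^ (1 / 2 : ℂ)).im := by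
  have h1 := cpow_half_re_pos (z := z) (Or.inr hz.ne')
  have h2 := im_eq_two_mul_re_mul_im z
  by_contra h
  nlinarith

lemma cpow_half_im_neg (hz : z.im < 0) : (z ^ (1 / 2 : ℂ)).im < 0 := by
  have h1 := cpow_half_re_pos (z := z) (Or.inr hz.ne)
  have h2 := im_eq_two_mul_re_mul_im z
  by_contra h
  nlinarith

lemma cpow_half_ofReal {r : ℝ} (hr : 0 ≤ r) : (r : ℂ) ^ (1 / 2 : ℂ) = (Real.sqrt r : ℂ) := by
  rw [Real.sqrt_eq_rpow, Complex.ofReal_cpow hr]; norm_num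

lemma cpow_half_neg_ofReal {r : ℝ} (hr : 0 ≤ r) :
    (-(r : ℂ)) ^ (1 / 2 : ℂ) = I * (Real.sqrt r : ℂ) := by
  refine cpow_half_eq_of_re_zero ?_ (by simp) (by simp [Real.sqrt_nonneg])
  rw [mul_pow, I_sq, ← Complex.ofReal_pow, Real.sq_sqrt hr]; ring

lemma cpow_half_ofReal_mul {r : ℝ} (hr : 0 ≤ r) (z : ℂ) :
    ((r : ℂ) * z) ^ (1 / 2 : ℂ) = (Real.sqrt r : ℂ) * z ^ (1 / 2 : ℂ) := by
  by_cases hz : z ∈ slitPlane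
  · rcases hr.eq_or_lt with rfl | hr
    · simp
    · refine cpow_half_eq_of_re_pos ?_ ?_
      · rw [mul_pow, cpow_half_sq, ← Complex.ofReal_pow, Real.sq_sqrt hr.le]
      · rw [Complex.re_ofReal_mul]
        exact mul_pos (Real.sqrt_pos.2 hr) (cpow_half_re_pos hz)
  · rw [mem_slitPlane_iff, not_or, not_lt, not_not] at hz
    obtain ⟨t, ht, rfl⟩ : ∃ t : ℝ, 0 ≤ t ∧ z = -(t : ℂ) :=
      ⟨-z.re, by linarith [hz.1], by apply Complex.ext <;> simp [hz.2]⟩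
    rw [mul_neg, ← Complex.ofReal_mul, cpow_half_neg_ofReal (by positivity),
      cpow_half_neg_ofReal ht, Real.sqrt_mul hr]
    push_cast; ring

lemma norm_cpow_half (z : ℂ) : ‖z ^ (1 / 2 : ℂ)‖ = Real.sqrt ‖z‖ := by
  rw [eq_comm, Real.sqrt_eq_iff_mul_self_eq (norm_nonneg _) (norm_nonneg _), ← norm_mul,
    cpow_half_mul_self]

lemma differentiableAt_cpow_half (hz : z ∈ slitPlane) :
    DifferentiableAt ℂ (fun z => z ^ (1 / 2 : ℂ)) z :=
  (Complex.hasStrictDerivAt_cpow_const (c := 1 / 2) hz).hasDerivAt.differentiableAt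

/-- `e ^ (π i / 4)`, the principal square root of `i`. -/
lemma I_cpow_half : I ^ (1 / 2 : ℂ) = cexp (Real.pi * I / 4) := by
  rw [Complex.cpow_def_of_ne_zero I_ne_zero, Complex.log_I]
  congr 1; ring

/-- Multiplication by `√i` turns the principal root of `-i z` into that of `z` on the
closed upper half-plane. -/
lemma cpow_half_eq_I_mul (hz : 0 ≤ z.im) :
    z ^ (1 / 2 : ℂ) = I ^ (1 / 2 : ℂ) * (-I * z) ^ (1 / 2 : ℂ) := by
  by_cases h0 : z = 0
  · simp [h0]
  have h1 : z = I * (-I * z) := by rw [← mul_assoc, mul_neg, I_mul_I]; simp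
  have ha : (-I * z).arg ∈ Set.Icc (-(Real.pi / 2)) (Real.pi / 2) := by
    have h : 0 ≤ (-I * z).re := by simpa using hz
    have := Complex.abs_arg_le_pi_div_two_iff.2 h
    rwa [abs_le] at this
  have hne : -I * z ≠ 0 := by simp [h0]
  conv_lhs => rw [h1]
  rw [Complex.cpow_def_of_ne_zero (by rwa [← h1]), Complex.cpow_def_of_ne_zero I_ne_zero,
    Complex.cpow_def_of_ne_zero hne, ← Complex.exp_add, ← add_mul]
  rw [Complex.log_mul I_ne_zero hne]
  rw [Complex.arg_I]
  constructor <;> linarith [ha.1, ha.2, Real.pi_pos]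

end Roots

/-! ### The inversion law with the sine matrix -/

section Inversion

variable {p j : ℕ} {τ : ℂ}

lemma im_neg_one_div_pos (hτ : 0 < τ.im) : 0 < (-1 / τ).im := by
  have h0 : τ ≠ 0 := by rintro rfl; simp at hτ
  rw [neg_div, Complex.neg_im, one_div, Complex.inv_im, neg_div, neg_neg]
  exact div_pos hτ (Complex.normSq_pos.2 h0)

/-- The functional equation of `jacobiTheta₂'` at (j/(2p), τ/(2p)) has the sine sum on one side. On
the other side, the term produced by differentiating the Gaussian factor is exactly the j/(2p) part
of the coefficient n + j/(2p). -/
lemma unaryTheta_neg_inv (hp : p ≠ 0) (hτ : 0 < τ.im) :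
    unaryTheta p j (-1 / τ) = -I * τ * (-I * τ) ^ (1 / 2 : ℂ) * ((Real.sqrt (2 / p) : ℝ) : ℂ) *
      ∑ c : Fin (p - 1), (Real.sin (Real.pi * j * ((c : ℕ) + 1) / p) : ℂ) *
        unaryTheta p (c + 1) τ := by
  have hp' : (p : ℂ) ≠ 0 := by exact_mod_cast hp
  have hp0 : (0 : ℝ) < p := by exact_mod_cast Nat.pos_of_ne_zero hp
  have h0 : τ ≠ 0 := by rintro rfl; simp at hτ
  have hpi : (Real.pi : ℂ) ≠ 0 := by exact_mod_cast Real.pi_ne_zero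
  set Sg := ∑ c : Fin (p - 1), (Real.sin (Real.pi * j * ((c : ℕ) + 1) / p) : ℂ) *
        unaryTheta p (c + 1) τ with hSg
  have h1 := jacobiTheta₂'_eq_sum_sin (j := j) hp hτ
  rw [← hSg, jacobiTheta₂'_functional_equation] at h1
  have e1 : (j / (2 * p) / (τ / (2 * p)) : ℂ) = j / τ := by field_simp
  have e2 : -1 / (τ / (2 * p)) = 2 * p * (-1 / τ) := by field_simp
  have e3 : (-I * (τ / (2 * p))) ^ (1 / 2 : ℂ) =
      ((Real.sqrt (1 / (2 * p)) : ℝ) : ℂ) * (-I * τ) ^ (1 / 2 : ℂ) := by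
    rw [← cpow_half_ofReal_mul (by positivity)]
    congr 1; push_cast; field_simp
  have e4 : -Real.pi * I * (j / (2 * p)) ^ 2 / (τ / (2 * p)) =
      Real.pi * I * j ^ 2 / (2 * p) * (-1 / τ) := by field_simp
  rw [e1, e2, e3, e4] at h1
  rw [unaryTheta_eq_jacobi hp (im_neg_one_div_pos hτ),
    show (j : ℂ) * (-1 / τ) = -(j / τ) by ring, jacobiTheta₂'_neg_left, jacobiTheta₂_neg_left]
  have hr : (-I * τ) ^ (1 / 2 : ℂ) ≠ 0 := cpow_half_ne_zero (by simp [h0])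
  have hs0 : ((Real.sqrt (1 / (2 * p)) : ℝ) : ℂ) ≠ 0 := by
    exact_mod_cast (Real.sqrt_pos.2 (by positivity)).ne'
  have hs : ((Real.sqrt (2 / p) : ℝ) : ℂ) = 2 * ((Real.sqrt (1 / (2 * p)) : ℝ) : ℂ) := by
    have : Real.sqrt (2 / p) = 2 * Real.sqrt (1 / (2 * p)) := by
      rw [Real.sqrt_eq_iff_mul_self_eq (by positivity) (by positivity)]
      rw [mul_mul_mul_comm, Real.mul_self_sqrt (by positivity)]
      field_simp
    rw [this]; push_cast; rfl
  rw [hs]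
  set X := cexp (Real.pi * I * j ^ 2 / (2 * p) * (-1 / τ))
  set A := jacobiTheta₂' (j / τ) (2 * p * (-1 / τ))
  set B := jacobiTheta₂ (j / τ) (2 * p * (-1 / τ))
  set R := (-I * τ) ^ (1 / 2 : ℂ)
  set q := ((Real.sqrt (1 / (2 * p)) : ℝ) : ℂ)
  have h2 : X * (A - 2 * Real.pi * I * (j / (2 * p)) * B) = -4 * Real.pi * τ * q * R * Sg := by
    field_simp at h1 ⊢
    linear_combination h1 / 2
  have h3 : X * (1 / (2 * Real.pi * I) * -A + j / (2 * p) * B) =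
      -(1 / (2 * Real.pi * I)) * (X * (A - 2 * Real.pi * I * (j / (2 * p)) * B)) := by
    field_simp
    ring
  rw [h3, h2]
  field_simp
  rw [I_sq]; ring

end Inversion

/-- The vector `(f_{1,p}, …, f_{p-1,p})` of unary theta functions. -/
noncomputable def thetaVec (p : ℕ) (z : ℂ) : Fin (p - 1) → ℂ := fun j => unaryTheta p (j + 1) z

lemma thetaVec_neg_inv {p : ℕ} (hp : p ≠ 0) {τ : ℂ} (hτ : 0 < τ.im) :
    thetaVec p (-1 / τ) = (-I * τ * (-I * τ) ^ (1 / 2 : ℂ)) • (matS p *ᵥ thetaVec p τ) := by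
  ext j
  simp only [thetaVec, Pi.smul_apply, smul_eq_mul, Matrix.mulVec, dotProduct, matS]
  rw [unaryTheta_neg_inv hp hτ, mul_assoc (-I * τ * (-I * τ) ^ (1 / 2 : ℂ)), Finset.mul_sum]
  congr 1
  refine Finset.sum_congr rfl fun c _ => ?_
  push_cast
  ring_nf

lemma thetaVec_add_one {p : ℕ} (hp : p ≠ 0) (τ : ℂ) :
    thetaVec p (τ + 1) = Matrix.diagonal (fun j : Fin (p - 1) =>
      cexp (2 * Real.pi * I * (((j : ℕ) + 1) ^ 2 / (4 * p)))) *ᵥ thetaVec p τ := by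
  ext j
  rw [Matrix.mulVec_diagonal, thetaVec, thetaVec, unaryTheta_add_one hp]
  push_cast; rfl

lemma differentiableOn_thetaVec {p : ℕ} (hp : p ≠ 0) :
    DifferentiableOn ℂ (thetaVec p) {τ | 0 < τ.im} :=
  differentiableOn_pi.2 fun _ => differentiableOn_unaryTheta hp

lemma exists_norm_thetaVec_le {p : ℕ} (hp : p ≠ 0) {δ : ℝ} (hδ : 0 < δ) :
    ∃ K : ℝ, 0 ≤ K ∧ ∀ τ : ℂ, δ ≤ τ.im →
      ‖thetaVec p τ‖ ≤ K * Real.exp (-decayRate p * τ.im) := by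
  have h : ∀ j : Fin (p - 1), ∃ K : ℝ, 0 ≤ K ∧ ∀ τ : ℂ, δ ≤ τ.im →
      ‖unaryTheta p (j + 1) τ‖ ≤ K * Real.exp (-decayRate p * τ.im) := fun j =>
    exists_norm_unaryTheta_le hp (by omega) (by omega) hδ
  choose K hK0 hK using h
  refine ⟨∑ j, K j, Finset.sum_nonneg fun j _ => hK0 j, fun τ hτ => ?_⟩
  rw [pi_norm_le_iff_of_nonneg (by have := Finset.sum_nonneg fun j (_ : j ∈ Finset.univ) => hK0 j; positivity)]
  intro j
  refine (hK j τ hτ).trans ?_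
  gcongr
  exact Finset.single_le_sum (fun j _ => hK0 j) (Finset.mem_univ j)

/-! ### Linear independence -/

/-- The factor cancels the leading exponent i²/(4p) of the i-th component. All other exponents (2pn
+ j)²/(4p) with j ≥ i are strictly larger. -/
lemma tendsto_exp_mul_unaryTheta {p j i : ℕ} (hp : p ≠ 0) (hj : 1 ≤ i) (hij : i ≤ j)
    (hj' : j < p) :
    Tendsto (fun t : ℝ => cexp (2 * Real.pi * (i ^ 2 / (4 * p)) * t) * unaryTheta p j (I * t))
      atTop (𝓝 (if j = i then (j : ℂ) / (2 * p) else 0)) := by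
  have hp0 : (0 : ℝ) < p := by exact_mod_cast Nat.pos_of_ne_zero hp
  have hp' : (p : ℂ) ≠ 0 := by exact_mod_cast hp
  set l : ℤ → ℂ := fun n => if n = 0 ∧ j = i then (j : ℂ) / (2 * p) else 0 with hl
  have hsum : ∑' n, l n = if j = i then (j : ℂ) / (2 * p) else 0 := by
    rw [tsum_eq_single 0 (fun n hn => by simp [hl, hn])]
    simp [hl]
  have hterm : ∀ (t : ℝ) (n : ℤ), cexp (2 * Real.pi * (i ^ 2 / (4 * p)) * t) *
      (shift p j n * qTerm p j (I * t) n) =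
      shift p j n * ((Real.exp (-(2 * Real.pi * (p * rshift p j n ^ 2 - i ^ 2 / (4 * p))) * t) : ℝ) : ℂ) := by
    intro t n
    rw [mul_left_comm, qTerm, ← Complex.exp_add, shift_eq_ofReal]
    push_cast
    congr 2
    linear_combination (2 * Real.pi * t * (p * (rshift p j n : ℂ) ^ 2)) * I_sq
  have hmul : ∀ t : ℝ, cexp (2 * Real.pi * (i ^ 2 / (4 * p)) * t) * unaryTheta p j (I * t) =
      ∑' n, cexp (2 * Real.pi * (i ^ 2 / (4 * p)) * t) * (shift p j n * qTerm p j (I * t) n) :=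
    fun t => by rw [tsum_mul_left, unaryTheta]
  simp_rw [hmul]
  rw [← hsum]
  have hexp : ∀ n : ℤ, p * rshift p j n ^ 2 - (i : ℝ) ^ 2 / (4 * p) =
      (((2 * p * n + j : ℤ) : ℝ) ^ 2 - (i : ℝ) ^ 2) / (4 * p) := by
    intro n; rw [rshift]; push_cast; field_simp; ring
  -- For n ≠ 0 one has |2pn + j| ≥ 2p - j > p > i.
  have hlt : ∀ n : ℤ, n ≠ 0 → (i : ℤ) ^ 2 < (2 * p * n + j : ℤ) ^ 2 := by
    intro n hn
    rw [sq_lt_sq, Nat.abs_cast, lt_abs]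
    rcases lt_or_gt_of_ne hn with h | h
    · right
      have : (p : ℤ) * n ≤ p * (-1) := by gcongr; omega
      nlinarith
    · left
      have : (p : ℤ) * 1 ≤ p * n := by gcongr; omega
      nlinarith
  have hnn : ∀ n : ℤ, 0 ≤ p * rshift p j n ^ 2 - (i : ℝ) ^ 2 / (4 * p) := by
    intro n
    rw [hexp]
    refine div_nonneg (sub_nonneg.2 ?_) (by positivity)
    by_cases hn : n = 0
    · subst hn
      have : (i : ℝ) ≤ j := by exact_mod_cast hij
      simp only [mul_zero, zero_add, Int.cast_natCast]
      gcongr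
    · exact_mod_cast (hlt n hn).le
  have hpos : ∀ n : ℤ, ¬ (n = 0 ∧ j = i) →
      0 < p * rshift p j n ^ 2 - (i : ℝ) ^ 2 / (4 * p) := by
    intro n h
    rw [hexp]
    refine div_pos (sub_pos.2 ?_) (by positivity)
    by_cases hn : n = 0
    · subst hn
      have : (i : ℝ) < j := by
        have : i < j := lt_of_le_of_ne hij (fun e => h ⟨rfl, e.symm⟩)
        exact_mod_cast this
      simp only [mul_zero, zero_add, Int.cast_natCast]
      gcongr
    · exact_mod_cast hlt n hn
  -- The normalised exponents are nonnegative, so for t ≥ 1 the terms are dominated by those at t =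
  -- 1.
  refine tendsto_tsum_of_dominated_convergence (bound := fun n =>
    ‖cexp (2 * Real.pi * (i ^ 2 / (4 * p)) * (1 : ℝ)) *
      (shift p j n * qTerm p j (I * (1 : ℝ)) n)‖)
    ((summable_shift_mul_qTerm hp (by simp)).mul_left _).norm (fun n => ?_) ?_
  · simp_rw [hterm]
    by_cases h : n = 0 ∧ j = i
    · have h2 : p * rshift p j n ^ 2 - (i : ℝ) ^ 2 / (4 * p) = 0 := by
        rw [hexp, h.1, h.2]; simp
      simp only [h2, hl, if_pos h]
      rw [h.1]
      simp [shift]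
    · simp only [hl, if_neg h]
      rw [← mul_zero (shift p j n)]
      refine Tendsto.const_mul _ ?_
      rw [← Complex.ofReal_zero]
      refine (Complex.continuous_ofReal.tendsto 0).comp ?_
      refine Real.tendsto_exp_atBot.comp ?_
      refine Tendsto.const_mul_atTop_of_neg ?_ tendsto_id
      have := hpos n h
      have := Real.pi_pos
      simp only [neg_lt_zero]; positivity
  · filter_upwards [eventually_ge_atTop (1 : ℝ)] with t ht n
    rw [hterm, hterm, norm_mul, norm_mul]
    gcongr
    rw [Complex.norm_real, Complex.norm_real, Real.norm_of_nonneg (Real.exp_pos _).le,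
      Real.norm_of_nonneg (Real.exp_pos _).le, Real.exp_le_exp]
    have := hnn n
    have h3 : 0 ≤ 2 * Real.pi * (p * rshift p j n ^ 2 - (i : ℝ) ^ 2 / (4 * p)) := by positivity
    nlinarith

/-- The components of the theta vector are linearly independent functions on `ℍ`. -/
lemma eq_zero_of_sum_mul_thetaVec {p : ℕ} (hp : p ≠ 0) (v : Fin (p - 1) → ℂ)
    (h : ∀ τ : ℂ, 0 < τ.im → ∑ j, v j * thetaVec p τ j = 0) : v = 0 := by
  by_contra hv
  -- The least index with a nonzero coefficient has the slowest decay; after rescaling by it only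
  -- that component survives at i∞.
  have hne : ∃ n : ℕ, ∃ hn : n < p - 1, v ⟨n, hn⟩ ≠ 0 := by
    obtain ⟨j, hj⟩ := Function.ne_iff.1 hv
    exact ⟨j, j.2, hj⟩
  classical
  obtain ⟨hn, hvn⟩ := Nat.find_spec hne
  set n := Nat.find hne
  have hmin : ∀ j : Fin (p - 1), (j : ℕ) < n → v j = 0 := by
    intro j hj
    by_contra hc
    exact Nat.find_min hne hj ⟨j.2, hc⟩
  have hp' : (p : ℂ) ≠ 0 := by exact_mod_cast hp
  have h1 : Tendsto (fun t : ℝ => ∑ j : Fin (p - 1), v j *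
      (cexp (2 * Real.pi * (((n + 1 : ℕ) : ℂ) ^ 2 / (4 * p)) * t) * unaryTheta p (j + 1) (I * t)))
      atTop (𝓝 (∑ j : Fin (p - 1), v j *
        (if (j : ℕ) + 1 = n + 1 then (((j : ℕ) + 1 : ℕ) : ℂ) / (2 * p) else 0))) := by
    refine tendsto_finsetSum _ fun j _ => ?_
    by_cases hj : (j : ℕ) < n
    · simp [hmin j hj]
    · exact (tendsto_exp_mul_unaryTheta hp (by omega) (by omega) (by omega)).const_mul _
  have h2 : (fun t : ℝ => ∑ j : Fin (p - 1), v j *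
      (cexp (2 * Real.pi * (((n + 1 : ℕ) : ℂ) ^ 2 / (4 * p)) * t) * unaryTheta p (j + 1) (I * t)))
      =ᶠ[atTop] fun _ => 0 := by
    filter_upwards [eventually_gt_atTop (0 : ℝ)] with t ht
    have := h (I * t) (by simpa using ht)
    simp_rw [mul_left_comm (v _)]
    rw [← Finset.mul_sum]
    simp only [thetaVec] at this
    rw [this, mul_zero]
  have h3 := tendsto_nhds_unique (h1.congr' h2) tendsto_const_nhds
  rw [Finset.sum_eq_single (⟨n, hn⟩ : Fin (p - 1))] at h3
  · simp only [if_true] at h3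
    have : (((n + 1 : ℕ) : ℂ)) ≠ 0 := by exact_mod_cast Nat.succ_ne_zero n
    have h4 : ((n + 1 : ℕ) : ℂ) / (2 * p) ≠ 0 := div_ne_zero this (by simp [hp'])
    exact (mul_ne_zero hvn h4) h3
  · intro b _ hb
    have : (b : ℕ) + 1 ≠ n + 1 := fun e => hb (Fin.ext (by simpa using e))
    rw [if_neg this, mul_zero]
  · simp

/-- Turns a comparison of two transformation laws into an equality of matrices. -/
lemma matrix_eq_of_mulVec_thetaVec {p : ℕ} (hp : p ≠ 0)
    {A B : Matrix (Fin (p - 1)) (Fin (p - 1)) ℂ}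
    (h : ∀ τ : ℂ, 0 < τ.im → A *ᵥ thetaVec p τ = B *ᵥ thetaVec p τ) : A = B := by
  ext i j
  have := eq_zero_of_sum_mul_thetaVec hp (fun j => A i j - B i j) (fun τ hτ => by
    have h1 := congrFun (h τ hτ) i
    simp only [Matrix.mulVec, dotProduct] at h1
    simp_rw [sub_mul]
    rw [Finset.sum_sub_distrib, h1, sub_self])
  exact sub_eq_zero.1 (congrFun this j)

lemma neg_one_div_neg_one_div (τ : ℂ) : -1 / (-1 / τ) = τ := by
  rw [div_div_eq_mul_div]; simp

lemma neg_I_mul_neg_one_div (τ : ℂ) : -I * (-1 / τ) = (-I * τ)⁻¹ := by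
  rw [mul_inv, inv_neg, inv_I]; ring

lemma cpow_half_neg_I_inv {τ : ℂ} (hτ : 0 < τ.im) :
    ((-I * τ)⁻¹) ^ (1 / 2 : ℂ) = ((-I * τ) ^ (1 / 2 : ℂ))⁻¹ := by
  refine Complex.inv_cpow _ _ ?_
  have h : 0 < (-I * τ).re := by simpa using hτ
  exact (mem_slitPlane_iff_arg.1 (Or.inl h)).1

/-- Applying τ ↦ -1/τ twice gives the identity and the two automorphy factors cancel, so no
trigonometric sum has to be evaluated. -/
lemma matS_mul_self {p : ℕ} (hp : p ≠ 0) : matS p * matS p = 1 := by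
  refine matrix_eq_of_mulVec_thetaVec hp fun τ hτ => ?_
  have h0 : -I * τ ≠ 0 := by
    rintro h
    have : τ = 0 := by simpa using h
    simp [this] at hτ
  have h1 := thetaVec_neg_inv hp (im_neg_one_div_pos hτ)
  rw [neg_one_div_neg_one_div, thetaVec_neg_inv hp hτ, neg_I_mul_neg_one_div,
    cpow_half_neg_I_inv hτ, Matrix.mulVec_smul, smul_smul, Matrix.mulVec_mulVec] at h1
  have h2 := cpow_half_ne_zero h0
  rw [← mul_inv, inv_mul_cancel₀ (mul_ne_zero h0 h2), one_smul] at h1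
  rw [← h1, Matrix.one_mulVec]

/-! ### Möbius transformations and automorphy factors -/

section Moebius

variable {γ γ₁ γ₂ : SL(2, ℤ)} {w u : ℂ}

lemma det_cast (γ : SL(2, ℤ)) :
    ((γ 0 0 : ℤ) : ℂ) * ((γ 1 1 : ℤ) : ℂ) - ((γ 0 1 : ℤ) : ℂ) * ((γ 1 0 : ℤ) : ℂ) = 1 := by
  have := γ.2
  rw [Matrix.det_fin_two] at this
  exact_mod_cast this

lemma conj_den (γ : SL(2, ℤ)) (w : ℂ) :
    (starRingEnd ℂ) (den γ w) = den γ ((starRingEnd ℂ) w) := by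
  simp [den]

lemma conj_moeb (γ : SL(2, ℤ)) (w : ℂ) :
    (starRingEnd ℂ) (moeb γ w) = moeb γ ((starRingEnd ℂ) w) := by
  simp [moeb, conj_den]

lemma den_im (γ : SL(2, ℤ)) (w : ℂ) : (den γ w).im = (γ 1 0 : ℤ) * w.im := by
  simp [den]

lemma den_ne_zero_of_im (hw : w.im ≠ 0) : den γ w ≠ 0 := by
  intro h
  have h1 := den_im γ w
  rw [h, Complex.zero_im, eq_comm, mul_eq_zero, or_iff_left hw] at h1
  have hc : γ 1 0 = 0 := by exact_mod_cast h1
  have h2 := det_cast γ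
  rw [den, hc] at h
  simp only [Int.cast_zero, zero_mul, zero_add] at h
  rw [hc, h] at h2
  simp at h2

lemma sl_mul_apply (γ₁ γ₂ : SL(2, ℤ)) (i j : Fin 2) :
    (γ₁ * γ₂) i j = γ₁ i 0 * γ₂ 0 j + γ₁ i 1 * γ₂ 1 j := by
  rw [Matrix.SpecialLinearGroup.coe_mul, Matrix.mul_apply, Fin.sum_univ_two]

lemma den_mul (h : den γ₂ w ≠ 0) :
    den (γ₁ * γ₂) w = den γ₁ (moeb γ₂ w) * den γ₂ w := by
  have h1 : moeb γ₂ w * den γ₂ w = ((γ₂ 0 0 : ℤ) : ℂ) * w + ((γ₂ 0 1 : ℤ) : ℂ) :=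
    div_mul_cancel₀ _ h
  rw [den, den, add_mul, mul_assoc, h1, den, sl_mul_apply, sl_mul_apply]
  push_cast
  ring

lemma moeb_mul (h : den γ₂ w ≠ 0) : moeb (γ₁ * γ₂) w = moeb γ₁ (moeb γ₂ w) := by
  have h1 : moeb γ₂ w * den γ₂ w = ((γ₂ 0 0 : ℤ) : ℂ) * w + ((γ₂ 0 1 : ℤ) : ℂ) :=
    div_mul_cancel₀ _ h
  rw [moeb, den_mul h, moeb.eq_1 γ₁, ← mul_div_mul_right _ (den γ₁ (moeb γ₂ w)) h]
  congr 1
  rw [add_mul, mul_assoc, h1, den, sl_mul_apply, sl_mul_apply]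
  push_cast
  ring

lemma moeb_one (w : ℂ) : moeb 1 w = w := by simp [moeb, den]

lemma moeb_inv_moeb (h : den γ w ≠ 0) : moeb γ⁻¹ (moeb γ w) = w := by
  rw [← moeb_mul h, inv_mul_cancel, moeb_one]

lemma moeb_moeb_inv (h : den γ⁻¹ w ≠ 0) : moeb γ (moeb γ⁻¹ w) = w := by
  rw [← moeb_mul h, mul_inv_cancel, moeb_one]

lemma moeb_sub_moeb (hu : den γ u ≠ 0) (hw : den γ w ≠ 0) :
    moeb γ u - moeb γ w = (u - w) / (den γ u * den γ w) := by
  have hd := det_cast γ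
  rw [moeb, moeb, div_sub_div _ _ hu hw]
  congr 1
  simp only [den]
  linear_combination (u - w) * hd

/-- This is the difference formula `moeb_sub_moeb` for the pair w, conj w. -/
lemma moeb_im (h : den γ w ≠ 0) : (moeb γ w).im = w.im / ‖den γ w‖ ^ 2 := by
  have h1 : den γ ((starRingEnd ℂ) w) ≠ 0 := by
    rw [← conj_den]; exact (map_ne_zero _).2 h
  have h2 := moeb_sub_moeb h h1
  rw [← conj_moeb, Complex.sub_conj, Complex.sub_conj, ← conj_den, Complex.mul_conj,
    Complex.normSq_eq_norm_sq] at h2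
  have h3 : ((2 * (moeb γ w).im : ℝ) : ℂ) = ((2 * w.im / ‖den γ w‖ ^ 2 : ℝ) : ℂ) := by
    have := mul_right_cancel₀ I_ne_zero (h2.trans (by rw [mul_div_right_comm]) :
      ((2 * (moeb γ w).im : ℝ) : ℂ) * I =
        ((2 * w.im : ℝ) : ℂ) / ((‖den γ w‖ ^ 2 : ℝ) : ℂ) * I)
    rw [this]; push_cast; rfl
  have h4 := Complex.ofReal_injective h3
  rw [mul_div_assoc] at h4
  linarith

lemma moeb_im_pos (h : 0 < w.im) : 0 < (moeb γ w).im := by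
  have hd : den γ w ≠ 0 := den_ne_zero_of_im h.ne'
  rw [moeb_im hd]
  have := norm_pos_iff.2 hd
  positivity

lemma moeb_im_neg (h : w.im < 0) : (moeb γ w).im < 0 := by
  have hd : den γ w ≠ 0 := den_ne_zero_of_im h.ne
  rw [moeb_im hd]
  have := norm_pos_iff.2 hd
  exact div_neg_of_neg_of_pos h (by positivity)

lemma differentiable_den (γ : SL(2, ℤ)) : Differentiable ℂ (den γ) := by
  unfold den; fun_prop

lemma hasDerivAt_moeb (h : den γ w ≠ 0) :
    HasDerivAt (moeb γ) (1 / den γ w ^ 2) w := by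
  have h1 : HasDerivAt (fun w => ((γ 0 0 : ℤ) : ℂ) * w + ((γ 0 1 : ℤ) : ℂ)) ((γ 0 0 : ℤ) : ℂ) w := by
    simpa using ((hasDerivAt_id w).const_mul ((γ 0 0 : ℤ) : ℂ)).add_const ((γ 0 1 : ℤ) : ℂ)
  have h2 : HasDerivAt (den γ) ((γ 1 0 : ℤ) : ℂ) w := by
    unfold den
    simpa using ((hasDerivAt_id w).const_mul ((γ 1 0 : ℤ) : ℂ)).add_const ((γ 1 1 : ℤ) : ℂ)
  refine (h1.div h2 h).congr_deriv ?_
  congr 1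
  have hd := det_cast γ
  simp only [den]
  linear_combination hd

lemma continuousOn_moeb (γ : SL(2, ℤ)) : ContinuousOn (moeb γ) {w | 0 < w.im} :=
  fun _ hw => (hasDerivAt_moeb (den_ne_zero_of_im (ne_of_gt hw))).continuousAt.continuousWithinAt

/-- The square root of `c w + d` on the closed lower half-plane. -/
noncomputable def lowerRoot (γ : SL(2, ℤ)) (w : ℂ) : ℂ := autFactor (1 / 2) γ w

lemma lowerRoot_eq (γ : SL(2, ℤ)) (w : ℂ) : lowerRoot γ w =
    if 0 < γ 1 0 then
      (starRingEnd ℂ) (((starRingEnd ℂ) (den γ w)) ^ (1 / 2 : ℂ))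
    else (den γ w) ^ (1 / 2 : ℂ) := by
  simp [lowerRoot, autFactor]

lemma lowerRoot_sq (γ : SL(2, ℤ)) (w : ℂ) : lowerRoot γ w ^ 2 = den γ w := by
  rw [lowerRoot_eq]
  split_ifs
  · rw [← map_pow, cpow_half_sq, Complex.conj_conj]
  · rw [cpow_half_sq]

/-- The square root of `c u + d` on the upper half-plane conjugate to `lowerRoot`. -/
noncomputable def upperRoot (γ : SL(2, ℤ)) (u : ℂ) : ℂ :=
  (starRingEnd ℂ) (lowerRoot γ ((starRingEnd ℂ) u))

lemma conj_lowerRoot (γ : SL(2, ℤ)) (w : ℂ) :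
    (starRingEnd ℂ) (lowerRoot γ w) = upperRoot γ ((starRingEnd ℂ) w) := by
  rw [upperRoot, Complex.conj_conj]

lemma upperRoot_eq (γ : SL(2, ℤ)) (u : ℂ) : upperRoot γ u =
    if 0 < γ 1 0 then (den γ u) ^ (1 / 2 : ℂ)
    else (starRingEnd ℂ) ((starRingEnd ℂ) (den γ u) ^ (1 / 2 : ℂ)) := by
  rw [upperRoot, lowerRoot_eq]
  split_ifs <;> simp [conj_den]

lemma upperRoot_sq (γ : SL(2, ℤ)) (u : ℂ) : upperRoot γ u ^ 2 = den γ u := by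
  rw [upperRoot, ← map_pow, lowerRoot_sq, conj_den, Complex.conj_conj]

lemma upperRoot_ne_zero (hu : den γ u ≠ 0) : upperRoot γ u ≠ 0 := by
  intro h
  have := upperRoot_sq γ u
  rw [h] at this
  exact hu (by simpa using this.symm)

lemma lowerRoot_ne_zero (hu : den γ u ≠ 0) : lowerRoot γ u ≠ 0 := by
  intro h
  have := lowerRoot_sq γ u
  rw [h] at this
  exact hu (by simpa using this.symm)

/-- For c ≠ 0 the denominator is never real on ℍ and so avoids the cut; for c = 0 it is constant. -/
lemma continuousOn_upperRoot (γ : SL(2, ℤ)) : ContinuousOn (upperRoot γ) {u | 0 < u.im} := by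
  by_cases hc : γ 1 0 = 0
  · have : upperRoot γ = fun _ => (starRingEnd ℂ)
        ((starRingEnd ℂ) (((γ 1 1 : ℤ) : ℂ)) ^ (1 / 2 : ℂ)) := by
      ext u; rw [upperRoot_eq, if_neg (by simp [hc]), den, hc]; simp
    rw [this]
    exact continuousOn_const
  · intro u hu
    have him : (den γ u).im ≠ 0 := by
      rw [den_im]
      exact mul_ne_zero (by exact_mod_cast hc) (ne_of_gt hu)
    refine ContinuousAt.continuousWithinAt ?_
    rw [show upperRoot γ = _ from funext (upperRoot_eq γ)]
    have hd := (differentiable_den γ).continuous.continuousAt (x := u)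
    split_ifs
    · exact (differentiableAt_cpow_half (Or.inr him)).continuousAt.comp hd
    · refine Complex.continuous_conj.continuousAt.comp ?_
      exact ContinuousAt.comp (g := fun z : ℂ => z ^ (1 / 2 : ℂ))
        (differentiableAt_cpow_half (Or.inr (by simpa using him))).continuousAt
        (Complex.continuous_conj.continuousAt.comp hd)

lemma isPreconnected_upper : IsPreconnected {u : ℂ | 0 < u.im} :=
  (convex_halfSpace_im_gt 0).isPreconnected

/-- Both sides are continuous square roots of the same nonvanishing function on a connected set. The
sign is not computed; what matters is that it does not depend on u. -/
lemma exists_upperRoot_mul (γ₁ γ₂ : SL(2, ℤ)) :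
    (∀ u : ℂ, 0 < u.im → upperRoot (γ₁ * γ₂) u = upperRoot γ₁ (moeb γ₂ u) * upperRoot γ₂ u) ∨
    (∀ u : ℂ, 0 < u.im → upperRoot (γ₁ * γ₂) u = -(upperRoot γ₁ (moeb γ₂ u) * upperRoot γ₂ u)) := by
  have h := isPreconnected_upper.eq_or_eq_neg_of_sq_eq
    (f := upperRoot (γ₁ * γ₂)) (g := fun u => upperRoot γ₁ (moeb γ₂ u) * upperRoot γ₂ u)
    (continuousOn_upperRoot _)
    (((continuousOn_upperRoot γ₁).comp (continuousOn_moeb γ₂) fun u hu => moeb_im_pos hu).mul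
      (continuousOn_upperRoot γ₂))
    (fun u hu => by
      have hd : den γ₂ u ≠ 0 := den_ne_zero_of_im (ne_of_gt hu)
      simp only [Pi.pow_apply]
      rw [mul_pow, upperRoot_sq, upperRoot_sq, upperRoot_sq, den_mul hd])
    (fun {u} hu => mul_ne_zero (upperRoot_ne_zero (den_ne_zero_of_im (moeb_im_pos hu).ne'))
      (upperRoot_ne_zero (den_ne_zero_of_im (ne_of_gt hu))))
  exact h.imp (fun h u hu => h hu) (fun h u hu => h hu)

lemma lowerRoot_eq_conj (γ : SL(2, ℤ)) (w : ℂ) :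
    lowerRoot γ w = (starRingEnd ℂ) (upperRoot γ ((starRingEnd ℂ) w)) := by
  rw [← conj_lowerRoot, Complex.conj_conj]

lemma upperRoot_one (u : ℂ) : upperRoot 1 u = 1 := by
  rw [upperRoot_eq]; simp [den]

end Moebius

/-! ### The multiplier system -/

section Multiplier

variable {p : ℕ}

/-- `A` describes the behaviour of the theta vector under `γ`. -/
def ThetaLaw (p : ℕ) (γ : SL(2, ℤ)) (A : GL (Fin (p - 1)) ℂ) : Prop :=
  ∀ u : ℂ, 0 < u.im →
    (upperRoot γ u ^ 3) • thetaVec p u = (A : Matrix (Fin (p - 1)) (Fin (p - 1)) ℂ) *ᵥ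
      thetaVec p (moeb γ u)

lemma ThetaLaw.unique (hp : p ≠ 0) {γ : SL(2, ℤ)} {A B : GL (Fin (p - 1)) ℂ}
    (hA : ThetaLaw p γ A) (hB : ThetaLaw p γ B) : A = B := by
  refine Units.ext (matrix_eq_of_mulVec_thetaVec hp fun τ hτ => ?_)
  have h := (hA (moeb γ⁻¹ τ) (moeb_im_pos hτ)).symm.trans (hB (moeb γ⁻¹ τ) (moeb_im_pos hτ))
  rwa [moeb_moeb_inv (den_ne_zero_of_im hτ.ne')] at h

lemma ThetaLaw.one : ThetaLaw p 1 1 := by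
  intro u _
  simp [upperRoot_one, moeb_one]

/-- The weight is an odd number of half-units: the cube of the sign is the sign itself, and it moves
into the matrix. -/
lemma ThetaLaw.neg_left {γ₁ γ₂ : SL(2, ℤ)} {A B : GL (Fin (p - 1)) ℂ} (hA : ThetaLaw p γ₁ A)
    (hB : ThetaLaw p γ₂ B)
    (h : ∀ u : ℂ, 0 < u.im → upperRoot (γ₁ * γ₂) u = -(upperRoot γ₁ (moeb γ₂ u) * upperRoot γ₂ u)) :
    ThetaLaw p (γ₁ * γ₂) (-(B * A)) := by
  intro u hu
  have h1 := hA (moeb γ₂ u) (moeb_im_pos hu)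
  rw [h u hu, Units.val_neg, Units.val_mul, Matrix.neg_mulVec, ← Matrix.mulVec_mulVec,
    moeb_mul (den_ne_zero_of_im hu.ne'), ← h1, Matrix.mulVec_smul, ← hB u hu, smul_smul, ← neg_smul]
  congr 1; ring

lemma ThetaLaw.mul_left {γ₁ γ₂ : SL(2, ℤ)} {A B : GL (Fin (p - 1)) ℂ} (hA : ThetaLaw p γ₁ A)
    (hB : ThetaLaw p γ₂ B)
    (h : ∀ u : ℂ, 0 < u.im → upperRoot (γ₁ * γ₂) u = upperRoot γ₁ (moeb γ₂ u) * upperRoot γ₂ u) :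
    ThetaLaw p (γ₁ * γ₂) (B * A) := by
  intro u hu
  have h1 := hA (moeb γ₂ u) (moeb_im_pos hu)
  rw [h u hu, Units.val_mul, ← Matrix.mulVec_mulVec,
    moeb_mul (den_ne_zero_of_im hu.ne'), ← h1, Matrix.mulVec_smul, ← hB u hu, smul_smul]
  congr 1; ring

/-- The law for γ read at γ⁻¹u, with the sign of the root cocycle for γ γ⁻¹ = 1 absorbed in the
matrix; induction over the group generated by S and T requires it. -/
lemma ThetaLaw.exists_inv {γ : SL(2, ℤ)} {A : GL (Fin (p - 1)) ℂ} (hA : ThetaLaw p γ A) :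
    ∃ B, ThetaLaw p γ⁻¹ B := by
  have key : ∀ u : ℂ, 0 < u.im →
      thetaVec p u = (upperRoot γ (moeb γ⁻¹ u) ^ 3) • ((A⁻¹ : GL (Fin (p - 1)) ℂ) :
        Matrix (Fin (p - 1)) (Fin (p - 1)) ℂ) *ᵥ thetaVec p (moeb γ⁻¹ u) := by
    intro u hu
    have h := hA (moeb γ⁻¹ u) (moeb_im_pos hu)
    rw [moeb_moeb_inv (den_ne_zero_of_im hu.ne')] at h
    rw [← Matrix.mulVec_smul, h, Matrix.mulVec_mulVec, ← Units.val_mul, inv_mul_cancel,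
      Units.val_one, Matrix.one_mulVec]
  rcases exists_upperRoot_mul γ γ⁻¹ with h | h
  · refine ⟨A⁻¹, fun u hu => ?_⟩
    have h1 := h u hu
    rw [mul_inv_cancel, upperRoot_one] at h1
    conv_lhs => rw [key u hu]
    rw [smul_smul, ← mul_pow, mul_comm, ← h1, one_pow, one_smul]
  · refine ⟨-A⁻¹, fun u hu => ?_⟩
    have h1 := h u hu
    rw [mul_inv_cancel, upperRoot_one] at h1
    conv_lhs => rw [key u hu]
    rw [smul_smul, ← mul_pow, mul_comm, ← neg_eq_iff_eq_neg.2 h1, Units.val_neg, Matrix.neg_mulVec]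
    simp [Odd.neg_one_pow (n := 3) (by decide)]

/-- `-e ^ (-π i / 4) S(p)` as an invertible matrix. -/
noncomputable def multS (hp : p ≠ 0) : GL (Fin (p - 1)) ℂ where
  val := (-cexp (-((Real.pi : ℂ) * I / 4))) • matS p
  inv := (-cexp ((Real.pi : ℂ) * I / 4)) • matS p
  val_inv := by
    rw [Matrix.smul_mul, Matrix.mul_smul, smul_smul, matS_mul_self hp, neg_mul_neg,
      ← Complex.exp_add]
    simp
  inv_val := by
    rw [Matrix.smul_mul, Matrix.mul_smul, smul_smul, matS_mul_self hp, neg_mul_neg,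
      ← Complex.exp_add]
    simp

lemma den_S (u : ℂ) : den ModularGroup.S u = u := by
  simp [den, ModularGroup.S]

lemma moeb_S (u : ℂ) : moeb ModularGroup.S u = -1 / u := by
  rw [moeb, den_S]; simp [ModularGroup.S]

lemma exp_pi_div_four_sq : cexp (Real.pi * I / 4) ^ 2 = I := by
  rw [← I_cpow_half, cpow_half_sq]

/-- On ℍ the root of u is e^{πi/4} times that of -iu. The cube of this constant, e^{3πi/4} =
-e^{-πi/4}, is the constant in `multS`. -/
lemma ThetaLaw.modularGroup_S (hp : p ≠ 0) : ThetaLaw p ModularGroup.S (multS hp) := by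
  intro u hu
  have h1 : upperRoot ModularGroup.S u = u ^ (1 / 2 : ℂ) := by
    rw [upperRoot_eq, den_S, if_pos (by simp [ModularGroup.S])]
  rw [h1, moeb_S, thetaVec_neg_inv hp hu, multS, Matrix.smul_mulVec, Matrix.mulVec_smul, smul_smul,
    Matrix.mulVec_mulVec, matS_mul_self hp, Matrix.one_mulVec, cpow_half_eq_I_mul hu.le,
    I_cpow_half]
  congr 1
  set e := cexp (Real.pi * I / 4)
  have he : cexp (-(Real.pi * I / 4)) * e = 1 := by rw [← Complex.exp_add]; simp
  have he2 : e ^ 2 = I := exp_pi_div_four_sq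
  set r := (-I * u) ^ (1 / 2 : ℂ)
  have hr : r ^ 2 = -I * u := cpow_half_sq _
  have he' : cexp (-(Real.pi * I / 4)) = -I * e := by
    have hne : e ≠ 0 := Complex.exp_ne_zero _
    refine mul_right_cancel₀ hne ?_
    rw [he, mul_assoc, ← sq, he2, neg_mul, I_mul_I, neg_neg]
  rw [he']
  linear_combination (e ^ 3 * r) * hr + (-I * u * e * r) * he2

lemma exists_thetaLaw_T (hp : p ≠ 0) : ∃ A, ThetaLaw p ModularGroup.T A := by
  have hden : ∀ u, den ModularGroup.T u = 1 := fun u => by simp [den, ModularGroup.T]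
  have hm : ∀ u, moeb ModularGroup.T u = u + 1 := fun u => by
    rw [moeb, hden]; simp [ModularGroup.T]
  let d : Fin (p - 1) → ℂ := fun j => 2 * Real.pi * I * (((j : ℕ) + 1) ^ 2 / (4 * p))
  have h1 : Matrix.diagonal (fun j => cexp (-d j)) * Matrix.diagonal (fun j => cexp (d j)) = 1 := by
    rw [Matrix.diagonal_mul_diagonal, ← Matrix.diagonal_one]
    congr 1; ext j; rw [← Complex.exp_add]; simp
  have h2 : Matrix.diagonal (fun j => cexp (d j)) * Matrix.diagonal (fun j => cexp (-d j)) = 1 := by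
    rw [Matrix.diagonal_mul_diagonal, ← Matrix.diagonal_one]
    congr 1; ext j; rw [← Complex.exp_add]; simp
  refine ⟨⟨_, _, h1, h2⟩, fun u hu => ?_⟩
  rw [hm, thetaVec_add_one hp, Matrix.mulVec_mulVec]
  change _ = (Matrix.diagonal (fun j => cexp (-d j)) * Matrix.diagonal (fun j => cexp (d j))) *ᵥ _
  rw [h1, Matrix.one_mulVec, upperRoot_eq, hden]
  simp

lemma exists_thetaLaw (hp : p ≠ 0) (γ : SL(2, ℤ)) : ∃ A, ThetaLaw p γ A := by
  have : γ ∈ Subgroup.closure {ModularGroup.S, ModularGroup.T} := by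
    simp [SpecialLinearGroup.SL2Z_generators]
  induction this using Subgroup.closure_induction with
  | one => exact ⟨1, ThetaLaw.one⟩
  | mem g hg =>
    simp only [Set.mem_insert_iff, Set.mem_singleton_iff] at hg
    rcases hg with rfl | rfl
    · exact ⟨_, ThetaLaw.modularGroup_S hp⟩
    · exact exists_thetaLaw_T hp
  | mul g h _ _ ig ih =>
    obtain ⟨A, hA⟩ := ig
    obtain ⟨B, hB⟩ := ih
    rcases exists_upperRoot_mul g h with e | e
    · exact ⟨_, hA.mul_left hB e⟩
    · exact ⟨_, hA.neg_left hB e⟩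
  | inv g _ ig => exact ig.elim fun A hA => hA.exists_inv

/-- The multiplier system of the theta vector. -/
noncomputable def mult (hp : p ≠ 0) (γ : SL(2, ℤ)) : GL (Fin (p - 1)) ℂ :=
  (exists_thetaLaw hp γ).choose

lemma thetaLaw_mult (hp : p ≠ 0) (γ : SL(2, ℤ)) : ThetaLaw p γ (mult hp γ) :=
  (exists_thetaLaw hp γ).choose_spec

lemma mult_S (hp : p ≠ 0) : mult hp ModularGroup.S = multS hp :=
  (thetaLaw_mult hp _).unique hp (ThetaLaw.modularGroup_S hp)

/-- By uniqueness E(γ₁γ₂) is ± E(γ₂)E(γ₁) with the sign of the root cocycle on ℍ. That sign is real,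
so conjugation gives the same one for the roots below, and the two cancel. -/
lemma isMultiplierSystem_mult (hp : p ≠ 0) : IsMultiplierSystem (1 / 2) (mult hp) := by
  intro γ₁ γ₂ w hw
  have hw' : 0 < ((starRingEnd ℂ) w).im := by simpa using hw
  change (lowerRoot (γ₁ * γ₂) w)⁻¹ • _ = ((lowerRoot γ₂ w)⁻¹ * (lowerRoot γ₁ (moeb γ₂ w))⁻¹) • _
  rw [lowerRoot_eq_conj, lowerRoot_eq_conj γ₂, lowerRoot_eq_conj γ₁, conj_moeb]
  rcases exists_upperRoot_mul γ₁ γ₂ with h | h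
  · rw [(thetaLaw_mult hp _).unique hp ((thetaLaw_mult hp γ₁).mul_left (thetaLaw_mult hp γ₂) h),
      h _ hw', map_mul, _root_.mul_inv_rev, Units.val_mul]
  · rw [(thetaLaw_mult hp _).unique hp ((thetaLaw_mult hp γ₁).neg_left (thetaLaw_mult hp γ₂) h),
      h _ hw', map_neg, map_mul, inv_neg, _root_.mul_inv_rev, Units.val_neg, Units.val_mul, smul_neg,
      neg_smul, neg_neg]

end Multiplier

/-! ### Functions on `(0, ∞)` that decay rapidly at both ends -/

section RapidDecay

variable {E : Type*} [NormedAddCommGroup E] {φ : ℝ → E}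

/-- `φ(t) = O(t ^ r)` on `(0, ∞)` for every real `r`. -/
def RapidDecay (φ : ℝ → E) : Prop :=
  ∀ r : ℝ, ∃ D : ℝ, 0 ≤ D ∧ ∀ t : ℝ, 0 < t → ‖φ t‖ ≤ D * t ^ r

/-- A power of t is absorbed by shifting the exponent, which is free. -/
lemma RapidDecay.mono {F : Type*} [NormedAddCommGroup F] {ψ : ℝ → F} (h : RapidDecay φ)
    {C r : ℝ} (hC : 0 ≤ C) (hψ : ∀ t, 0 < t → ‖ψ t‖ ≤ C * t ^ r * ‖φ t‖) : RapidDecay ψ := by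
  intro s
  obtain ⟨D, hD, hφ⟩ := h (s - r)
  refine ⟨C * D, by positivity, fun t ht => (hψ t ht).trans ?_⟩
  have h1 : t ^ s = t ^ r * t ^ (s - r) := by rw [← Real.rpow_add ht]; congr 1; ring
  calc C * t ^ r * ‖φ t‖ ≤ C * t ^ r * (D * t ^ (s - r)) := by gcongr; exact hφ t ht
    _ = C * D * t ^ s := by rw [h1]; ring

lemma RapidDecay.exists_bound (h : RapidDecay φ) :
    ∃ D : ℝ, 0 ≤ D ∧ ∀ t : ℝ, 0 < t → ‖φ t‖ ≤ D * (1 + t ^ 2)⁻¹ := by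
  obtain ⟨D₀, h₀, hφ₀⟩ := h 0
  obtain ⟨D₂, h₂, hφ₂⟩ := h (-2)
  refine ⟨D₀ + D₂, by positivity, fun t ht => ?_⟩
  rw [← div_eq_mul_inv, le_div_iff₀ (by positivity), mul_add, mul_one]
  refine add_le_add (by simpa using hφ₀ t ht) ?_
  have := hφ₂ t ht
  rw [Real.rpow_neg ht.le, Real.rpow_two, ← div_eq_mul_inv, le_div_iff₀ (by positivity)] at this
  exact this

lemma RapidDecay.integrableOn (h : RapidDecay φ)
    (hm : AEStronglyMeasurable φ (volume.restrict (Set.Ioi 0))) :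
    IntegrableOn φ (Set.Ioi 0) := by
  obtain ⟨D, _, hD⟩ := h.exists_bound
  refine Integrable.mono' (integrable_inv_one_add_sq.const_mul D).integrableOn hm ?_
  filter_upwards [ae_restrict_mem measurableSet_Ioi] with t ht using hD t ht

end RapidDecay

lemma exists_exp_neg_le_rpow {κ δ : ℝ} (hκ : 0 < κ) (hδ : 0 < δ) (r : ℝ) :
    ∃ D : ℝ, 0 ≤ D ∧ ∀ y : ℝ, δ ≤ y → Real.exp (-κ * y) ≤ D * y ^ r := by
  have h := tendsto_rpow_mul_exp_neg_mul_atTop_nhds_zero (-r) κ hκ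
  obtain ⟨M, hM⟩ := eventually_atTop.1 (h.eventually_le_const zero_lt_one)
  have hc : ContinuousOn (fun y : ℝ => y ^ (-r) * Real.exp (-κ * y)) (Set.Icc δ M) := by
    refine ContinuousOn.mul (fun y hy => ?_) (by fun_prop)
    exact (Real.continuousAt_rpow_const y (-r)
      (Or.inl (hδ.trans_le hy.1).ne')).continuousWithinAt
  obtain ⟨C, hC⟩ := isCompact_Icc.exists_bound_of_continuousOn hc
  refine ⟨max 1 C, by positivity, fun y hy => ?_⟩
  have hy0 : 0 < y := hδ.trans_le hy
  have h1 : y ^ (-r) * Real.exp (-κ * y) ≤ max 1 C := by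
    rcases le_total M y with h | h
    · exact (hM y h).trans (le_max_left _ _)
    · exact ((le_abs_self _).trans (hC y ⟨hy, h⟩)).trans (le_max_right _ _)
  rw [Real.rpow_neg hy0.le, inv_mul_le_iff₀ (by positivity)] at h1
  linarith

/-! ### Decay of the theta vector at rational cusps -/

section Cusps

variable {p : ℕ}

lemma norm_upperRoot (γ : SL(2, ℤ)) (u : ℂ) : ‖upperRoot γ u‖ ^ 2 = ‖den γ u‖ := by
  rw [← norm_pow, upperRoot_sq]

lemma exists_norm_mulVec_le (M : Matrix (Fin (p - 1)) (Fin (p - 1)) ℂ) :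
    ∃ C : ℝ, 0 ≤ C ∧ ∀ v : Fin (p - 1) → ℂ, ‖M *ᵥ v‖ ≤ C * ‖v‖ :=
  ⟨_, norm_nonneg _, fun v => (LinearMap.toContinuousLinearMap (Matrix.mulVecLin M)).le_opNorm v⟩

lemma exists_norm_thetaVec_moeb_le (hp : p ≠ 0) (γ : SL(2, ℤ)) :
    ∃ C : ℝ, 0 ≤ C ∧ ∀ u : ℂ, 0 < u.im →
      ‖thetaVec p (moeb γ u)‖ ≤ C * ‖upperRoot γ u‖ ^ 3 * ‖thetaVec p u‖ := by
  obtain ⟨C, hC, h⟩ := exists_norm_mulVec_le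
    (((mult hp γ)⁻¹ : GL (Fin (p - 1)) ℂ) : Matrix (Fin (p - 1)) (Fin (p - 1)) ℂ)
  refine ⟨C, hC, fun u hu => ?_⟩
  have h1 := thetaLaw_mult hp γ u hu
  have h2 := h (upperRoot γ u ^ 3 • thetaVec p u)
  rw [h1, Matrix.mulVec_mulVec, ← Units.val_mul, inv_mul_cancel, Units.val_one,
    Matrix.one_mulVec, ← h1, norm_smul, norm_pow] at h2
  rwa [mul_assoc]

lemma exists_norm_thetaVec_le_moeb (hp : p ≠ 0) (γ : SL(2, ℤ)) :
    ∃ C : ℝ, 0 ≤ C ∧ ∀ u : ℂ, 0 < u.im →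
      ‖upperRoot γ u‖ ^ 3 * ‖thetaVec p u‖ ≤ C * ‖thetaVec p (moeb γ u)‖ := by
  obtain ⟨C, hC, h⟩ := exists_norm_mulVec_le
    ((mult hp γ : GL (Fin (p - 1)) ℂ) : Matrix (Fin (p - 1)) (Fin (p - 1)) ℂ)
  refine ⟨C, hC, fun u hu => ?_⟩
  have h1 := thetaLaw_mult hp γ u hu
  rw [← norm_pow, ← norm_smul, h1]
  exact h _

/-- The coprime pair (denominator, -numerator) of x is completed to a matrix, which then sends x to
∞. -/
lemma exists_den_eq_zero (x : ℚ) : ∃ γ : SL(2, ℤ), γ 1 0 ≠ 0 ∧ den γ (x : ℂ) = 0 := by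
  have hco : IsCoprime (x.den : ℤ) (-x.num) := by
    have := x.reduced
    exact (Int.isCoprime_iff_gcd_eq_one.2 (by simpa [Int.gcd] using Nat.Coprime.symm this))
  obtain ⟨γ, _, hγ⟩ := ModularGroup.bottom_row_surj (R := ℤ) (a := ![(x.den : ℤ), -x.num])
    (show IsCoprime _ _ from hco)
  have h0 : γ 1 0 = x.den := by
    simpa using congrFun hγ 0
  have h1 : γ 1 1 = -x.num := by
    simpa using congrFun hγ 1
  refine ⟨γ, by rw [h0]; exact_mod_cast x.den_ne_zero, ?_⟩
  rw [den, h0, h1]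
  have hd : (x.den : ℂ) ≠ 0 := by exact_mod_cast x.den_ne_zero
  have : (x : ℂ) = x.num / x.den := by exact_mod_cast (Rat.num_div_den x).symm
  rw [this]
  push_cast
  field_simp
  ring

lemma den_cusp {γ : SL(2, ℤ)} {x : ℂ} (h : den γ x = 0) (z : ℂ) :
    den γ (x + z) = ((γ 1 0 : ℤ) : ℂ) * z := by
  rw [den, mul_add, add_right_comm]
  rw [den] at h
  rw [h, zero_add]

/-- The half-line above γ⁻¹∞ is a geodesic with an end at that cusp, so its image is again vertical
but run backwards: t → 0 becomes i∞. -/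
lemma moeb_cusp {γ : SL(2, ℤ)} (hc : γ 1 0 ≠ 0) {x : ℂ} (h : den γ x = 0) {t : ℝ} (ht : t ≠ 0) :
    moeb γ (x + I * t) = (((γ 0 0 : ℤ) / (γ 1 0 : ℤ) : ℝ) : ℂ) +
      I * ((1 / ((γ 1 0 : ℤ) ^ 2 * t) : ℝ) : ℂ) := by
  have hc' : ((γ 1 0 : ℤ) : ℂ) ≠ 0 := by exact_mod_cast hc
  have ht' : (t : ℂ) ≠ 0 := by exact_mod_cast ht
  have hd := det_cast γ
  rw [moeb, den_cusp h]
  rw [den] at h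
  have hx : ((γ 1 0 : ℤ) : ℂ) * x = -((γ 1 1 : ℤ) : ℂ) := eq_neg_of_add_eq_zero_left h
  push_cast
  field_simp
  linear_combination ((γ 0 0 : ℤ) : ℂ) * hx - hd - I_sq

lemma continuousOn_thetaVec (hp : p ≠ 0) : ContinuousOn (thetaVec p) {u | 0 < u.im} :=
  (differentiableOn_thetaVec hp).continuousOn

lemma continuousOn_thetaVec_vertical (hp : p ≠ 0) {w : ℂ} (hw : 0 ≤ w.im) :
    ContinuousOn (fun t : ℝ => thetaVec p (w + I * t)) (Set.Ioi 0) :=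
  (continuousOn_thetaVec hp).comp (by fun_prop) fun t ht => by
    have : 0 < t := ht
    simp; linarith

/-- For small t a matrix sending x to ∞ is applied: the exponential decay at height 1/(c²t) beats
the factor t^{-3/2} due to the weight. For large t the decay at i∞ applies directly. -/
lemma rapidDecay_thetaVec (hp : p ≠ 0) (x : ℚ) :
    RapidDecay (fun t : ℝ => thetaVec p ((x : ℂ) + I * t)) := by
  intro r
  obtain ⟨γ, hc, hγ⟩ := exists_den_eq_zero x
  obtain ⟨C, hC, hCf⟩ := exists_norm_thetaVec_le_moeb hp γ
  obtain ⟨K, hK, hKf⟩ := exists_norm_thetaVec_le hp zero_lt_one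
  set c : ℝ := ((γ 1 0 : ℤ) : ℝ) with hcdef
  have hc0 : 0 < |c| := abs_pos.2 (by rw [hcdef]; exact_mod_cast hc)
  have hc2 : c ^ 2 = |c| ^ 2 := (sq_abs c).symm
  obtain ⟨K', hK', hKf'⟩ := exists_norm_thetaVec_le hp (show 0 < 1 / c ^ 2 by rw [hc2]; positivity)
  -- At height 1/(c²t) this exponent gives t^{r + 3/2}; the 3/2 is consumed by the automorphy
  -- factor.
  obtain ⟨D₁, hD₁, hD₁f⟩ := exists_exp_neg_le_rpow (decayRate_pos hp) zero_lt_one (-(r + 3 / 2))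
  obtain ⟨D₂, hD₂, hD₂f⟩ := exists_exp_neg_le_rpow (decayRate_pos hp)
    (show 0 < 1 / c ^ 2 by rw [hc2]; positivity) r
  refine ⟨C * (K * (D₁ * (c ^ 2) ^ (r + 3 / 2))) / |c| ^ (3 / 2 : ℝ) + K' * D₂,
    by positivity, fun t ht => ?_⟩
  have him : 0 < ((x : ℂ) + I * t).im := by simpa using ht
  rw [add_mul]
  -- For t ≤ 1/c² the image point has height at least 1.
  rcases le_total t (1 / c ^ 2) with h | h
  · refine le_add_of_le_of_nonneg ?_ (by positivity)
    have h1 := hCf _ him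
    have h2 : ‖upperRoot γ ((x : ℂ) + I * t)‖ ^ 3 = |c| ^ (3 / 2 : ℝ) * t ^ (3 / 2 : ℝ) := by
      have e1 : ‖upperRoot γ ((x : ℂ) + I * t)‖ ^ 2 = |c| * t := by
        rw [norm_upperRoot, den_cusp hγ]
        simp [hcdef, abs_of_pos ht]
      have e2 : ‖upperRoot γ ((x : ℂ) + I * t)‖ ^ 3 =
          (‖upperRoot γ ((x : ℂ) + I * t)‖ ^ 2) ^ (3 / 2 : ℝ) := by
        rw [← Real.rpow_natCast, ← Real.rpow_natCast, ← Real.rpow_mul (norm_nonneg _)]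
        norm_num
      rw [e2, e1, Real.mul_rpow hc0.le ht.le]
    have him2 : (moeb γ ((x : ℂ) + I * t)).im = 1 / (c ^ 2 * t) := by
      rw [moeb_cusp hc hγ ht.ne', Complex.add_im, Complex.ofReal_im, Complex.I_mul_im,
        Complex.ofReal_re, zero_add]
    have hge : 1 ≤ 1 / (c ^ 2 * t) := by
      rw [le_div_iff₀ (by rw [hc2]; positivity), one_mul]
      rwa [le_div_iff₀ (by rw [hc2]; positivity), mul_comm] at h
    have h3 := (hKf _ (him2 ▸ hge)).trans (mul_le_mul_of_nonneg_left (him2 ▸ hD₁f _ hge) hK)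
    have h4 : (1 / (c ^ 2 * t)) ^ (-(r + 3 / 2)) = (c ^ 2) ^ (r + 3 / 2) * (t ^ r * t ^ (3 / 2 : ℝ)) := by
      rw [Real.rpow_neg (by positivity), ← Real.inv_rpow (by positivity), one_div, inv_inv,
        Real.mul_rpow (by positivity) ht.le, Real.rpow_add ht]
    rw [him2, h4] at h3
    rw [h2] at h1
    have h5 := h1.trans (mul_le_mul_of_nonneg_left h3 hC)
    have h6 : 0 < |c| ^ (3 / 2 : ℝ) := by positivity
    have h7 : 0 < t ^ (3 / 2 : ℝ) := by positivity
    rw [div_mul_eq_mul_div, le_div_iff₀ h6]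
    refine le_of_mul_le_mul_right ?_ h7
    calc _ = |c| ^ (3 / 2 : ℝ) * t ^ (3 / 2 : ℝ) * ‖thetaVec p ((x : ℂ) + I * t)‖ := by ring
      _ ≤ _ := h5
      _ = _ := by ring
  · refine le_add_of_nonneg_of_le (by positivity) ?_
    have him2 : ((x : ℂ) + I * t).im = t := by simp
    have h1 := hKf' ((x : ℂ) + I * t) (by rw [him2]; exact h)
    rw [him2] at h1
    exact h1.trans (by rw [mul_assoc]; gcongr; exact hD₂f t h)

end Cusps

/-! ### Square roots of differences under Möbius transformations -/

section RootMoebius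

variable {γ : SL(2, ℤ)} {u w : ℂ}

lemma neg_I_mul_mem_slitPlane {z : ℂ} (hz : 0 < z.im) : -I * z ∈ slitPlane :=
  Or.inl (by simpa using hz)

lemma sub_im_pos (hu : 0 < u.im) (hw : w.im ≤ 0) : 0 < (u - w).im := by
  rw [Complex.sub_im]; linarith

/-- As functions of u both sides are continuous square roots of the same function, hence equal up to
a constant sign. The value at u = conj w decides it. -/
lemma root_moeb_of_neg (hu : 0 < u.im) (hw : w.im < 0) :
    (-I * (moeb γ u - moeb γ w)) ^ (1 / 2 : ℂ) * (upperRoot γ u * lowerRoot γ w) =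
      (-I * (u - w)) ^ (1 / 2 : ℂ) := by
  have hdw : den γ w ≠ 0 := den_ne_zero_of_im hw.ne
  have hmw := moeb_im_neg (γ := γ) hw
  have hc1 : ContinuousOn (fun u => (-I * (moeb γ u - moeb γ w)) ^ (1 / 2 : ℂ)) {u | 0 < u.im} := by
    intro v hv
    refine ContinuousAt.comp_continuousWithinAt (g := fun z : ℂ => z ^ (1 / 2 : ℂ))
      (differentiableAt_cpow_half (neg_I_mul_mem_slitPlane
        (sub_im_pos (moeb_im_pos hv) hmw.le))).continuousAt ?_
    exact continuousWithinAt_const.mul ((continuousOn_moeb γ v hv).sub continuousWithinAt_const)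
  have hc2 : ContinuousOn (fun u => (-I * (u - w)) ^ (1 / 2 : ℂ)) {u | 0 < u.im} := by
    intro v hv
    refine ContinuousAt.comp_continuousWithinAt (g := fun z : ℂ => z ^ (1 / 2 : ℂ))
      (differentiableAt_cpow_half (neg_I_mul_mem_slitPlane
        (sub_im_pos hv hw.le))).continuousAt ?_
    fun_prop
  have h := isPreconnected_upper.eq_or_eq_neg_of_sq_eq
    (f := fun u => (-I * (moeb γ u - moeb γ w)) ^ (1 / 2 : ℂ) * (upperRoot γ u * lowerRoot γ w))
    (g := fun u => (-I * (u - w)) ^ (1 / 2 : ℂ))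
    (hc1.mul ((continuousOn_upperRoot γ).mul continuousOn_const)) hc2
    (fun v hv => by
      have hdv : den γ v ≠ 0 := den_ne_zero_of_im (ne_of_gt hv)
      simp only [Pi.pow_apply]
      rw [mul_pow, mul_pow, cpow_half_sq, cpow_half_sq, upperRoot_sq, lowerRoot_sq,
        moeb_sub_moeb hdv hdw]
      field_simp)
    (fun {v} hv => cpow_half_ne_zero (slitPlane_ne_zero (neg_I_mul_mem_slitPlane
        (sub_im_pos hv hw.le))))
  rcases h with h | h
  · exact h hu
  -- At u = conj w everything is real: -i(u - w) = -2 Im w > 0, likewise for the images, and the two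
  -- automorphy roots multiply to a squared modulus.
  · exfalso
    have hw' : 0 < ((starRingEnd ℂ) w).im := by simpa using hw
    have h1 := h hw'
    simp only [Pi.neg_apply] at h1
    have e1 : ∀ z : ℂ, -I * ((starRingEnd ℂ) z - z) = ((-2 * z.im : ℝ) : ℂ) := by
      intro z
      rw [← neg_sub z, Complex.sub_conj]
      push_cast
      linear_combination (2 * (z.im : ℂ)) * I_sq
    rw [← conj_moeb, e1, e1, ← conj_lowerRoot, mul_comm ((starRingEnd ℂ) _), Complex.mul_conj,
      cpow_half_ofReal (by linarith), cpow_half_ofReal (by linarith)] at h1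
    have h2 : Real.sqrt (-2 * (moeb γ w).im) * Complex.normSq (lowerRoot γ w) =
        -Real.sqrt (-2 * w.im) := by exact_mod_cast h1
    have h3 : 0 < Real.sqrt (-2 * w.im) := Real.sqrt_pos.2 (by linarith)
    have h4 : 0 ≤ Real.sqrt (-2 * (moeb γ w).im) * Complex.normSq (lowerRoot γ w) :=
      mul_nonneg (Real.sqrt_nonneg _) (Complex.normSq_nonneg _)
    linarith

/-- The case distinction in `autFactor` is made for this: when cw + d is a negative real, it selects
the boundary value reached from the lower half-plane. -/
lemma tendsto_lowerRoot (hw : w.im = 0) (hd : den γ w ≠ 0) :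
    Tendsto (fun ε : ℝ => lowerRoot γ (w - I * ε)) (𝓝[>] 0) (𝓝 (lowerRoot γ w)) := by
  -- From the upper side the principal root is continuous up to its cut, since there it is √i times
  -- the root of -iz.
  have key : ∀ D : ℂ, D ≠ 0 → D.im = 0 → ∀ g : ℝ → ℂ, ContinuousAt g 0 → g 0 = D →
      (∀ ε, 0 < ε → 0 ≤ (g ε).im) →
      Tendsto (fun ε => g ε ^ (1 / 2 : ℂ)) (𝓝[>] 0) (𝓝 (D ^ (1 / 2 : ℂ))) := by
    intro D hD hDi g hg hg0 hgi
    rw [cpow_half_eq_I_mul hDi.ge]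
    have hs : -I * D ∈ slitPlane := Or.inr (by
      have : D.re ≠ 0 := fun h => hD (Complex.ext h hDi)
      simpa using this)
    have h1 : ContinuousAt (fun ε => (-I * g ε) ^ (1 / 2 : ℂ)) 0 :=
      ContinuousAt.comp (g := fun z : ℂ => z ^ (1 / 2 : ℂ))
        (differentiableAt_cpow_half (by rw [hg0]; exact hs)).continuousAt (continuousAt_const.mul hg)
    have h2 := (h1.tendsto.const_mul (I ^ (1 / 2 : ℂ))).mono_left
      (nhdsWithin_le_nhds (s := Set.Ioi (0 : ℝ)))
    rw [hg0] at h2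
    refine h2.congr' ?_
    filter_upwards [self_mem_nhdsWithin] with ε hε
    exact (cpow_half_eq_I_mul (hgi ε hε)).symm
  have hcont : Continuous (fun ε : ℝ => den γ (w - I * ε)) :=
    (differentiable_den γ).continuous.comp (by fun_prop)
  have him : ∀ ε : ℝ, (den γ (w - I * ε)).im = -((γ 1 0 : ℤ) : ℝ) * ε := by
    intro ε; rw [den_im]; simp [hw]
  simp_rw [lowerRoot_eq]
  split_ifs with hc
  · refine (Complex.continuous_conj.tendsto _).comp ?_
    refine key _ ((map_ne_zero _).2 hd) (by rw [Complex.conj_im, den_im, hw]; simp)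
      (fun ε => (starRingEnd ℂ) (den γ (w - I * ε)))
      (Complex.continuous_conj.comp hcont).continuousAt (by simp) fun ε hε => ?_
    rw [Complex.conj_im, him]
    have : (0 : ℝ) < ((γ 1 0 : ℤ) : ℝ) := by exact_mod_cast hc
    nlinarith
  · refine key _ hd (by rw [den_im, hw]; simp) _ hcont.continuousAt (by simp) fun ε hε => ?_
    rw [him]
    have : ((γ 1 0 : ℤ) : ℝ) ≤ 0 := by exact_mod_cast not_lt.1 hc
    nlinarith

lemma moeb_im_nonpos (hw : w.im ≤ 0) (hd : den γ w ≠ 0) : (moeb γ w).im ≤ 0 := by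
  rw [moeb_im hd]
  exact div_nonpos_of_nonpos_of_nonneg hw (by positivity)

/-- A real w is the limit of w - iε, and both sides pass to the limit. -/
lemma root_moeb (hu : 0 < u.im) (hw : w.im ≤ 0) (hd : den γ w ≠ 0) :
    (-I * (moeb γ u - moeb γ w)) ^ (1 / 2 : ℂ) * (upperRoot γ u * lowerRoot γ w) =
      (-I * (u - w)) ^ (1 / 2 : ℂ) := by
  rcases hw.lt_or_eq with h | h
  · exact root_moeb_of_neg hu h
  have hmw := moeb_im_nonpos hw hd
  have hlim : Tendsto (fun ε : ℝ => w - I * ε) (𝓝[>] 0) (𝓝 w) := by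
    have : Continuous (fun ε : ℝ => w - I * ε) := by fun_prop
    have h2 := this.tendsto 0
    simp only [Complex.ofReal_zero, mul_zero, sub_zero] at h2
    exact h2.mono_left nhdsWithin_le_nhds
  have h1 : Tendsto (fun ε : ℝ => (-I * (u - (w - I * ε))) ^ (1 / 2 : ℂ)) (𝓝[>] 0)
      (𝓝 ((-I * (u - w)) ^ (1 / 2 : ℂ))) :=
    ((differentiableAt_cpow_half (neg_I_mul_mem_slitPlane (sub_im_pos hu hw))).continuousAt.tendsto).comp
      ((hlim.const_sub u).const_mul (-I))
  have h2 : Tendsto (fun ε : ℝ => (-I * (moeb γ u - moeb γ (w - I * ε))) ^ (1 / 2 : ℂ)) (𝓝[>] 0)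
      (𝓝 ((-I * (moeb γ u - moeb γ w)) ^ (1 / 2 : ℂ))) :=
    ((differentiableAt_cpow_half (neg_I_mul_mem_slitPlane
      (sub_im_pos (moeb_im_pos hu) hmw))).continuousAt.tendsto).comp
      ((((hasDerivAt_moeb hd).continuousAt.tendsto.comp hlim).const_sub _).const_mul (-I))
  refine tendsto_nhds_unique (h2.mul ((tendsto_lowerRoot h hd).const_mul (upperRoot γ u))) ?_
  refine h1.congr' ?_
  filter_upwards [self_mem_nhdsWithin] with ε hε
  have hε' : 0 < ε := hε
  exact (root_moeb_of_neg hu (by simp [h, hε'])).symm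

end RootMoebius

/-! ### Primitives on the upper half-plane and their values at cusps -/

section Primitive

variable {E : Type*} [NormedAddCommGroup E] [NormedSpace ℂ E] [CompleteSpace E]

/-- A holomorphic function on the upper half-plane has a primitive. -/
lemma exists_primitive_upper {G : ℂ → E} (hG : DifferentiableOn ℂ G {u | 0 < u.im}) :
    ∃ P : ℂ → E, ∀ u : ℂ, 0 < u.im → HasDerivAt P (G u) u := by
  -- The Cayley transform ζ ↦ i(1 + ζ)/(1 - ζ) pulls G(u) du back to the unit disc, where
  -- holomorphic functions have primitives.
  have hsub : ∀ ζ : ℂ, ζ ∈ Metric.ball (0 : ℂ) 1 → 1 - ζ ≠ 0 := by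
    intro ζ hζ h
    rw [← sub_eq_zero.1 h] at hζ
    simp at hζ
  have him : ∀ ζ : ℂ, ζ ∈ Metric.ball (0 : ℂ) 1 → 0 < (I * (1 + ζ) / (1 - ζ)).im := by
    intro ζ hζ
    have hn : ‖ζ‖ ^ 2 < 1 := by
      rw [mem_ball_zero_iff] at hζ
      nlinarith [norm_nonneg ζ]
    have h1 : (I * (1 + ζ) / (1 - ζ)).im = (1 - ‖ζ‖ ^ 2) / Complex.normSq (1 - ζ) := by
      rw [← Complex.normSq_eq_norm_sq, Complex.div_im, Complex.normSq_apply ζ]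
      simp only [Complex.mul_im, Complex.mul_re, Complex.I_re, Complex.I_im, Complex.add_re,
        Complex.add_im, Complex.one_re, Complex.one_im, Complex.sub_re, Complex.sub_im]
      ring
    rw [h1]
    exact div_pos (by linarith) (Complex.normSq_pos.2 (hsub ζ hζ))
  have hφ : ∀ ζ : ℂ, ζ ∈ Metric.ball (0 : ℂ) 1 →
      HasDerivAt (fun ζ : ℂ => I * (1 + ζ) / (1 - ζ)) (2 * I / (1 - ζ) ^ 2) ζ := by
    intro ζ hζ
    have h1 : HasDerivAt (fun ζ : ℂ => I * (1 + ζ)) I ζ := by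
      simpa using ((hasDerivAt_id ζ).const_add 1).const_mul I
    have h2 : HasDerivAt (fun ζ : ℂ => 1 - ζ) (-1) ζ := by
      simpa using (hasDerivAt_id ζ).const_sub 1
    refine (h1.div h2 (hsub ζ hζ)).congr_deriv ?_
    congr 1; ring
  have hdiff : DifferentiableOn ℂ
      (fun ζ : ℂ => (2 * I / (1 - ζ) ^ 2) • G (I * (1 + ζ) / (1 - ζ))) (Metric.ball 0 1) := by
    refine DifferentiableOn.smul ?_ ?_
    · refine DifferentiableOn.div (by fun_prop) (by fun_prop) fun ζ hζ => pow_ne_zero _ (hsub ζ hζ)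
    · exact hG.comp (fun ζ hζ => (hφ ζ hζ).differentiableAt.differentiableWithinAt) him
  obtain ⟨P₀, hP₀⟩ := hdiff.isExactOn_ball
  have hne : ∀ u : ℂ, 0 < u.im → u + I ≠ 0 := by
    intro u hu h
    have := congrArg Complex.im h
    simp at this; linarith
  refine ⟨fun u => P₀ ((u - I) / (u + I)), fun u hu => ?_⟩
  have hu' := hne u hu
  have hψ : HasDerivAt (fun u : ℂ => (u - I) / (u + I)) (2 * I / (u + I) ^ 2) u := by
    refine (((hasDerivAt_id u).sub_const I).div ((hasDerivAt_id u).add_const I) hu').congr_deriv ?_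
    congr 1; simp; ring
  have hmem : (u - I) / (u + I) ∈ Metric.ball (0 : ℂ) 1 := by
    rw [mem_ball_zero_iff, norm_div, div_lt_one (norm_pos_iff.2 hu'),
      ← sq_lt_sq₀ (norm_nonneg _) (norm_nonneg _), ← Complex.normSq_eq_norm_sq,
      ← Complex.normSq_eq_norm_sq, Complex.normSq_apply, Complex.normSq_apply]
    simp only [Complex.sub_re, Complex.I_re, Complex.sub_im, Complex.I_im, Complex.add_re,
      Complex.add_im]
    nlinarith
  have h := (hP₀ _ hmem).scomp u hψ
  refine h.congr_deriv ?_
  have e1 : 1 - (u - I) / (u + I) = 2 * I / (u + I) := by field_simp; ring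
  have e2 : I * (1 + (u - I) / (u + I)) / (2 * I / (u + I)) = u := by
    field_simp [I_ne_zero]; ring
  beta_reduce
  rw [e1, e2, smul_smul]
  have e3 : 2 * I / (u + I) ^ 2 * (2 * I / (2 * I / (u + I)) ^ 2) = 1 := by
    field_simp [I_ne_zero]
  rw [e3, one_smul]

/-- If the derivative of `Q` decays like `y ^ (-2)` in vertical strips, then `Q` has a limit at
`i∞` along vertical lines which does not depend on the line. -/
lemma exists_tendsto_vertical {Q Q' : ℂ → E} (hQ : ∀ u : ℂ, 0 < u.im → HasDerivAt Q (Q' u) u)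
    (hb : ∀ R : ℝ, ∃ B : ℝ, ∀ u : ℂ, |u.re| ≤ R → 1 ≤ u.im → ‖Q' u‖ ≤ B * (u.im ^ 2)⁻¹) :
    ∃ L : E, ∀ α : ℝ, Tendsto (fun y : ℝ => Q (α + I * y)) atTop (𝓝 L) := by
  have hdiff : DifferentiableOn ℂ Q {u | 0 < u.im} := fun u hu =>
    (hQ u hu).differentiableAt.differentiableWithinAt
  have hopen : IsOpen {u : ℂ | 0 < u.im} := isOpen_lt continuous_const Complex.continuous_im
  have hQ'c : ContinuousOn Q' {u | 0 < u.im} :=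
    ((hdiff.deriv hopen).continuousOn).congr fun u hu => (hQ u hu).deriv.symm
  have hline : ∀ y : ℝ, 0 < y → HasDerivAt (fun y : ℝ => Q (I * y)) (I • Q' (I * y)) y := by
    intro y hy
    have h1 : HasDerivAt (fun y : ℝ => I * (y : ℂ)) I y := by
      simpa using (Complex.ofRealCLM.hasDerivAt (x := y)).const_mul I
    exact (hQ (I * y) (by simpa using hy)).scomp y h1
  obtain ⟨B₀, hB₀⟩ := hb 0
  have hint : IntegrableOn (fun y : ℝ => I • Q' (I * y)) (Set.Ioi 1) := by
    have hi : IntegrableOn (fun y : ℝ => B₀ * y ^ (-2 : ℝ)) (Set.Ioi 1) :=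
      (integrableOn_Ioi_rpow_of_lt (by norm_num) zero_lt_one).const_mul B₀
    refine Integrable.mono' hi ?_ ?_
    · refine ContinuousOn.aestronglyMeasurable ?_ measurableSet_Ioi
      refine continuousOn_const.smul (hQ'c.comp (by fun_prop) fun y hy => ?_)
      have : (1 : ℝ) < y := hy
      simp; linarith
    · filter_upwards [ae_restrict_mem measurableSet_Ioi] with y hy
      have hy1 : (1 : ℝ) < y := hy
      rw [norm_smul, Complex.norm_I, one_mul, Real.rpow_neg (by linarith), Real.rpow_two]
      simpa using hB₀ (I * y) (by simp) (by simpa using hy1.le)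
  have h0 := tendsto_limUnder_of_hasDerivAt_of_integrableOn_Ioi (a := 1)
    (f := fun y : ℝ => Q (I * y)) (fun y hy => hline y (zero_lt_one.trans hy)) hint
  refine ⟨limUnder atTop (fun y : ℝ => Q (I * y)), fun α => ?_⟩
  obtain ⟨B, hB⟩ := hb |α|
  -- Two vertical lines are joined at height y by a segment of fixed length |α|, on which the
  -- derivative is O(y⁻²).
  have h1 : Tendsto (fun y : ℝ => Q (α + I * y) - Q (I * y)) atTop (𝓝 0) := by
    have h2 : Tendsto (fun y : ℝ => B * (y ^ 2)⁻¹ * |α|) atTop (𝓝 0) := by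
      have : Tendsto (fun y : ℝ => (y ^ 2)⁻¹) atTop (𝓝 0) :=
        tendsto_inv_atTop_zero.comp (tendsto_pow_atTop two_ne_zero)
      simpa using (this.const_mul B).mul_const |α|
    refine squeeze_zero_norm' ?_ h2
    filter_upwards [eventually_ge_atTop (1 : ℝ)] with y hy
    have hconv : Convex ℝ {u : ℂ | |u.re| ≤ |α| ∧ u.im = y} := by
      have e : {u : ℂ | |u.re| ≤ |α| ∧ u.im = y} =
          (Complex.reLm ⁻¹' (Set.Icc (-|α|) |α|)) ∩ (Complex.imLm ⁻¹' {y}) := by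
        ext u; simp [abs_le]
      rw [e]
      exact ((convex_Icc _ _).linear_preimage _).inter ((convex_singleton _).linear_preimage _)
    have h3 := hconv.norm_image_sub_le_of_norm_hasDerivWithin_le (f := Q) (f' := Q')
      (C := B * (y ^ 2)⁻¹) (x := I * y) (y := α + I * y)
      (fun u hu => (hQ u (by rw [hu.2]; linarith)).hasDerivWithinAt)
      (fun u hu => by
        have := hB u hu.1 (by rw [hu.2]; exact hy)
        rwa [hu.2] at this)
      (by simp) (by simp)
    simpa using h3
  have h3 := h1.add h0
  simpa using h3

end Primitive

/-! ### Eichler integrals and their transformation behaviour -/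

/-- Only a limit at 0⁺ is needed: redefining the primitive at 0 by that limit makes it continuous
there. The integrals below may start at a cusp or a branch point. -/
lemma integral_Ioi_of_tendsto {E : Type*} [NormedAddCommGroup E] [NormedSpace ℝ E]
    [CompleteSpace E] {f f' : ℝ → E} {m₀ m : E}
    (hd : ∀ x, 0 < x → HasDerivAt f (f' x) x) (hi : IntegrableOn f' (Set.Ioi 0))
    (h0 : Tendsto f (𝓝[>] 0) (𝓝 m₀)) (h : Tendsto f atTop (𝓝 m)) :
    ∫ x in Set.Ioi (0 : ℝ), f' x = m - m₀ := by
  have hne : ∀ x : ℝ, 0 < x → Function.update f 0 m₀ =ᶠ[𝓝 x] f := fun x hx => by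
    filter_upwards [eventually_ne_nhds hx.ne'] with y hy
    rw [Function.update_of_ne hy]
  have h1 := integral_Ioi_of_hasDerivAt_of_tendsto (f := Function.update f 0 m₀) (f' := f')
    (a := 0) (m := m) (by
      rw [← Set.Ioi_insert, continuousWithinAt_insert_self, continuousWithinAt_update_same,]
      simpa using h0)
    (fun x hx => (hd x hx).congr_of_eventuallyEq (hne x hx)) hi
    (h.congr' (by
      filter_upwards [eventually_gt_atTop (0 : ℝ)] with y hy
      rw [Function.update_of_ne hy.ne']))
  simpa using h1

section Eichler

variable {p : ℕ} {γ : SL(2, ℤ)} {w : ℂ}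

/-- The integrand `f(u) / √(-i (u - w))`. -/
noncomputable def kernelTheta (p : ℕ) (w u : ℂ) : Fin (p - 1) → ℂ :=
  ((-I * (u - w)) ^ (1 / 2 : ℂ))⁻¹ • thetaVec p u

lemma differentiableOn_kernelTheta (hp : p ≠ 0) (hw : w.im ≤ 0) :
    DifferentiableOn ℂ (kernelTheta p w) {u | 0 < u.im} := by
  have h1 : DifferentiableOn ℂ (fun u => ((-I * (u - w)) ^ (1 / 2 : ℂ))⁻¹) {u | 0 < u.im} := by
    intro u hu
    have hs := neg_I_mul_mem_slitPlane (sub_im_pos hu hw)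
    have h2 : DifferentiableAt ℂ (fun u => (-I * (u - w)) ^ (1 / 2 : ℂ)) u :=
      (differentiableAt_cpow_half hs).comp (f := fun u => -I * (u - w)) u (by fun_prop)
    exact (h2.inv (cpow_half_ne_zero (slitPlane_ne_zero hs))).differentiableWithinAt
  exact h1.smul (differentiableOn_thetaVec hp)

lemma norm_kernelTheta_le {u : ℂ} (hu : 0 < u.im) (hw : w.im ≤ 0) :
    ‖kernelTheta p w u‖ ≤ (Real.sqrt u.im)⁻¹ * ‖thetaVec p u‖ := by
  rw [kernelTheta, norm_smul, norm_inv, norm_cpow_half, norm_mul, norm_neg, Complex.norm_I, one_mul]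
  gcongr
  have := (le_abs_self _).trans (Complex.abs_im_le_norm (u - w))
  rw [Complex.sub_im] at this
  linarith

/-- With U the root of cu + d at u = γ⁻¹z, the differential du contributes U⁴, the theta law U⁻³ and
the kernel U⁻¹. All powers of U cancel, and what remains is the weight 1/2 factor in w. -/
lemma kernelTheta_moeb (hp : p ≠ 0) {z : ℂ} (hz : 0 < z.im) (hw : w.im ≤ 0) (hd : den γ w ≠ 0) :
    (1 / den γ⁻¹ z ^ 2) • kernelTheta p w (moeb γ⁻¹ z) =
      (lowerRoot γ w)⁻¹ • ((mult hp γ : Matrix (Fin (p - 1)) (Fin (p - 1)) ℂ) *ᵥ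
        kernelTheta p (moeb γ w) z) := by
  set u := moeb γ⁻¹ z with hu
  have hui : 0 < u.im := moeb_im_pos hz
  have hzu : moeb γ u = z := moeb_moeb_inv (den_ne_zero_of_im hz.ne')
  have hdu : den γ u ≠ 0 := den_ne_zero_of_im hui.ne'
  have h1 : den γ u * den γ⁻¹ z = 1 := by
    rw [← den_mul (den_ne_zero_of_im hz.ne'), mul_inv_cancel]; simp [den]
  have h2 := thetaLaw_mult hp γ u hui
  have h3 := root_moeb hui hw hd
  rw [hzu] at h2 h3
  rw [kernelTheta, kernelTheta, Matrix.mulVec_smul, ← h2, ← h3, smul_smul, smul_smul, smul_smul,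
    eq_one_div_of_mul_eq_one_right h1]
  congr 1
  have h4 := upperRoot_ne_zero hdu
  have h5 := lowerRoot_ne_zero hd
  have h6 : (-I * (z - moeb γ w)) ^ (1 / 2 : ℂ) ≠ 0 :=
    cpow_half_ne_zero (slitPlane_ne_zero (neg_I_mul_mem_slitPlane
      (sub_im_pos hz (moeb_im_nonpos hw hd))))
  rw [← upperRoot_sq γ u]
  field_simp

/-- After pulling back by δ, the derivative carries a⁻⁴ from the differential, a³ from the theta law
and at most a² from the kernel, where a is the modulus of the root of the denominator. The net
factor a grows at most linearly in the height. -/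
lemma exists_tendsto_primitive_cusp (hp : p ≠ 0) (hw : w.im ≤ 0) {P : ℂ → Fin (p - 1) → ℂ}
    (hP : ∀ u : ℂ, 0 < u.im → HasDerivAt P (kernelTheta p w u) u) (δ : SL(2, ℤ)) :
    ∃ L, ∀ α : ℝ, Tendsto (fun y : ℝ => P (moeb δ (α + I * y))) atTop (𝓝 L) := by
  refine exists_tendsto_vertical (Q := fun z => P (moeb δ z))
    (Q' := fun z => (1 / den δ z ^ 2) • kernelTheta p w (moeb δ z))
    (fun u hu => (hP _ (moeb_im_pos hu)).scomp u (hasDerivAt_moeb (den_ne_zero_of_im hu.ne'))) ?_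
  intro R
  obtain ⟨C, hC, hCf⟩ := exists_norm_thetaVec_moeb_le hp δ
  obtain ⟨K, hK, hKf⟩ := exists_norm_thetaVec_le hp zero_lt_one
  -- One of the three powers pays for the linear growth of a, leaving the required y⁻².
  obtain ⟨D, hD, hDf⟩ := exists_exp_neg_le_rpow (decayRate_pos hp) zero_lt_one (-3)
  set c : ℝ := |((δ 1 0 : ℤ) : ℝ)|
  set d : ℝ := |((δ 1 1 : ℤ) : ℝ)|
  have hc : 0 ≤ c := abs_nonneg _
  have hd : 0 ≤ d := abs_nonneg _
  refine ⟨C * (1 + c * (|R| + 1) + d) * (K * D), fun z hz1 hz2 => ?_⟩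
  have hz : 0 < z.im := by linarith
  have hden : den δ z ≠ 0 := den_ne_zero_of_im hz.ne'
  set a := ‖upperRoot δ z‖ with ha
  have ha0 : 0 < a := norm_pos_iff.2 (upperRoot_ne_zero hden)
  have ha2 : ‖den δ z‖ = a ^ 2 := (norm_upperRoot δ z).symm
  have hle : a ≤ (1 + c * (|R| + 1) + d) * z.im := by
    have h1 : a ^ 2 ≤ c * (|R| + z.im) + d := by
      rw [← ha2, den]
      refine (norm_add_le _ _).trans ?_
      rw [norm_mul, Complex.norm_intCast, Complex.norm_intCast]
      gcongr
      refine (Complex.norm_le_abs_re_add_abs_im z).trans ?_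
      rw [abs_of_pos hz]
      exact add_le_add_left (hz1.trans (le_abs_self R)) _
    have h2 : a ≤ 1 + a ^ 2 := by nlinarith [sq_nonneg (a - 1)]
    have h3 : |R| ≤ |R| * z.im := le_mul_of_one_le_right (abs_nonneg _) hz2
    have h4 : d ≤ d * z.im := le_mul_of_one_le_right hd hz2
    have h5 : c * |R| ≤ c * (|R| * z.im) := by gcongr
    nlinarith
  have h1 := norm_kernelTheta_le (p := p) (moeb_im_pos (γ := δ) hz) hw
  have h2 : (Real.sqrt (moeb δ z).im)⁻¹ ≤ a ^ 2 := by
    rw [moeb_im hden, Real.sqrt_div hz.le, ha2, Real.sqrt_sq (by positivity), inv_div]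
    exact div_le_self (by positivity) (Real.one_le_sqrt.2 hz2)
  have h3 := hCf z hz
  have h4 := hKf z hz2
  have h5 := hDf z.im hz2
  have h6 : z.im ^ (-3 : ℝ) = (z.im ^ 3)⁻¹ := by
    rw [Real.rpow_neg hz.le]; norm_cast
  rw [h6] at h5
  rw [norm_smul, norm_div, norm_one, norm_pow, ha2]
  calc 1 / (a ^ 2) ^ 2 * ‖kernelTheta p w (moeb δ z)‖
      ≤ 1 / (a ^ 2) ^ 2 * (a ^ 2 * (C * a ^ 3 * (K * (D * (z.im ^ 3)⁻¹)))) := by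
        gcongr
        refine h1.trans ?_
        gcongr
        refine h3.trans ?_
        gcongr
        exact h4.trans (by gcongr)
    _ = C * a * (K * D) * (z.im ^ 3)⁻¹ := by field_simp
    _ ≤ C * ((1 + c * (|R| + 1) + d) * z.im) * (K * D) * (z.im ^ 3)⁻¹ := by gcongr
    _ = C * (1 + c * (|R| + 1) + d) * (K * D) * (z.im ^ 2)⁻¹ := by field_simp

/-- The points where the Eichler integral is considered: the lower half-plane and `ℚ`. -/
def LowerPoint (w : ℂ) : Prop := w.im < 0 ∨ ∃ x : ℚ, w = (x : ℂ)

lemma LowerPoint.im_nonpos (h : LowerPoint w) : w.im ≤ 0 := by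
  rcases h with h | ⟨x, rfl⟩
  · exact h.le
  · simp

lemma moeb_ratCast (γ : SL(2, ℤ)) (x : ℚ) :
    moeb γ (x : ℂ) = ((((γ 0 0 : ℤ) * x + (γ 0 1 : ℤ)) / ((γ 1 0 : ℤ) * x + (γ 1 1 : ℤ)) : ℚ) : ℂ) := by
  rw [moeb, den]; push_cast; rfl

lemma LowerPoint.moeb (h : LowerPoint w) : LowerPoint (moeb γ w) := by
  rcases h with h | ⟨x, rfl⟩
  · exact Or.inl (moeb_im_neg h)
  · exact Or.inr ⟨_, moeb_ratCast γ x⟩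

/-- The path starting at `conj w` and ending at `i∞`. -/
lemma kernelTheta_vertical (w : ℂ) (s : ℝ) :
    -I * ((starRingEnd ℂ) w + I * s - w) = ((s - 2 * w.im : ℝ) : ℂ) := by
  rw [show (starRingEnd ℂ) w + I * s - w = -(w - (starRingEnd ℂ) w) + I * s by ring,
    Complex.sub_conj]
  push_cast
  linear_combination (2 * (w.im : ℂ) - s) * I_sq

lemma continuousOn_kernelTheta_vertical (hp : p ≠ 0) (hw : w.im ≤ 0) {z : ℂ} (hz : 0 ≤ z.im) :
    ContinuousOn (fun s : ℝ => kernelTheta p w (z + I * s)) (Set.Ioi 0) :=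
  (differentiableOn_kernelTheta hp hw).continuousOn.comp (by fun_prop) fun t ht => by
    have : 0 < t := ht
    simp; linarith

lemma integrableOn_kernelTheta_rat (hp : p ≠ 0) (hw : w.im ≤ 0) (x : ℚ) :
    IntegrableOn (fun s : ℝ => kernelTheta p w ((x : ℂ) + I * s)) (Set.Ioi 0) := by
  have h : RapidDecay (fun s : ℝ => kernelTheta p w ((x : ℂ) + I * s)) := by
    refine (rapidDecay_thetaVec hp x).mono (C := 1) (r := -(1 / 2)) zero_le_one fun t ht => ?_
    refine (norm_kernelTheta_le (by simpa using ht) hw).trans_eq ?_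
    rw [Real.rpow_neg ht.le, Real.sqrt_eq_rpow]
    simp
  exact h.integrableOn ((continuousOn_kernelTheta_vertical hp hw (by simp)).aestronglyMeasurable
    measurableSet_Ioi)

lemma integrableOn_kernelTheta (hp : p ≠ 0) (hw : LowerPoint w) :
    IntegrableOn (fun s : ℝ => kernelTheta p w ((starRingEnd ℂ) w + I * s)) (Set.Ioi 0) := by
  rcases hw with h | ⟨x, rfl⟩
  · obtain ⟨K, hK, hKf⟩ := exists_norm_thetaVec_le hp (neg_pos.2 h)
    have hi : IntegrableOn (fun s : ℝ => (Real.sqrt (-w.im))⁻¹ * K * Real.exp (-decayRate p * s))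
        (Set.Ioi 0) :=
      (integrableOn_exp_mul_Ioi (neg_neg_iff_pos.2 (decayRate_pos hp)) 0).const_mul _
    refine Integrable.mono' hi ((continuousOn_kernelTheta_vertical hp h.le
      (by simpa using h.le)).aestronglyMeasurable measurableSet_Ioi) ?_
    filter_upwards [ae_restrict_mem measurableSet_Ioi] with s hs
    have hs0 : 0 < s := hs
    have him : ((starRingEnd ℂ) w + I * s).im = -w.im + s := by simp
    have hu : 0 < ((starRingEnd ℂ) w + I * s).im := by rw [him]; linarith
    refine (norm_kernelTheta_le hu h.le).trans ?_
    rw [mul_assoc]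
    have h1 := hKf ((starRingEnd ℂ) w + I * s) (by rw [him]; linarith)
    rw [him] at h1 ⊢
    gcongr
    · exact Real.sqrt_pos.2 (neg_pos.2 h)
    · linarith
    · refine h1.trans ?_
      have := mul_pos (decayRate_pos hp) (neg_pos.2 h)
      gcongr ?_ * Real.exp ?_
      linarith
  · rw [map_ratCast]
    exact integrableOn_kernelTheta_rat hp (by simp) x

/-- `∫ f(z) (-i (z - w)) ^ (-1/2) |dz|` over the vertical path from `conj w` to `i∞`. -/
noncomputable def eichlerVec (p : ℕ) (w : ℂ) : Fin (p - 1) → ℂ :=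
  ∫ s in Set.Ioi (0 : ℝ), kernelTheta p w ((starRingEnd ℂ) w + I * s)

lemma hasDerivAt_vertical (z : ℂ) (s : ℝ) : HasDerivAt (fun s : ℝ => z + I * s) I s := by
  simpa using ((Complex.ofRealCLM.hasDerivAt (x := s)).const_mul I).const_add z

lemma slOneZero_ne_zero_of_den {x : ℂ} (h : den γ x = 0) : γ 1 0 ≠ 0 := by
  intro hc
  have h2 := det_cast γ
  rw [den, hc] at h
  simp only [Int.cast_zero, zero_mul, zero_add] at h
  rw [hc, h] at h2
  simp at h2

/-- The limit of a primitive at the cusp `x = δ⁻¹ ∞`, along the image of a vertical line. -/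
lemma tendsto_primitive_at_cusp {P : ℂ → Fin (p - 1) → ℂ} {δ : SL(2, ℤ)} {x : ℂ}
    (hx : x.im = 0) (hδ : den δ x = 0) (hγ : den γ x ≠ 0) {L : Fin (p - 1) → ℂ}
    (hL : ∀ α : ℝ, Tendsto (fun y : ℝ => P (moeb δ⁻¹ (α + I * y))) atTop (𝓝 L)) :
    Tendsto (fun s : ℝ => P (moeb γ⁻¹ (moeb γ x + I * s))) (𝓝[>] 0) (𝓝 L) := by
  have hgx : den γ⁻¹ (moeb γ x) ≠ 0 := by
    have h1 : den (γ⁻¹ * γ) x = den γ⁻¹ (moeb γ x) * den γ x := den_mul hγ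
    rw [inv_mul_cancel] at h1
    intro h
    rw [h, zero_mul] at h1
    simp [den] at h1
  -- The matrix δγ⁻¹ sends γx to ∞, so it straightens the half-line above γx to a vertical line
  -- running towards i∞.
  have hδ' : den (δ * γ⁻¹) (moeb γ x) = 0 := by
    rw [den_mul hgx, moeb_inv_moeb hγ, hδ, zero_mul]
  have hc := slOneZero_ne_zero_of_den hδ'
  have him : (moeb γ x).im = 0 := by rw [moeb_im hγ, hx, zero_div]
  set c : ℝ := (((δ * γ⁻¹) 1 0 : ℤ) : ℝ) with hcdef
  have hc2 : 0 < c ^ 2 := by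
    have : c ≠ 0 := by rw [hcdef]; exact_mod_cast hc
    positivity
  have hlim : Tendsto (fun s : ℝ => 1 / (c ^ 2 * s)) (𝓝[>] 0) atTop := by
    simp_rw [one_div, mul_inv]
    exact tendsto_inv_nhdsGT_zero.const_mul_atTop (inv_pos.2 hc2)
  refine ((hL (((δ * γ⁻¹) 0 0 : ℤ) / ((δ * γ⁻¹) 1 0 : ℤ) : ℝ)).comp hlim).congr' ?_
  filter_upwards [self_mem_nhdsWithin] with s hs
  have hs0 : (0 : ℝ) < s := hs
  have hsi : 0 < (moeb γ x + I * s).im := by simp [him, hs0]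
  simp only [Function.comp_apply]
  rw [← moeb_cusp hc hδ' hs0.ne', ← moeb_mul (den_ne_zero_of_im hsi.ne'), ← mul_assoc,
    inv_mul_cancel, one_mul]

lemma tendsto_vertical_infty {P : ℂ → Fin (p - 1) → ℂ} {L : Fin (p - 1) → ℂ} {δ : SL(2, ℤ)}
    (hL : ∀ α : ℝ, Tendsto (fun y : ℝ => P (moeb δ (α + I * y))) atTop (𝓝 L)) (z : ℂ) :
    Tendsto (fun s : ℝ => P (moeb δ (z + I * s))) atTop (𝓝 L) := by
  refine ((hL z.re).comp (tendsto_atTop_add_const_left atTop z.im tendsto_id)).congr fun s => ?_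
  simp only [Function.comp_apply, id]
  congr 2
  conv_rhs => rw [← Complex.re_add_im z]
  push_cast; ring

/-- Let P be one primitive of the kernel, L δ its limit at the cusp δ∞, and m its value at conj w,
read as a cusp limit for rational w. Up to the factor i, the three terms are L 1 - m, L γ⁻¹ - m and
L 1 - L γ⁻¹. -/
theorem eichlerVec_sub (hp : p ≠ 0) (hw : LowerPoint w) (hd : den γ w ≠ 0) {x : ℚ}
    (hx : den γ (x : ℂ) = 0) :
    eichlerVec p w - (lowerRoot γ w)⁻¹ •
        ((mult hp γ : Matrix (Fin (p - 1)) (Fin (p - 1)) ℂ) *ᵥ eichlerVec p (moeb γ w)) =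
      ∫ s in Set.Ioi (0 : ℝ), kernelTheta p w ((x : ℂ) + I * s) := by
  have hwi := hw.im_nonpos
  obtain ⟨P, hP⟩ := exists_primitive_upper (differentiableOn_kernelTheta hp hwi)
  choose L hL using exists_tendsto_primitive_cusp hp hwi hP
  have hL1 : ∀ α : ℝ, Tendsto (fun y : ℝ => P (α + I * y)) atTop (𝓝 (L 1)) := by
    simpa only [moeb_one] using hL 1
  -- the path from the cusp `γ⁻¹ ∞` to `i∞`
  have hV : ∫ s in Set.Ioi (0 : ℝ), I • kernelTheta p w ((x : ℂ) + I * s) = L 1 - L γ⁻¹ := by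
    refine integral_Ioi_of_tendsto (f := fun s : ℝ => P ((x : ℂ) + I * s)) (fun s hs => ?_)
      ((integrableOn_kernelTheta_rat hp hwi x).smul I) ?_ ?_
    · exact (hP _ (by simpa using hs)).scomp s (hasDerivAt_vertical _ s)
    · have := tendsto_primitive_at_cusp (γ := 1) (x := (x : ℂ)) (by simp) hx (by simp [den])
        (hL γ⁻¹)
      simpa only [inv_one, moeb_one] using this
    · simpa only [moeb_one] using tendsto_vertical_infty (hL 1) (x : ℂ)
  -- the common starting point
  obtain ⟨m, hm⟩ : ∃ m, ∀ γ : SL(2, ℤ), den γ w ≠ 0 →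
      Tendsto (fun s : ℝ => P (moeb γ⁻¹ ((starRingEnd ℂ) (moeb γ w) + I * s))) (𝓝[>] 0) (𝓝 m) := by
    rcases hw with h | ⟨y, rfl⟩
    · refine ⟨P ((starRingEnd ℂ) w), fun γ hγ => ?_⟩
      have hi : 0 < ((starRingEnd ℂ) w).im := by simpa using h
      have hi2 : 0 < ((starRingEnd ℂ) (moeb γ w)).im := by simpa using moeb_im_neg (γ := γ) h
      have hc : ContinuousAt (fun s : ℝ => P (moeb γ⁻¹ ((starRingEnd ℂ) (moeb γ w) + I * s))) 0 := by
        have e : (starRingEnd ℂ) (moeb γ w) + I * ((0 : ℝ) : ℂ) = (starRingEnd ℂ) (moeb γ w) := by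
          simp
        refine ContinuousAt.comp (g := P) (f := fun s : ℝ =>
          moeb γ⁻¹ ((starRingEnd ℂ) (moeb γ w) + I * s)) ?_ ?_
        · rw [e]
          exact (hP _ (moeb_im_pos hi2)).continuousAt
        · refine ContinuousAt.comp (g := moeb γ⁻¹) (f := fun s : ℝ =>
            (starRingEnd ℂ) (moeb γ w) + I * s) ?_ (by fun_prop)
          rw [e]
          exact (hasDerivAt_moeb (den_ne_zero_of_im hi2.ne')).continuousAt
      have := hc.tendsto.mono_left (nhdsWithin_le_nhds (s := Set.Ioi (0 : ℝ)))
      rwa [Complex.ofReal_zero, mul_zero, add_zero, conj_moeb, moeb_inv_moeb (den_ne_zero_of_im hi.ne'), ← conj_moeb] at this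
    · obtain ⟨δ, _, hδ⟩ := exists_den_eq_zero y
      refine ⟨L δ⁻¹, fun γ hγ => ?_⟩
      have e : (starRingEnd ℂ) (moeb γ (y : ℂ)) = moeb γ (y : ℂ) := by
        rw [conj_moeb, map_ratCast]
      rw [e]
      exact tendsto_primitive_at_cusp (by simp) hδ hγ (hL δ⁻¹)
  -- the path from `conj w` to `i∞`
  have hA : ∫ s in Set.Ioi (0 : ℝ), I • kernelTheta p w ((starRingEnd ℂ) w + I * s) = L 1 - m := by
    refine integral_Ioi_of_tendsto (f := fun s : ℝ => P ((starRingEnd ℂ) w + I * s))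
      (fun s hs => ?_) ((integrableOn_kernelTheta hp hw).smul I) ?_ ?_
    · refine (hP _ ?_).scomp s (hasDerivAt_vertical _ s)
      simp; linarith
    · simpa only [inv_one, moeb_one] using hm 1 (by simp [den])
    · simpa only [moeb_one] using tendsto_vertical_infty (hL 1) ((starRingEnd ℂ) w)
  -- the image under `γ⁻¹` of the vertical path from `conj (γ w)`
  have hgw : LowerPoint (moeb γ w) := hw.moeb
  let M := LinearMap.toContinuousLinearMap
    (Matrix.mulVecLin (mult hp γ : Matrix (Fin (p - 1)) (Fin (p - 1)) ℂ))
  have hM : ∀ v, M v = (mult hp γ : Matrix (Fin (p - 1)) (Fin (p - 1)) ℂ) *ᵥ v := fun v => rfl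
  have hB : ∫ s in Set.Ioi (0 : ℝ), I • (lowerRoot γ w)⁻¹ •
      M (kernelTheta p (moeb γ w) ((starRingEnd ℂ) (moeb γ w) + I * s)) = L γ⁻¹ - m := by
    refine integral_Ioi_of_tendsto
      (f := fun s : ℝ => P (moeb γ⁻¹ ((starRingEnd ℂ) (moeb γ w) + I * s)))
      (fun s hs => ?_) ?_ (hm γ hd) (tendsto_vertical_infty (hL γ⁻¹) _)
    · have hi : 0 < ((starRingEnd ℂ) (moeb γ w) + I * s).im := by
        have := hgw.im_nonpos
        simp; linarith
      rw [hM, ← kernelTheta_moeb hp hi hwi hd]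
      have h1 := (hP _ (moeb_im_pos (γ := γ⁻¹) hi)).scomp _
        (hasDerivAt_moeb (γ := γ⁻¹) (den_ne_zero_of_im hi.ne'))
      exact HasDerivAt.scomp (h := fun s : ℝ => (starRingEnd ℂ) (moeb γ w) + I * s) s h1
        (hasDerivAt_vertical _ s)
    · exact ((M.integrable_comp (integrableOn_kernelTheta hp hgw)).smul (lowerRoot γ w)⁻¹).smul I
  rw [integral_smul] at hV hA hB
  rw [integral_smul, M.integral_comp_comm (integrableOn_kernelTheta hp hgw)] at hB
  refine smul_right_injective _ I_ne_zero ?_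
  simp only [eichlerVec, smul_sub]
  rw [hA, hV]
  have := hB
  rw [hM] at this
  rw [this]
  abel

end Eichler

/-! ### Asymptotic expansions -/

section Expansion

/-- Near 0 this is Taylor's estimate. Away from 0 a trivial bound suffices, because |r|^N is bounded
below. The factor (1 - r)^{-1/2} on the right keeps the estimate valid up to r → 1, where the
function is unbounded. -/
lemma exists_inv_sqrt_expansion : ∃ c : ℕ → ℝ, c 0 = 1 ∧ ∀ N : ℕ, ∃ C : ℝ, 0 ≤ C ∧
    ∀ r : ℝ, |r| < 1 → |(Real.sqrt (1 - r))⁻¹ - ∑ n ∈ Finset.range N, c n * r ^ n| ≤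
      C * |r| ^ N * (Real.sqrt (1 - r))⁻¹ := by
  have han : AnalyticAt ℝ (fun r : ℝ => (1 - r) ^ (-(1 / 2) : ℝ)) 0 := by
    have h1 : AnalyticAt ℝ (fun r : ℝ => 1 - r) 0 := by fun_prop
    have h2 := ((Real.contDiffAt_rpow_const_of_ne (n := ω) (p := (-(1 / 2) : ℝ)) (x := 1 - 0)
      (by norm_num)).analyticAt).comp_of_eq h1 rfl
    exact h2
  have heq : ∀ r : ℝ, r < 1 → (1 - r) ^ (-(1 / 2) : ℝ) = (Real.sqrt (1 - r))⁻¹ := by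
    intro r hr
    rw [Real.rpow_neg (by linarith), Real.sqrt_eq_rpow]
  obtain ⟨q, hq⟩ := han
  refine ⟨fun n => q.coeff n, ?_, fun N => ?_⟩
  · have := hq.coeff_zero (fun _ => 0)
    change q 0 1 = 1
    have e : (1 : Fin 0 → ℝ) = fun _ => 0 := Subsingleton.elim _ _
    rw [e, this]; simp
  obtain ⟨C, hC0, hC⟩ := (hq.isBigO_sub_partialSum_pow N).exists_nonneg
  rw [isBigOWith_iff] at hC
  obtain ⟨δ, hδ, hδC⟩ := Metric.eventually_nhds_iff.1 hC
  set B := ∑ n ∈ Finset.range N, |q.coeff n| with hB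
  have hB0 : 0 ≤ B := Finset.sum_nonneg fun _ _ => abs_nonneg _
  refine ⟨2 * C + (1 + 2 * B) / δ ^ N, by positivity, fun r hr => ?_⟩
  have hr' := abs_lt.1 hr
  have hs0 : 0 < Real.sqrt (1 - r) := Real.sqrt_pos.2 (by linarith)
  have hs2 : Real.sqrt (1 - r) ≤ 2 := by
    rw [Real.sqrt_le_left (by norm_num)]; linarith
  have hs : 1 ≤ 2 * (Real.sqrt (1 - r))⁻¹ := by
    rw [← div_eq_mul_inv, le_div_iff₀ hs0]; linarith
  rcases lt_or_ge |r| δ with h | h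
  · have h1 := hδC (show dist r 0 < δ by simpa using h)
    rw [zero_add, heq r hr'.2, FormalMultilinearSeries.partialSum] at h1
    simp only [FormalMultilinearSeries.apply_eq_pow_smul_coeff, smul_eq_mul, Real.norm_eq_abs,
      abs_pow, abs_abs] at h1
    simp_rw [mul_comm (q.coeff _)]
    refine h1.trans ?_
    calc C * |r| ^ N ≤ C * |r| ^ N * (2 * (Real.sqrt (1 - r))⁻¹) :=
          le_mul_of_one_le_right (by positivity) hs
      _ = 2 * C * |r| ^ N * (Real.sqrt (1 - r))⁻¹ := by ring
      _ ≤ _ := by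
          gcongr
          exact le_add_of_nonneg_right (by positivity)
  · have h1 : |∑ n ∈ Finset.range N, q.coeff n * r ^ n| ≤ B := by
      refine (Finset.abs_sum_le_sum_abs _ _).trans (Finset.sum_le_sum fun n _ => ?_)
      rw [abs_mul, abs_pow]
      exact mul_le_of_le_one_right (abs_nonneg _) (pow_le_one₀ (abs_nonneg _) hr.le)
    have h2 : 1 ≤ |r| ^ N / δ ^ N := by
      rw [← div_pow]
      exact one_le_pow₀ ((one_le_div hδ).2 h)
    calc |(Real.sqrt (1 - r))⁻¹ - ∑ n ∈ Finset.range N, q.coeff n * r ^ n|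
        ≤ (Real.sqrt (1 - r))⁻¹ + B := by
          refine (abs_sub _ _).trans ?_
          rw [abs_of_pos (inv_pos.2 hs0)]
          gcongr
      _ ≤ (1 + 2 * B) * (Real.sqrt (1 - r))⁻¹ * 1 := by nlinarith
      _ ≤ (1 + 2 * B) * (Real.sqrt (1 - r))⁻¹ * (|r| ^ N / δ ^ N) := by gcongr
      _ = (1 + 2 * B) / δ ^ N * |r| ^ N * (Real.sqrt (1 - r))⁻¹ := by ring
      _ ≤ _ := by
          gcongr
          exact le_add_of_nonneg_left (by positivity)

variable {E : Type*} [NormedAddCommGroup E]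

lemma integrableOn_Ioi_comp_add {g : ℝ → E} {a : ℝ} :
    IntegrableOn (fun s => g (s + a)) (Set.Ioi 0) ↔ IntegrableOn g (Set.Ioi a) := by
  have := (measurePreserving_add_right volume a).integrableOn_comp_preimage
    (measurableEmbedding_addRight a) (f := g) (s := Set.Ioi a)
  rwa [Set.preimage_add_const_Ioi, sub_self] at this

lemma integral_Ioi_comp_add [NormedSpace ℝ E] (g : ℝ → E) (a : ℝ) :
    ∫ s in Set.Ioi (0 : ℝ), g (s + a) = ∫ t in Set.Ioi a, g t := by
  have := (measurePreserving_add_right volume a).setIntegral_preimage_emb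
    (measurableEmbedding_addRight a) g (Set.Ioi a)
  rwa [Set.preimage_add_const_Ioi, sub_self] at this

lemma integrableOn_inv_sqrt_Ioc (a : ℝ) :
    IntegrableOn (fun s : ℝ => (Real.sqrt s)⁻¹) (Set.Ioc 0 a) := by
  have h : IntegrableOn (fun s : ℝ => s ^ (-(1 / 2) : ℝ)) (Set.Ioc 0 a) := by
    rcases le_total 0 a with ha | ha
    · exact (intervalIntegrable_iff_integrableOn_Ioc_of_le ha).1
        (intervalIntegral.intervalIntegrable_rpow' (by norm_num))
    · simp [Set.Ioc_eq_empty_of_le ha]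
  refine h.congr_fun (fun s hs => ?_) measurableSet_Ioc
  simp only
  rw [Real.rpow_neg hs.1.le, Real.sqrt_eq_rpow]

lemma integrableOn_inv_one_add_sq_mul_inv_sqrt :
    IntegrableOn (fun s : ℝ => (1 + s ^ 2)⁻¹ * (Real.sqrt s)⁻¹) (Set.Ioi 0) := by
  have hm : Measurable (fun s : ℝ => (1 + s ^ 2)⁻¹ * (Real.sqrt s)⁻¹) := by fun_prop
  rw [← Set.Ioc_union_Ioi_eq_Ioi zero_le_one]
  refine IntegrableOn.union ?_ ?_
  · refine Integrable.mono' (integrableOn_inv_sqrt_Ioc 1) hm.aestronglyMeasurable ?_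
    filter_upwards with s
    rw [norm_mul, Real.norm_of_nonneg (by positivity), Real.norm_of_nonneg (by positivity)]
    exact mul_le_of_le_one_left (by positivity) (inv_le_one_of_one_le₀ (by nlinarith))
  · refine Integrable.mono' integrable_inv_one_add_sq.integrableOn hm.aestronglyMeasurable ?_
    filter_upwards [ae_restrict_mem measurableSet_Ioi] with s hs
    rw [norm_mul, Real.norm_of_nonneg (by positivity), Real.norm_of_nonneg (by positivity)]
    exact mul_le_of_le_one_right (by positivity)
      (inv_le_one_of_one_le₀ (Real.one_le_sqrt.2 (le_of_lt hs)))

/-- Translating by a moves the singularity to 0 and only decreases the other factor. The bound is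
independent of a, which makes the error constant of the expansion independent of y. -/
lemma integrableOn_inv_one_add_sq_mul_inv_sqrt_sub {a : ℝ} (ha : 0 ≤ a) :
    IntegrableOn (fun t : ℝ => (1 + t ^ 2)⁻¹ * (Real.sqrt (t - a))⁻¹) (Set.Ioi a) ∧
    ∫ t in Set.Ioi a, (1 + t ^ 2)⁻¹ * (Real.sqrt (t - a))⁻¹ ≤
      ∫ s in Set.Ioi (0 : ℝ), (1 + s ^ 2)⁻¹ * (Real.sqrt s)⁻¹ := by
  have hle : ∀ s ∈ Set.Ioi (0 : ℝ), (1 + (s + a) ^ 2)⁻¹ * (Real.sqrt (s + a - a))⁻¹ ≤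
      (1 + s ^ 2)⁻¹ * (Real.sqrt s)⁻¹ := by
    intro s hs
    have hs0 : 0 < s := hs
    rw [add_sub_cancel_right]
    gcongr
    linarith
  have hi : IntegrableOn (fun s : ℝ => (1 + (s + a) ^ 2)⁻¹ * (Real.sqrt (s + a - a))⁻¹)
      (Set.Ioi 0) := by
    refine Integrable.mono' integrableOn_inv_one_add_sq_mul_inv_sqrt
      (Measurable.aestronglyMeasurable (by fun_prop)) ?_
    filter_upwards [ae_restrict_mem measurableSet_Ioi] with s hs
    rw [Real.norm_of_nonneg (by positivity)]
    exact hle s hs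
  refine ⟨integrableOn_Ioi_comp_add.1 hi, ?_⟩
  rw [← integral_Ioi_comp_add (fun t : ℝ => (1 + t ^ 2)⁻¹ * (Real.sqrt (t - a))⁻¹) a]
  exact setIntegral_mono_on hi integrableOn_inv_one_add_sq_mul_inv_sqrt measurableSet_Ioi hle

variable [NormedSpace ℝ E]

/-- The half-order fractional integral `∫_{|y|}^∞ φ(t) (t - y) ^ (-1/2) dt` of a rapidly decaying
function has an asymptotic expansion as `y → 0` from both sides. -/
theorem RapidDecay.exists_expansion {φ : ℝ → E} (h : RapidDecay φ)
    (hc : ContinuousOn φ (Set.Ioi 0)) :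
    ∃ a : ℕ → E, a 0 = ∫ t in Set.Ioi (0 : ℝ), (Real.sqrt t)⁻¹ • φ t ∧ ∀ N : ℕ,
      (fun y : ℝ => (∫ t in Set.Ioi |y|, (Real.sqrt (t - y))⁻¹ • φ t) -
        ∑ n ∈ Finset.range N, y ^ n • a n) =O[𝓝 0] (fun y : ℝ => y ^ N) := by
  obtain ⟨c, hc0, hcN⟩ := exists_inv_sqrt_expansion
  have hmeas := hc.aestronglyMeasurable (μ := volume) measurableSet_Ioi
  -- Rapid decay at 0 makes all negative moments ∫ t^{-n-1/2} φ finite; they are the coefficients up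
  -- to the factors c n.
  have hpow : ∀ n : ℕ, RapidDecay (fun t => (t ^ n)⁻¹ • (Real.sqrt t)⁻¹ • φ t) := by
    intro n
    refine h.mono (C := 1) (r := -(n + 1 / 2)) zero_le_one fun t ht => ?_
    rw [norm_smul, norm_smul, ← mul_assoc, Real.norm_of_nonneg (by positivity),
      Real.norm_of_nonneg (by positivity), Real.rpow_neg ht.le, Real.rpow_add ht,
      Real.rpow_natCast, ← Real.sqrt_eq_rpow, mul_inv, one_mul]
  have hpowi : ∀ n : ℕ, IntegrableOn (fun t => (t ^ n)⁻¹ • (Real.sqrt t)⁻¹ • φ t) (Set.Ioi 0) := by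
    intro n
    refine (hpow n).integrableOn ?_
    exact AEStronglyMeasurable.smul (Measurable.aestronglyMeasurable (by fun_prop))
      (AEStronglyMeasurable.smul (Measurable.aestronglyMeasurable (by fun_prop)) hmeas)
  refine ⟨fun n => c n • ∫ t in Set.Ioi (0 : ℝ), (t ^ n)⁻¹ • (Real.sqrt t)⁻¹ • φ t, by simp [hc0],
    fun N => ?_⟩
  obtain ⟨C, hC, hCr⟩ := hcN N
  set B := ∑ n ∈ Finset.range N, |c n| with hB
  have hB0 : 0 ≤ B := Finset.sum_nonneg fun _ _ => abs_nonneg _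
  obtain ⟨D₁, hD₁, hD₁f⟩ := (h.mono (ψ := fun t => (t ^ N)⁻¹ • φ t) (C := 1) (r := -N)
    zero_le_one fun t ht => by
      rw [norm_smul, Real.norm_of_nonneg (by positivity), Real.rpow_neg ht.le, Real.rpow_natCast,
        one_mul]).exists_bound
  obtain ⟨D₂, hD₂, hD₂f⟩ := (hpow N).exists_bound
  set J := ∫ s in Set.Ioi (0 : ℝ), (1 + s ^ 2)⁻¹ * (Real.sqrt s)⁻¹
  set J' := ∫ s in Set.Ioi (0 : ℝ), (1 + s ^ 2)⁻¹
  refine IsBigO.of_bound (C * D₁ * J + B * D₂ * J') (Eventually.of_forall fun y => ?_)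
  -- Extending the kernel by 0 to t ≤ |y| puts it and its Taylor polynomial under one integral over
  -- (0, ∞).
  set k : ℝ → ℝ := fun t => (Set.Ioi |y|).indicator (fun t => (Real.sqrt (t - y))⁻¹) t with hk
  set b : ℝ → ℝ := fun t => (Set.Ioi |y|).indicator
    (fun t => (1 + t ^ 2)⁻¹ * (Real.sqrt (t - |y|))⁻¹) t with hb
  have hsub : Set.Ioi (0 : ℝ) ∩ Set.Ioi |y| = Set.Ioi |y| :=
    Set.inter_eq_right.2 (Set.Ioi_subset_Ioi (abs_nonneg y))
  have hle : ∀ t : ℝ, |y| < t → (Real.sqrt (t - y))⁻¹ ≤ (Real.sqrt (t - |y|))⁻¹ := by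
    intro t ht
    have := le_abs_self y
    gcongr
  -- the pointwise estimate of the kernels
  have hker : ∀ t : ℝ, 0 < t → |k t - ∑ n ∈ Finset.range N, y ^ n * c n * ((t ^ n)⁻¹ *
      (Real.sqrt t)⁻¹)| ≤ |y| ^ N * (C * ((t ^ N)⁻¹ * k t) + B * ((t ^ N)⁻¹ * (Real.sqrt t)⁻¹)) := by
    intro t ht
    have hs0 : 0 < Real.sqrt t := Real.sqrt_pos.2 ht
    have e : ∑ n ∈ Finset.range N, y ^ n * c n * ((t ^ n)⁻¹ * (Real.sqrt t)⁻¹) =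
        (Real.sqrt t)⁻¹ * ∑ n ∈ Finset.range N, c n * (y / t) ^ n := by
      rw [Finset.mul_sum]
      refine Finset.sum_congr rfl fun n _ => ?_
      rw [div_pow]; ring
    rw [e]
    by_cases hyt : |y| < t
    · have hk1 : k t = (Real.sqrt t)⁻¹ * (Real.sqrt (1 - y / t))⁻¹ := by
        simp only [hk]
        rw [Set.indicator_of_mem (show t ∈ Set.Ioi |y| from hyt), ← mul_inv, ← Real.sqrt_mul ht.le]
        congr 2
        field_simp
      have hr : |y / t| < 1 := by rwa [abs_div, abs_of_pos ht, div_lt_one ht]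
      rw [hk1, ← mul_sub, abs_mul, abs_of_pos (inv_pos.2 hs0)]
      calc (Real.sqrt t)⁻¹ * |(Real.sqrt (1 - y / t))⁻¹ - ∑ n ∈ Finset.range N, c n * (y / t) ^ n|
          ≤ (Real.sqrt t)⁻¹ * (C * |y / t| ^ N * (Real.sqrt (1 - y / t))⁻¹) := by
            gcongr; exact hCr _ hr
        _ = |y| ^ N * (C * ((t ^ N)⁻¹ * ((Real.sqrt t)⁻¹ * (Real.sqrt (1 - y / t))⁻¹))) := by
            rw [abs_div, abs_of_pos ht, div_pow]; ring
        _ ≤ _ := by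
            gcongr
            exact le_add_of_nonneg_right (by positivity)
    -- Below the cut-off only the polynomial is left. Since |y|/t ≥ 1 there, each of its powers is
    -- at most (|y|/t)^N, so this range also costs O(y^N).
    · have hk1 : k t = 0 := Set.indicator_of_notMem (by simpa using hyt) _
      have hr : 1 ≤ |y| / t := by rw [le_div_iff₀ ht]; linarith
      rw [hk1, zero_sub, abs_neg, abs_mul, abs_of_pos (inv_pos.2 hs0), mul_zero, mul_zero, zero_add]
      have h1 : |∑ n ∈ Finset.range N, c n * (y / t) ^ n| ≤ B * (|y| / t) ^ N := by
        rw [hB, Finset.sum_mul]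
        refine (Finset.abs_sum_le_sum_abs _ _).trans (Finset.sum_le_sum fun n hn => ?_)
        rw [abs_mul, abs_pow, abs_div, abs_of_pos ht]
        gcongr
        exact (Finset.mem_range.1 hn).le
      calc (Real.sqrt t)⁻¹ * |∑ n ∈ Finset.range N, c n * (y / t) ^ n|
          ≤ (Real.sqrt t)⁻¹ * (B * (|y| / t) ^ N) := by gcongr
        _ = _ := by rw [div_pow]; ring
  have hkm : Measurable k := by
    refine Measurable.indicator ?_ measurableSet_Ioi
    fun_prop
  have hk0 : ∀ t, 0 ≤ k t := fun t => Set.indicator_nonneg (fun t _ => by positivity) t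
  have hkb : ∀ t, (1 + t ^ 2)⁻¹ * k t ≤ b t := by
    intro t
    by_cases hyt : |y| < t
    · simp only [hk, hb]
      rw [Set.indicator_of_mem (show t ∈ Set.Ioi |y| from hyt),
        Set.indicator_of_mem (show t ∈ Set.Ioi |y| from hyt)]
      exact mul_le_mul_of_nonneg_left (hle t hyt) (by positivity)
    · simp only [hk, hb]
      rw [Set.indicator_of_notMem (by simpa using hyt), Set.indicator_of_notMem (by simpa using hyt),
        mul_zero]
  obtain ⟨hbi, hbJ⟩ := integrableOn_inv_one_add_sq_mul_inv_sqrt_sub (abs_nonneg y)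
  have hbint : IntegrableOn b (Set.Ioi 0) := by
    have : Integrable b := (integrable_indicator_iff measurableSet_Ioi).2 hbi
    exact this.integrableOn
  have hbJ' : ∫ t in Set.Ioi (0 : ℝ), b t ≤ J := by
    rw [setIntegral_indicator measurableSet_Ioi, hsub]
    exact hbJ
  have hkφ : IntegrableOn (fun t => k t • φ t) (Set.Ioi 0) := by
    obtain ⟨D, hD, hDf⟩ := h.exists_bound
    refine Integrable.mono' (hbint.const_mul D) (hkm.aestronglyMeasurable.smul hmeas) ?_
    filter_upwards [ae_restrict_mem measurableSet_Ioi] with t ht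
    rw [norm_smul, Real.norm_of_nonneg (hk0 t)]
    calc k t * ‖φ t‖ ≤ k t * (D * (1 + t ^ 2)⁻¹) := by
          gcongr
          · exact hk0 t
          · exact hDf t ht
      _ = D * ((1 + t ^ 2)⁻¹ * k t) := by ring
      _ ≤ _ := by gcongr; exact hkb t
  have hmain : (∫ t in Set.Ioi |y|, (Real.sqrt (t - y))⁻¹ • φ t) -
      ∑ n ∈ Finset.range N, y ^ n • c n • ∫ t in Set.Ioi (0 : ℝ), (t ^ n)⁻¹ • (Real.sqrt t)⁻¹ • φ t =
      ∫ t in Set.Ioi (0 : ℝ), (k t - ∑ n ∈ Finset.range N, y ^ n * c n * ((t ^ n)⁻¹ *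
        (Real.sqrt t)⁻¹)) • φ t := by
    have e1 : ∫ t in Set.Ioi |y|, (Real.sqrt (t - y))⁻¹ • φ t =
        ∫ t in Set.Ioi (0 : ℝ), k t • φ t := by
      have : (fun t => k t • φ t) = (Set.Ioi |y|).indicator
          (fun t => (Real.sqrt (t - y))⁻¹ • φ t) := by
        ext t; rw [hk, Set.indicator_smul_apply_left]
      rw [this, setIntegral_indicator measurableSet_Ioi, hsub]
    have hI : ∀ n : ℕ, IntegrableOn (fun t => y ^ n • c n • (t ^ n)⁻¹ • (Real.sqrt t)⁻¹ • φ t)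
        (Set.Ioi 0) := fun n => ((hpowi n).smul (c n)).smul (y ^ n)
    have e2 : ∑ n ∈ Finset.range N,
        y ^ n • c n • ∫ t in Set.Ioi (0 : ℝ), (t ^ n)⁻¹ • (Real.sqrt t)⁻¹ • φ t =
        ∫ t in Set.Ioi (0 : ℝ), ∑ n ∈ Finset.range N,
          y ^ n • c n • (t ^ n)⁻¹ • (Real.sqrt t)⁻¹ • φ t := by
      rw [integral_finsetSum _ fun n _ => hI n]
      simp_rw [integral_smul]
    rw [e1, e2, ← integral_sub hkφ (integrable_finsetSum _ fun n _ => hI n)]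
    congr 1; ext t
    rw [sub_smul, Finset.sum_smul]
    simp only [smul_smul, mul_assoc]
  rw [hmain]
  refine (norm_integral_le_of_norm_le (g := fun t => |y| ^ N * (C * D₁ * b t +
    B * D₂ * (1 + t ^ 2)⁻¹)) ?_ ?_).trans ?_
  · exact ((hbint.const_mul _).add
      ((integrable_inv_one_add_sq.integrableOn).const_mul _)).const_mul _
  · filter_upwards [ae_restrict_mem measurableSet_Ioi] with t ht
    have ht0 : 0 < t := ht
    have h1 := hD₁f t ht0
    have h2 := hD₂f t ht0
    rw [norm_smul, Real.norm_of_nonneg (by positivity)] at h1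
    rw [smul_smul, norm_smul, Real.norm_of_nonneg (by positivity)] at h2
    rw [norm_smul, Real.norm_eq_abs]
    calc _ ≤ |y| ^ N * (C * ((t ^ N)⁻¹ * k t) + B * ((t ^ N)⁻¹ * (Real.sqrt t)⁻¹)) * ‖φ t‖ := by
          gcongr; exact hker t ht0
      _ = |y| ^ N * (C * k t * ((t ^ N)⁻¹ * ‖φ t‖) +
            B * ((t ^ N)⁻¹ * (Real.sqrt t)⁻¹ * ‖φ t‖)) := by ring
      _ ≤ |y| ^ N * (C * k t * (D₁ * (1 + t ^ 2)⁻¹) + B * (D₂ * (1 + t ^ 2)⁻¹)) := by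
          have := hk0 t
          gcongr
      _ = |y| ^ N * (C * D₁ * ((1 + t ^ 2)⁻¹ * k t) + B * D₂ * (1 + t ^ 2)⁻¹) := by ring
      _ ≤ _ := by gcongr; exact hkb t
  · rw [integral_const_mul, integral_add (hbint.const_mul _)
      ((integrable_inv_one_add_sq.integrableOn).const_mul _), integral_const_mul,
      integral_const_mul, Real.norm_eq_abs, abs_pow, mul_comm]
    gcongr

end Expansion

/-! ### Integral representations -/

section Representation

variable {p j : ℕ} {w : ℂ}

lemma integrableOn_inv_sqrt_mul_exp_neg {b : ℝ} (hb : 0 < b) :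
    IntegrableOn (fun s : ℝ => (Real.sqrt s)⁻¹ * Real.exp (-b * s)) (Set.Ioi 0) := by
  refine (integrableOn_rpow_mul_exp_neg_mul_rpow (s := -(1 / 2)) (p := 1) (by norm_num)
    zero_lt_one hb).congr_fun (fun s hs => ?_) measurableSet_Ioi
  have hs0 : 0 < s := hs
  simp only [Real.rpow_one]
  rw [Real.rpow_neg hs0.le, Real.sqrt_eq_rpow]

lemma integral_inv_sqrt_mul_exp_neg {b : ℝ} (hb : 0 < b) :
    ∫ s in Set.Ioi (0 : ℝ), (Real.sqrt s)⁻¹ * Real.exp (-b * s) = Real.sqrt (Real.pi / b) := by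
  have h := Real.integral_rpow_mul_exp_neg_mul_Ioi (a := 1 / 2) one_half_pos hb
  rw [Real.Gamma_one_half_eq, ← Real.sqrt_eq_rpow, ← Real.sqrt_mul (by positivity)] at h
  rw [show Real.pi / b = 1 / b * Real.pi by ring, ← h]
  refine setIntegral_congr_fun measurableSet_Ioi fun s hs => ?_
  have hs0 : 0 < s := hs
  rw [show (1 / 2 - 1 : ℝ) = -(1 / 2) by norm_num, Real.rpow_neg hs0.le, Real.sqrt_eq_rpow, neg_mul]

lemma qTerm_add_I_mul (p j : ℕ) (w : ℂ) (n : ℤ) (s : ℝ) :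
    qTerm p j (w + I * s) n =
      qTerm p j w n * (Real.exp (-(2 * Real.pi * p * rshift p j n ^ 2) * s) : ℝ) := by
  rw [qTerm, qTerm, shift_eq_ofReal, Complex.ofReal_exp, ← Complex.exp_add]
  congr 1
  push_cast
  linear_combination (2 * (Real.pi : ℂ) * s * p * (rshift p j n : ℂ) ^ 2) * I_sq

/-- As 0 ≤ j/(2p) ≤ 1, the convention sgn 0 = 1 gives the sign of the shifted index. Here the false
theta function meets the unary one. -/
lemma sgn_mul_abs_rshift (hp : p ≠ 0) (hj' : j ≤ 2 * p - 1) (n : ℤ) :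
    (rshift p j n : ℂ) = sgn n * (|rshift p j n| : ℝ) := by
  have hp0 : (0 : ℝ) < p := by exact_mod_cast Nat.pos_of_ne_zero hp
  have hj2 : (j : ℝ) ≤ 2 * p := by
    have : j ≤ 2 * p := by omega
    exact_mod_cast this
  rw [sgn]
  split_ifs with h
  · rw [abs_of_nonneg, one_mul]
    have : (0 : ℝ) ≤ n := by exact_mod_cast h
    rw [rshift]; positivity
  · rw [abs_of_nonpos]
    · push_cast; ring
    · have : (n : ℝ) ≤ -1 := by exact_mod_cast (by omega : n ≤ -1)
      have h2 : (j : ℝ) / (2 * p) ≤ 1 := (div_le_one (by positivity)).2 hj2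
      rw [rshift]; linarith

/-- With r = n + j/(2p), integrating s^{-1/2} e^{-2πp r² s} gives 1/(√(2p) |r|). The coefficient r
of the unary theta function thus becomes r/|r| = sgn n. -/
lemma integral_inv_sqrt_smul_unaryTheta (hp : p ≠ 0) (hj : 1 ≤ j) (hj' : j ≤ 2 * p - 1)
    (hw : 0 < w.im) :
    falseTheta p j w = (Real.sqrt (2 * p) : ℝ) •
      ∫ s in Set.Ioi (0 : ℝ), (Real.sqrt s)⁻¹ • unaryTheta p j (w + I * s) := by
  have hp0 : (0 : ℝ) < p := by exact_mod_cast Nat.pos_of_ne_zero hp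
  have h2p : 0 < Real.sqrt (2 * p) := Real.sqrt_pos.2 (by positivity)
  have hr : ∀ n, 0 < rshift p j n ^ 2 := fun n =>
    lt_of_lt_of_le (by positivity) (rshift_sq_ge hp hj hj' n)
  have hr' : ∀ n, 0 < |rshift p j n| := fun n => by
    have := hr n
    rw [abs_pos]; rintro h; simp [h] at this
  have hb : ∀ n, 0 < 2 * Real.pi * p * rshift p j n ^ 2 := fun n => by
    have := hr n
    positivity
  have hval : ∀ n, |rshift p j n| * Real.sqrt (Real.pi / (2 * Real.pi * p * rshift p j n ^ 2)) =
      (Real.sqrt (2 * p))⁻¹ := by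
    intro n
    have := hr' n
    rw [show Real.pi / (2 * Real.pi * p * rshift p j n ^ 2) = (2 * (p : ℝ))⁻¹ * (|rshift p j n|⁻¹) ^ 2 by
      rw [inv_pow, sq_abs]; have := hr n; field_simp, Real.sqrt_mul (by positivity),
      Real.sqrt_sq (by positivity), Real.sqrt_inv]
    field_simp
  set F : ℤ → ℝ → ℂ := fun n s => (Real.sqrt s)⁻¹ • (shift p j n * qTerm p j (w + I * s) n) with hF
  have hFeq : ∀ n s, F n s = (sgn n * qTerm p j w n * (|rshift p j n| : ℝ)) *
      (((Real.sqrt s)⁻¹ * Real.exp (-(2 * Real.pi * p * rshift p j n ^ 2) * s) : ℝ) : ℂ) := by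
    intro n s
    simp only [hF]
    rw [qTerm_add_I_mul, shift_eq_ofReal, sgn_mul_abs_rshift hp hj', Complex.real_smul]
    push_cast; ring
  have hFn : ∀ n s, ‖F n s‖ = (‖qTerm p j w n‖ * |rshift p j n|) *
      ((Real.sqrt s)⁻¹ * Real.exp (-(2 * Real.pi * p * rshift p j n ^ 2) * s)) := by
    intro n s
    rw [hFeq, norm_mul, norm_mul, norm_mul, norm_sgn, one_mul, Complex.norm_real, Complex.norm_real,
      Real.norm_eq_abs, abs_abs, Real.norm_of_nonneg (by positivity)]
  have hint : ∀ n, IntegrableOn (F n) (Set.Ioi 0) := fun n => by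
    rw [funext (hFeq n)]
    exact ((integrableOn_inv_sqrt_mul_exp_neg (hb n)).ofReal).const_mul _
  have hI : ∀ n, ∫ s in Set.Ioi (0 : ℝ), F n s =
      (Real.sqrt (2 * p))⁻¹ • (sgn n * qTerm p j w n) := fun n => by
    simp_rw [hFeq n]
    rw [integral_const_mul, integral_complex_ofReal, integral_inv_sqrt_mul_exp_neg (hb n), mul_assoc,
      ← Complex.ofReal_mul, hval n, Complex.real_smul, mul_comm]
  have hN : ∀ n, ∫ s in Set.Ioi (0 : ℝ), ‖F n s‖ = ‖qTerm p j w n‖ * (Real.sqrt (2 * p))⁻¹ :=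
    fun n => by
    simp_rw [hFn n]
    rw [integral_const_mul, integral_inv_sqrt_mul_exp_neg (hb n), mul_assoc, hval n]
  -- After integration the norms are those of the q-series itself, so summation and integration may
  -- be interchanged.
  have hs : Summable fun n => ∫ s in Set.Ioi (0 : ℝ), ‖F n s‖ := by
    simp_rw [hN]
    exact (summable_qTerm hp hw).norm.mul_right _
  have h1 := (hasSum_integral_of_summable_integral_norm hint hs).tsum_eq
  have h2 : ∀ s : ℝ, ∑' n, F n s = (Real.sqrt s)⁻¹ • unaryTheta p j (w + I * s) := fun s => by
    simp only [hF, unaryTheta]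
    rw [tsum_const_smul'']
  simp_rw [h2, hI] at h1
  rw [← h1, tsum_const_smul'', smul_smul, mul_inv_cancel₀ h2p.ne', one_smul, falseTheta]

lemma integrableOn_inv_sqrt_smul_thetaVec (hp : p ≠ 0) (hw : 0 < w.im) :
    IntegrableOn (fun s : ℝ => (Real.sqrt s)⁻¹ • thetaVec p (w + I * s)) (Set.Ioi 0) := by
  obtain ⟨K, hK, hKf⟩ := exists_norm_thetaVec_le hp hw
  refine Integrable.mono' ((integrableOn_inv_sqrt_mul_exp_neg (decayRate_pos hp)).const_mul K)
    (AEStronglyMeasurable.smul (f := fun s : ℝ => (Real.sqrt s)⁻¹)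
      (Measurable.aestronglyMeasurable (by fun_prop))
      ((continuousOn_thetaVec_vertical hp hw.le).aestronglyMeasurable measurableSet_Ioi)) ?_
  filter_upwards [ae_restrict_mem measurableSet_Ioi] with s hs
  have hs0 : 0 < s := hs
  have him : (w + I * s).im = w.im + s := by simp
  have h1 := hKf (w + I * s) (by rw [him]; linarith)
  rw [norm_smul, Real.norm_of_nonneg (by positivity)]
  calc (Real.sqrt s)⁻¹ * ‖thetaVec p (w + I * s)‖
      ≤ (Real.sqrt s)⁻¹ * (K * Real.exp (-decayRate p * s)) := by
        gcongr
        refine h1.trans ?_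
        rw [him]
        have := mul_pos (decayRate_pos hp) hw
        gcongr ?_ * Real.exp ?_
        linarith
    _ = _ := by ring

lemma vecF_of_pos (hp : p ≠ 0) (hw : 0 < w.im) :
    vecF p w = (Real.sqrt (2 * p) : ℝ) •
      ∫ s in Set.Ioi (0 : ℝ), (Real.sqrt s)⁻¹ • thetaVec p (w + I * s) := by
  ext j
  have hj := j.2
  rw [Pi.smul_apply, eval_integral
    (fun i => (integrableOn_inv_sqrt_smul_thetaVec hp hw).integrable.eval i), vecF, extF, if_pos hw,
    integral_inv_sqrt_smul_unaryTheta hp (by omega) (by omega) hw]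
  rfl

lemma eichlerConst_eq (p : ℕ) :
    eichlerConst p = (Real.sqrt (2 * p) : ℂ) * (I ^ (1 / 2 : ℂ))⁻¹ := by
  have h1 : 2 * (p : ℂ) / I = ((2 * p : ℝ) : ℂ) * I⁻¹ := by push_cast; ring
  rw [eichlerConst, h1, cpow_half_ofReal_mul (by positivity), Complex.inv_cpow]
  rw [Complex.arg_I]
  linarith [Real.pi_pos]

lemma I_div_I_cpow_half : I * (I ^ (1 / 2 : ℂ))⁻¹ = I ^ (1 / 2 : ℂ) := by
  have h := cpow_half_mul_self I
  have h0 : I ^ (1 / 2 : ℂ) ≠ 0 := cpow_half_ne_zero I_ne_zero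
  rw [mul_inv_eq_iff_eq_mul₀ h0, h]

lemma eichlerIntegrand_eq (hw : w.im ≤ 0) {s : ℝ} (hs : 0 ≤ s) (j : Fin (p - 1)) :
    eichlerIntegrand p (j + 1) w s =
      I ^ (1 / 2 : ℂ) * kernelTheta p w ((starRingEnd ℂ) w + I * s) j := by
  have him : 0 ≤ ((starRingEnd ℂ) w + I * s - w).im := by simp; linarith
  rw [eichlerIntegrand, cpow_half_eq_I_mul him, kernelTheta, Pi.smul_apply, smul_eq_mul,
    ← I_div_I_cpow_half, thetaVec]
  have h0 : I ^ (1 / 2 : ℂ) ≠ 0 := cpow_half_ne_zero I_ne_zero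
  rw [I_div_I_cpow_half]
  rw [div_mul_eq_mul_div, div_eq_mul_inv, mul_inv]
  linear_combination (unaryTheta p (j + 1) ((starRingEnd ℂ) w + I * s) *
    ((-I * ((starRingEnd ℂ) w + I * s - w)) ^ (1 / 2 : ℂ))⁻¹) * I_div_I_cpow_half

lemma integrableOn_eichlerIntegrand (hp : p ≠ 0) (hw : w.im < 0) (j : Fin (p - 1)) :
    IntegrableOn (eichlerIntegrand p (j + 1) w) (Set.Ioi 0) := by
  refine Integrable.congr
    (((integrableOn_kernelTheta hp (Or.inl hw)).integrable.eval j).const_mul (I ^ (1 / 2 : ℂ))) ?_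
  filter_upwards [ae_restrict_mem measurableSet_Ioi] with s hs
  exact (eichlerIntegrand_eq hw.le (le_of_lt hs) j).symm

lemma vecF_of_neg (hp : p ≠ 0) (hw : w.im < 0) :
    vecF p w = (Real.sqrt (2 * p) : ℝ) • eichlerVec p w := by
  ext j
  rw [Pi.smul_apply, eichlerVec, eval_integral
    (fun i => (integrableOn_kernelTheta hp (Or.inl hw)).integrable.eval i), vecF, extF,
    if_neg hw.not_gt, if_pos hw, eichler,
    setIntegral_congr_fun measurableSet_Ioi fun s hs => eichlerIntegrand_eq hw.le (le_of_lt hs) j,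
    integral_const_mul, eichlerConst_eq, Complex.real_smul, ← mul_assoc, mul_assoc _ _ (I ^ _),
    inv_mul_cancel₀ (cpow_half_ne_zero I_ne_zero), mul_one]

/-- In both cases t = s + |y| is the height of the point on the path. Above, s = t - y; below, the
kernel has s - 2y = t - y. This single formula is why the two expansions agree. -/
lemma vecF_vertical (hp : p ≠ 0) (x : ℝ) {y : ℝ} (hy : y ≠ 0) :
    vecF p ((x : ℂ) + I * y) = (Real.sqrt (2 * p) : ℝ) •
      ∫ t in Set.Ioi |y|, (Real.sqrt (t - y))⁻¹ • thetaVec p ((x : ℂ) + I * t) := by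
  have him : ((x : ℂ) + I * y).im = y := by simp
  rw [← integral_Ioi_comp_add]
  rcases hy.lt_or_gt with h | h
  · rw [vecF_of_neg hp (by rwa [him]), eichlerVec]
    congr 1
    refine setIntegral_congr_fun measurableSet_Ioi fun s hs => ?_
    have hs0 : 0 < s := hs
    rw [kernelTheta, kernelTheta_vertical, him, cpow_half_ofReal (by linarith), abs_of_neg h]
    have e : (starRingEnd ℂ) ((x : ℂ) + I * y) + I * s = (x : ℂ) + I * ((s + -y : ℝ) : ℂ) := by
      simp; ring
    rw [e, ← Complex.ofReal_inv, show s + -y - y = s - 2 * y by ring]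
    rfl
  · rw [vecF_of_pos hp (by rwa [him])]
    congr 1
    refine setIntegral_congr_fun measurableSet_Ioi fun s hs => ?_
    rw [abs_of_pos h, add_sub_cancel_right]
    congr 2
    push_cast; ring

lemma eichlerVec_real (x : ℝ) :
    eichlerVec p x = ∫ t in Set.Ioi (0 : ℝ), (Real.sqrt t)⁻¹ • thetaVec p ((x : ℂ) + I * t) := by
  refine setIntegral_congr_fun measurableSet_Ioi fun s hs => ?_
  have hs0 : 0 < s := hs
  rw [kernelTheta, kernelTheta_vertical, Complex.ofReal_im, mul_zero, sub_zero,
    cpow_half_ofReal hs0.le, Complex.conj_ofReal, ← Complex.ofReal_inv]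
  rfl

/-- The asymptotic expansions of `F(x + i y)` from above and from below agree. -/
theorem exists_vecF_expansion (hp : p ≠ 0) (x : ℚ) :
    ∃ a : ℕ → Fin (p - 1) → ℂ, a 0 = (Real.sqrt (2 * p) : ℝ) • eichlerVec p x ∧ ∀ N : ℕ,
      (fun y : ℝ => vecF p ((x : ℂ) + I * (y : ℂ)) - ∑ n ∈ Finset.range N, (I * (y : ℂ)) ^ n • a n)
        =O[𝓝[≠] (0 : ℝ)] (fun y : ℝ => y ^ N) := by
  obtain ⟨a, ha0, ha⟩ := (rapidDecay_thetaVec hp x).exists_expansion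
    (continuousOn_thetaVec_vertical hp (by simp))
  refine ⟨fun n => (I ^ n)⁻¹ • (Real.sqrt (2 * p) : ℝ) • a n, ?_, fun N => ?_⟩
  · have := eichlerVec_real (p := p) (x : ℝ)
    rw [Complex.ofReal_ratCast] at this
    simp [ha0, this]
  · refine (((ha N).const_smul_left (Real.sqrt (2 * p))).mono nhdsWithin_le_nhds).congr' ?_
      EventuallyEq.rfl
    filter_upwards [self_mem_nhdsWithin] with y hy
    have := vecF_vertical hp (x : ℝ) (y := y) hy
    rw [Complex.ofReal_ratCast] at this
    rw [this]
    change (Real.sqrt (2 * p) : ℝ) • ((_ : Fin (p - 1) → ℂ) - _) = _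
    rw [smul_sub, Finset.smul_sum]
    congr 1
    refine Finset.sum_congr rfl fun n _ => ?_
    have hI : I ^ n ≠ 0 := pow_ne_zero _ I_ne_zero
    ext k
    simp only [Pi.smul_apply, smul_eq_mul, Complex.real_smul]
    push_cast
    field_simp
    rw [mul_pow]; ring

/-- The case N = 1 of the expansion identifies the limit from above with the Eichler integral at x.
-/
lemma vecF_ratCast (hp : p ≠ 0) (x : ℚ) :
    vecF p (x : ℂ) = (Real.sqrt (2 * p) : ℝ) • eichlerVec p x := by
  obtain ⟨a, ha0, ha⟩ := exists_vecF_expansion hp x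
  have h1 : Tendsto (fun y : ℝ => vecF p ((x : ℂ) + I * (y : ℂ))) (𝓝[≠] 0) (𝓝 (a 0)) := by
    have h2 := (ha 1).trans_tendsto (by
      simp_rw [pow_one]
      exact tendsto_id.mono_left nhdsWithin_le_nhds)
    simpa using h2.add_const (a 0)
  rw [← ha0]
  ext j
  have him : ((x : ℂ)).im = 0 := by simp
  rw [vecF, extF, if_neg (by simp), if_neg (by simp)]
  refine Tendsto.limUnder_eq ?_
  refine (((tendsto_pi_nhds.1 h1) j).mono_left (nhdsWithin_mono _ fun y hy => ne_of_gt hy)).congr' ?_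
  filter_upwards [self_mem_nhdsWithin] with y hy
  have hy0 : (0 : ℝ) < y := hy
  rw [vecF, extF, if_pos (by simpa using hy0)]

lemma LowerPoint.vecF_eq (hp : p ≠ 0) (hw : LowerPoint w) :
    vecF p w = (Real.sqrt (2 * p) : ℝ) • eichlerVec p w := by
  rcases hw with h | ⟨x, rfl⟩
  · exact vecF_of_neg hp h
  · exact vecF_ratCast hp x

end Representation

/-! ### Half-order Stieltjes transforms -/

section CuspIntegral

/-- The odd powers `z ^ (-1/2 - n)`. -/
noncomputable def invSqrtPow (n : ℕ) (z : ℂ) : ℂ := ((z ^ (1 / 2 : ℂ))⁻¹) ^ (2 * n + 1)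

lemma invSqrtPow_zero (z : ℂ) : invSqrtPow 0 z = (z ^ (1 / 2 : ℂ))⁻¹ := by simp [invSqrtPow]

lemma norm_invSqrtPow (n : ℕ) (z : ℂ) : ‖invSqrtPow n z‖ = ((Real.sqrt ‖z‖)⁻¹) ^ (2 * n + 1) := by
  rw [invSqrtPow, norm_pow, norm_inv, norm_cpow_half]

lemma measurable_invSqrtPow (n : ℕ) : Measurable (invSqrtPow n) := by
  unfold invSqrtPow; fun_prop

lemma norm_invSqrtPow_le {n : ℕ} {z : ℂ} {δ : ℝ} (hδ : 0 < δ) (h : δ ≤ ‖z‖) :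
    ‖invSqrtPow n z‖ ≤ ((Real.sqrt δ)⁻¹) ^ (2 * n + 1) := by
  rw [norm_invSqrtPow]
  have := Real.sqrt_pos.2 hδ
  gcongr

lemma hasDerivAt_cpow_half {z : ℂ} (hz : z ∈ slitPlane) :
    HasDerivAt (fun z : ℂ => z ^ (1 / 2 : ℂ)) (1 / 2 * (z ^ (1 / 2 : ℂ))⁻¹) z := by
  have h := (hasDerivAt_id z).cpow_const (c := 1 / 2) hz
  rw [mul_one, show (1 / 2 - 1 : ℂ) = -(1 / 2) by norm_num, id, Complex.cpow_neg] at h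
  exact h

lemma hasDerivAt_invSqrtPow (n : ℕ) {z : ℂ} (hz : z ∈ slitPlane) :
    HasDerivAt (invSqrtPow n) (-((2 * n + 1) / 2) * invSqrtPow (n + 1) z) z := by
  have h0 : z ^ (1 / 2 : ℂ) ≠ 0 := cpow_half_ne_zero (slitPlane_ne_zero hz)
  refine (((hasDerivAt_cpow_half hz).fun_inv h0).fun_pow (2 * n + 1)).congr_deriv ?_
  rw [invSqrtPow, Nat.add_sub_cancel, show 2 * (n + 1) + 1 = 2 * n + 3 by ring]
  simp only [inv_pow]
  push_cast
  field_simp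
  ring

variable {E : Type*} [NormedAddCommGroup E] [NormedSpace ℂ E] {φ : ℝ → E}

/-- `∫₀^∞ φ(s) (s + i w) ^ (-1/2 - n) ds`. -/
noncomputable def cuspIntegral (φ : ℝ → E) (n : ℕ) (w : ℂ) : E :=
  ∫ s in Set.Ioi (0 : ℝ), invSqrtPow n ((s : ℂ) + I * w) • φ s

lemma aestronglyMeasurable_invSqrtPow_smul (hc : ContinuousOn φ (Set.Ioi 0)) (n : ℕ) (w : ℂ) :
    AEStronglyMeasurable (fun s : ℝ => invSqrtPow n ((s : ℂ) + I * w) • φ s)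
      (volume.restrict (Set.Ioi 0)) := by
  have h : Measurable (fun s : ℝ => invSqrtPow n ((s : ℂ) + I * w)) :=
    (measurable_invSqrtPow n).comp (by fun_prop)
  exact h.aestronglyMeasurable.smul (hc.aestronglyMeasurable measurableSet_Ioi)

lemma integrableOn_inv_sqrt_abs : IntegrableOn (fun s : ℝ => (Real.sqrt |s|)⁻¹) (Set.Ioc (-1) 1) := by
  have h1 : IntegrableOn (fun s : ℝ => (Real.sqrt |s|)⁻¹) (Set.Ioc 0 1) :=
    (integrableOn_inv_sqrt_Ioc 1).congr_fun (fun s hs => by simp [abs_of_pos hs.1])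
      measurableSet_Ioc
  have h2 : IntervalIntegrable (fun s : ℝ => (Real.sqrt |s|)⁻¹) volume 0 1 :=
    (intervalIntegrable_iff_integrableOn_Ioc_of_le zero_le_one).2 h1
  have h3 : IntervalIntegrable (fun s : ℝ => (Real.sqrt |s|)⁻¹) volume (-1) 0 := by
    have := (IntervalIntegrable.iff_comp_neg (f := fun s : ℝ => (Real.sqrt |s|)⁻¹)).1 h2
    simpa using this.symm
  exact (intervalIntegrable_iff_integrableOn_Ioc_of_le (by norm_num)).1 (h3.trans h2)

/-- Needed for w on the positive imaginary axis, where the path of integration runs through w; the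
singularity is of order 1/2 and integrable. -/
lemma integrable_inv_one_add_sq_mul_inv_sqrt_abs (a : ℝ) :
    Integrable (fun s : ℝ => (1 + s ^ 2)⁻¹ * (Real.sqrt |s - a|)⁻¹) := by
  have h1 : Integrable ((Set.Ioc (-1 : ℝ) 1).indicator (fun s : ℝ => (Real.sqrt |s|)⁻¹)) :=
    (integrable_indicator_iff measurableSet_Ioc).2 integrableOn_inv_sqrt_abs
  refine Integrable.mono' ((h1.comp_sub_right a).add integrable_inv_one_add_sq)
    (Measurable.aestronglyMeasurable (by fun_prop)) (Eventually.of_forall fun s => ?_)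
  rw [Real.norm_of_nonneg (by positivity)]
  by_cases h : s - a ∈ Set.Ioc (-1 : ℝ) 1
  · rw [Pi.add_apply, Set.indicator_of_mem h]
    have h3 : (1 + s ^ 2)⁻¹ * (Real.sqrt |s - a|)⁻¹ ≤ (Real.sqrt |s - a|)⁻¹ :=
      mul_le_of_le_one_left (by positivity) (inv_le_one_of_one_le₀ (by nlinarith))
    have : (0 : ℝ) ≤ (1 + s ^ 2)⁻¹ := by positivity
    linarith
  · rw [Pi.add_apply, Set.indicator_of_notMem h, zero_add]
    refine mul_le_of_le_one_right (by positivity) (inv_le_one_of_one_le₀ (Real.one_le_sqrt.2 ?_))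
    by_contra hlt
    rw [not_le, abs_lt] at hlt
    exact h ⟨hlt.1, hlt.2.le⟩

lemma norm_invSqrtPow_zero_le (w : ℂ) {s : ℝ} (hs : s ≠ w.im) :
    ‖invSqrtPow 0 ((s : ℂ) + I * w)‖ ≤ (Real.sqrt |s - w.im|)⁻¹ := by
  have h := Complex.abs_re_le_norm ((s : ℂ) + I * w)
  simp only [add_re, ofReal_re, mul_re, I_re, zero_mul, I_im, one_mul, zero_sub,
    ← sub_eq_add_neg] at h
  simpa using norm_invSqrtPow_le (n := 0) (abs_pos.2 (sub_ne_zero.2 hs)) h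

/-- The bound depends on Im w alone, so it dominates along a horizontal approach to the imaginary
axis. -/
lemma RapidDecay.integrable_bound (h : RapidDecay φ) (a : ℝ) :
    ∃ b : ℝ → ℝ, Integrable b ∧ ∀ w : ℂ, w.im = a →
      ∀ᵐ (s : ℝ) ∂(volume.restrict (Set.Ioi (0 : ℝ))), ‖invSqrtPow 0 ((s : ℂ) + I * w) • φ s‖ ≤ b s := by
  obtain ⟨D, hD, hDf⟩ := h.exists_bound
  refine ⟨_, (integrable_inv_one_add_sq_mul_inv_sqrt_abs a).const_mul D, fun w hw => ?_⟩
  have hne : ∀ᵐ s ∂(volume.restrict (Set.Ioi (0 : ℝ))), s ≠ a :=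
    ae_restrict_of_ae (Measure.ae_ne volume a)
  filter_upwards [ae_restrict_mem measurableSet_Ioi, hne] with s hs hsa
  rw [norm_smul]
  calc _ ≤ (Real.sqrt |s - a|)⁻¹ * (D * (1 + s ^ 2)⁻¹) := by
        gcongr
        · have := norm_invSqrtPow_zero_le w (s := s) (by rwa [hw])
          rwa [hw] at this
        · exact hDf s hs
    _ = _ := by ring

lemma RapidDecay.integrableOn_invSqrt_smul (h : RapidDecay φ) (hc : ContinuousOn φ (Set.Ioi 0))
    (w : ℂ) : IntegrableOn (fun s : ℝ => invSqrtPow 0 ((s : ℂ) + I * w) • φ s) (Set.Ioi 0) := by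
  obtain ⟨b, hb, hle⟩ := h.integrable_bound w.im
  exact Integrable.mono' hb.integrableOn (aestronglyMeasurable_invSqrtPow_smul hc 0 w) (hle w rfl)

/-- For real x one has |s + ix| ≥ s, hence a bound uniform in x at the price of a power of s. -/
lemma RapidDecay.norm_invSqrtPow_smul_le (n : ℕ) {s : ℝ} (hs : 0 < s) (x : ℝ) :
    ‖invSqrtPow n ((s : ℂ) + I * x) • φ s‖ ≤ 1 * s ^ (-(n + 1 / 2) : ℝ) * ‖φ s‖ := by
  rw [norm_smul, one_mul]
  gcongr
  refine (norm_invSqrtPow_le hs ?_).trans_eq ?_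
  · refine le_trans ?_ (Complex.re_le_norm _)
    simp
  · rw [inv_pow, pow_succ, pow_mul, Real.sq_sqrt hs.le, Real.rpow_neg hs.le, Real.rpow_add hs,
      Real.rpow_natCast, Real.sqrt_eq_rpow]

lemma RapidDecay.invSqrtPow_smul (h : RapidDecay φ) (n : ℕ) (x : ℝ) :
    RapidDecay (fun s : ℝ => invSqrtPow n ((s : ℂ) + I * x) • φ s) :=
  h.mono zero_le_one fun _ hs => RapidDecay.norm_invSqrtPow_smul_le n hs x

lemma add_I_mul_mem_slitPlane {w : ℂ} (hw : w.re ≠ 0 ∨ w.im ≤ 0) {s : ℝ} (hs : 0 < s) :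
    (s : ℂ) + I * w ∈ slitPlane := by
  rw [Complex.mem_slitPlane_iff]
  rcases hw with h | h
  · right; simpa using h
  · left; simp; linarith

/-- Each derivative raises the singularity of the kernel by one order, which the rapid decay of φ at
0 absorbs uniformly in x. Therefore the integral is smooth even at the cusp x = 0. -/
lemma RapidDecay.hasDerivAt_cuspIntegral_real (h : RapidDecay φ)
    (hc : ContinuousOn φ (Set.Ioi 0)) (n : ℕ) (x : ℝ) :
    HasDerivAt (fun x : ℝ => cuspIntegral φ n x)
      ((-((2 * n + 1) / 2) * I : ℂ) • cuspIntegral φ (n + 1) x) x := by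
  have hb : IntegrableOn (fun s : ℝ => ‖(-((2 * n + 1) / 2) * I : ℂ)‖ *
      (s ^ (-(((n + 1 : ℕ) : ℝ) + 1 / 2) : ℝ) * ‖φ s‖)) (Set.Ioi 0) := by
    refine Integrable.const_mul ?_ _
    have h1 : RapidDecay (fun s : ℝ => s ^ (-(((n + 1 : ℕ) : ℝ) + 1 / 2) : ℝ) * ‖φ s‖) :=
      h.mono zero_le_one fun s hs => by
        rw [one_mul, Real.norm_of_nonneg (by positivity)]
    exact h1.integrableOn ((Measurable.aestronglyMeasurable (by fun_prop)).mul
      (hc.norm.aestronglyMeasurable measurableSet_Ioi))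
  have key := hasDerivAt_integral_of_dominated_loc_of_deriv_le (𝕜 := ℝ)
    (μ := volume.restrict (Set.Ioi 0)) (x₀ := x) (s := Set.univ)
    (F := fun (x : ℝ) (s : ℝ) => invSqrtPow n ((s : ℂ) + I * x) • φ s)
    (F' := fun (x : ℝ) (s : ℝ) => (-((2 * n + 1) / 2) * I : ℂ) •
      invSqrtPow (n + 1) ((s : ℂ) + I * x) • φ s)
    Filter.univ_mem
    (Eventually.of_forall fun x => aestronglyMeasurable_invSqrtPow_smul hc n x)
    ((h.invSqrtPow_smul n x).integrableOn (aestronglyMeasurable_invSqrtPow_smul hc n x))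
    ((aestronglyMeasurable_invSqrtPow_smul hc (n + 1) x).const_smul _) ?_ hb ?_
  · have h2 := key.2
    rw [integral_smul] at h2
    exact h2
  · filter_upwards [ae_restrict_mem measurableSet_Ioi] with s hs y _
    rw [norm_smul]
    gcongr
    simpa using RapidDecay.norm_invSqrtPow_smul_le (φ := φ) (n + 1) hs y
  · filter_upwards [ae_restrict_mem measurableSet_Ioi] with s hs y _
    have h1 := hasDerivAt_invSqrtPow n
      (add_I_mul_mem_slitPlane (w := (y : ℂ)) (Or.inr (by simp)) hs)
    have h2 : HasDerivAt (fun y : ℝ => (s : ℂ) + I * y) I y := hasDerivAt_vertical _ y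
    refine ((h1.comp y h2).smul_const (φ s)).congr_deriv ?_
    rw [smul_smul]
    congr 1; ring

lemma RapidDecay.contDiff_cuspIntegral (h : RapidDecay φ) (hc : ContinuousOn φ (Set.Ioi 0)) :
    ContDiff ℝ ∞ (fun x : ℝ => cuspIntegral φ 0 x) := by
  have hm : ∀ m n : ℕ, ContDiff ℝ m (fun x : ℝ => cuspIntegral φ n x) := by
    intro m
    induction m with
    | zero =>
      intro n
      exact contDiff_zero.2 (continuous_iff_continuousAt.2 fun x =>
        (h.hasDerivAt_cuspIntegral_real hc n x).continuousAt)
    | succ m ih =>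
      intro n
      rw [show ((m + 1 : ℕ) : WithTop ℕ∞) = (m : WithTop ℕ∞) + 1 by push_cast; rfl,
        contDiff_succ_iff_deriv]
      refine ⟨fun x => (h.hasDerivAt_cuspIntegral_real hc n x).differentiableAt, by simp, ?_⟩
      rw [funext fun x => (h.hasDerivAt_cuspIntegral_real hc n x).deriv]
      exact (ih (n + 1)).const_smul _
  exact contDiff_infty.2 fun m => hm m 0

lemma RapidDecay.differentiableOn_cuspIntegral (h : RapidDecay φ)
    (hc : ContinuousOn φ (Set.Ioi 0)) :
    DifferentiableOn ℂ (cuspIntegral φ 0) {w : ℂ | w.re ≠ 0 ∨ w.im < 0} := by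
  intro w₀ hw₀
  -- Half of |Re w₀| or of -Im w₀ keeps s + iw at distance δ from 0 and off the cut, for all s > 0.
  obtain ⟨δ, hδ, hball⟩ : ∃ δ > 0, ∀ w ∈ Metric.ball w₀ δ, (w.re ≠ 0 ∨ w.im ≤ 0) ∧
      ∀ s : ℝ, 0 < s → δ ≤ ‖(s : ℂ) + I * w‖ := by
    rcases hw₀ with h1 | h1
    · refine ⟨|w₀.re| / 2, by positivity, fun w hw => ?_⟩
      have h2 : |w₀.re| / 2 ≤ |w.re| := by
        have h3 := (Complex.abs_re_le_norm (w - w₀)).trans_lt (mem_ball_iff_norm.1 hw)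
        rw [sub_re] at h3
        have := abs_sub_abs_le_abs_sub w₀.re w.re
        rw [abs_sub_comm] at this
        linarith
      have h0 : 0 < |w₀.re| := abs_pos.2 h1
      refine ⟨Or.inl (abs_pos.1 (by linarith)), fun s _ => h2.trans ?_⟩
      have := Complex.abs_im_le_norm ((s : ℂ) + I * w)
      simpa using this
    · refine ⟨-w₀.im / 2, by linarith, fun w hw => ?_⟩
      have h3 := (Complex.abs_im_le_norm (w - w₀)).trans_lt (mem_ball_iff_norm.1 hw)
      rw [sub_im] at h3
      have h4 := (abs_lt.1 h3).2
      refine ⟨Or.inr (by linarith), fun s hs => ?_⟩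
      have := Complex.re_le_norm ((s : ℂ) + I * w)
      simp at this
      linarith
  have hint : IntegrableOn φ (Set.Ioi 0) := h.integrableOn (hc.aestronglyMeasurable measurableSet_Ioi)
  have key := hasDerivAt_integral_of_dominated_loc_of_deriv_le (𝕜 := ℂ)
    (μ := volume.restrict (Set.Ioi 0)) (x₀ := w₀) (s := Metric.ball w₀ δ)
    (F := fun (w : ℂ) (s : ℝ) => invSqrtPow 0 ((s : ℂ) + I * w) • φ s)
    (F' := fun (w : ℂ) (s : ℝ) => (-((2 * (0 : ℕ) + 1) / 2) * I : ℂ) •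
      invSqrtPow 1 ((s : ℂ) + I * w) • φ s)
    (bound := fun s => ‖(-((2 * (0 : ℕ) + 1) / 2) * I : ℂ)‖ *
      (((Real.sqrt δ)⁻¹) ^ (2 * 1 + 1) * ‖φ s‖))
    (Metric.ball_mem_nhds w₀ hδ)
    (Eventually.of_forall fun w => aestronglyMeasurable_invSqrtPow_smul hc 0 w)
    (h.integrableOn_invSqrt_smul hc w₀)
    ((aestronglyMeasurable_invSqrtPow_smul hc 1 w₀).const_smul _) ?_
    ((hint.norm.const_mul _).const_mul _) ?_
  · exact key.2.differentiableAt.differentiableWithinAt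
  · filter_upwards [ae_restrict_mem measurableSet_Ioi] with s hs w hw
    rw [norm_smul, norm_smul]
    gcongr
    exact norm_invSqrtPow_le hδ ((hball w hw).2 s hs)
  · filter_upwards [ae_restrict_mem measurableSet_Ioi] with s hs w hw
    have h1 := hasDerivAt_invSqrtPow 0 (add_I_mul_mem_slitPlane (hball w hw).1 hs)
    have h2 : HasDerivAt (fun w : ℂ => (s : ℂ) + I * w) I w := by
      simpa using ((hasDerivAt_id w).const_mul I).const_add (s : ℂ)
    refine ((h1.comp w h2).smul_const (φ s)).congr_deriv ?_
    rw [smul_smul, zero_add]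
    congr 1; ring

lemma RapidDecay.analyticAt_cuspIntegral [CompleteSpace E] (h : RapidDecay φ)
    (hc : ContinuousOn φ (Set.Ioi 0)) {x : ℝ} (hx : x ≠ 0) :
    AnalyticAt ℝ (fun x : ℝ => cuspIntegral φ 0 x) x := by
  have hopen : IsOpen {w : ℂ | w.re ≠ 0 ∨ w.im < 0} :=
    (isOpen_ne_fun Complex.continuous_re continuous_const).union
      (isOpen_lt Complex.continuous_im continuous_const)
  have h1 : AnalyticAt ℂ (cuspIntegral φ 0) (x : ℂ) :=
    (h.differentiableOn_cuspIntegral hc).analyticAt (hopen.mem_nhds (Or.inl (by simpa using hx)))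
  have h2 : AnalyticAt ℝ (fun x : ℝ => (x : ℂ)) x := Complex.ofRealCLM.analyticAt x
  exact (h1.restrictScalars (𝕜 := ℝ)).fun_comp h2

/-- Continuity of the integral on the imaginary axis, from the right. -/
lemma RapidDecay.tendsto_cuspIntegral (h : RapidDecay φ) (hc : ContinuousOn φ (Set.Ioi 0)) (t : ℝ) :
    Tendsto (fun ε : ℝ => cuspIntegral φ 0 (ε + I * t)) (𝓝[>] 0) (𝓝 (cuspIntegral φ 0 (I * t))) := by
  obtain ⟨b, hb, hle⟩ := h.integrable_bound t
  refine tendsto_integral_filter_of_dominated_convergence b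
    (Eventually.of_forall fun ε => aestronglyMeasurable_invSqrtPow_smul hc 0 _)
    (Eventually.of_forall fun ε => hle (ε + I * t) (by simp)) hb.integrableOn ?_
  have hne : ∀ᵐ s ∂(volume.restrict (Set.Ioi (0 : ℝ))), s ≠ t :=
    ae_restrict_of_ae (Measure.ae_ne volume t)
  filter_upwards [hne] with s hs
  refine Tendsto.smul_const ?_ _
  have hz : ∀ ε : ℝ, (s : ℂ) + I * (ε + I * t) = ((s - t : ℝ) : ℂ) + I * ε := fun ε => by
    push_cast; linear_combination (t : ℂ) * I_sq
  have hz0 : (s : ℂ) + I * (I * t) = ((s - t : ℝ) : ℂ) := by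
    push_cast; linear_combination (t : ℂ) * I_sq
  have hst : ((s - t : ℝ) : ℂ) ≠ 0 := by exact_mod_cast sub_ne_zero.2 hs
  simp_rw [invSqrtPow_zero, hz, hz0]
  refine Tendsto.inv₀ ?_ (cpow_half_ne_zero hst)
  -- For s < t the limit point lies on the cut but is approached from above; rotating by √i moves
  -- the cut away.
  rw [cpow_half_eq_I_mul (z := ((s - t : ℝ) : ℂ)) (by simp)]
  have hslit : -I * ((s - t : ℝ) : ℂ) ∈ slitPlane := by
    rw [Complex.mem_slitPlane_iff]
    right
    simpa using sub_ne_zero.2 hs.symm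
  have hcont : ContinuousAt (fun ε : ℝ => I ^ (1 / 2 : ℂ) *
      (-I * (((s - t : ℝ) : ℂ) + I * ε)) ^ (1 / 2 : ℂ)) 0 := by
    refine continuousAt_const.mul ?_
    have h1 : ContinuousAt (fun z : ℂ => z ^ (1 / 2 : ℂ))
        (-I * (((s - t : ℝ) : ℂ) + I * ((0 : ℝ) : ℂ))) := by
      refine (differentiableAt_cpow_half ?_).continuousAt
      simpa using hslit
    exact h1.comp (f := fun ε : ℝ => -I * (((s - t : ℝ) : ℂ) + I * ε)) (by fun_prop)
  have hlim := hcont.tendsto.mono_left (nhdsWithin_le_nhds (s := Set.Ioi 0))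
  simp only [ofReal_zero, mul_zero, add_zero] at hlim
  refine hlim.congr' ?_
  filter_upwards [self_mem_nhdsWithin] with ε hε
  have hε0 : (0 : ℝ) < ε := hε
  rw [← cpow_half_eq_I_mul]
  simpa using hε0.le

end CuspIntegral

/-! ### The errors of modularity on the lower half-plane and on `ℚ` -/

section ErrorOfModularity

variable {p : ℕ} {w : ℂ} {γ : SL(2, ℤ)}

lemma rapidDecay_thetaVec_zero (hp : p ≠ 0) : RapidDecay (fun s : ℝ => thetaVec p (I * s)) := by
  simpa using rapidDecay_thetaVec hp 0

lemma continuousOn_thetaVec_I_mul (hp : p ≠ 0) :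
    ContinuousOn (fun s : ℝ => thetaVec p (I * s)) (Set.Ioi 0) := by
  simpa using continuousOn_thetaVec_vertical hp (w := 0) (by simp)

lemma errorIntegrand_eq (w : ℂ) (s : ℝ) (j : Fin (p - 1)) :
    errorIntegrand p (j + 1) w s =
      I ^ (1 / 2 : ℂ) * (invSqrtPow 0 ((s : ℂ) + I * w) • thetaVec p (I * s)) j := by
  rw [errorIntegrand, invSqrtPow_zero, Pi.smul_apply, smul_eq_mul, thetaVec, div_eq_mul_inv, mul_inv]
  linear_combination (unaryTheta p (j + 1) (I * s) * (((s : ℂ) + I * w) ^ (1 / 2 : ℂ))⁻¹) *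
    I_div_I_cpow_half

lemma integrableOn_errorIntegrand (hp : p ≠ 0) (w : ℂ) (j : Fin (p - 1)) :
    IntegrableOn (errorIntegrand p (j + 1) w) (Set.Ioi 0) := by
  rw [funext fun s => errorIntegrand_eq w s j]
  exact (((rapidDecay_thetaVec_zero hp).integrableOn_invSqrt_smul
    (continuousOn_thetaVec_I_mul hp) w).integrable.eval j).const_mul _

lemma errorG_eq (hp : p ≠ 0) (w : ℂ) :
    errorG p w = -(Real.sqrt (2 * p) : ℂ) • cuspIntegral (fun s : ℝ => thetaVec p (I * s)) 0 w := by
  ext j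
  rw [errorG, funext fun s => errorIntegrand_eq w s j, integral_const_mul, Pi.smul_apply,
    cuspIntegral, eval_integral (fun i => ((rapidDecay_thetaVec_zero hp).integrableOn_invSqrt_smul
      (continuousOn_thetaVec_I_mul hp) w).integrable.eval i), eichlerConst_eq, smul_eq_mul,
      ← mul_assoc, neg_mul, mul_assoc _ _ (I ^ _),
    inv_mul_cancel₀ (cpow_half_ne_zero I_ne_zero), mul_one]

lemma differentiableOn_errorG (hp : p ≠ 0) :
    DifferentiableOn ℂ (errorG p) {w : ℂ | w.re ≠ 0 ∨ w.im < 0} := by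
  rw [funext (errorG_eq hp)]
  exact ((rapidDecay_thetaVec_zero hp).differentiableOn_cuspIntegral
    (continuousOn_thetaVec_I_mul hp)).const_smul (-(Real.sqrt (2 * p) : ℂ))

lemma contDiff_errorG (hp : p ≠ 0) : ContDiff ℝ ∞ (fun x : ℝ => errorG p (x : ℂ)) := by
  rw [funext fun x : ℝ => errorG_eq hp (x : ℂ)]
  exact ((rapidDecay_thetaVec_zero hp).contDiff_cuspIntegral
    (continuousOn_thetaVec_I_mul hp)).const_smul (-(Real.sqrt (2 * p) : ℂ))

lemma analyticAt_errorG (hp : p ≠ 0) {x : ℝ} (hx : x ≠ 0) :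
    AnalyticAt ℝ (fun x : ℝ => errorG p (x : ℂ)) x := by
  rw [funext fun x : ℝ => errorG_eq hp (x : ℂ)]
  exact ((rapidDecay_thetaVec_zero hp).analyticAt_cuspIntegral
    (continuousOn_thetaVec_I_mul hp) hx).const_smul (c := -(Real.sqrt (2 * p) : ℂ))

lemma integral_kernelTheta (p : ℕ) (x w : ℂ) :
    ∫ s in Set.Ioi (0 : ℝ), kernelTheta p w (x + I * s) =
      cuspIntegral (fun s : ℝ => thetaVec p (x + I * s)) 0 (w - x) := by
  rw [cuspIntegral]
  congr 1; ext1 s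
  rw [kernelTheta, invSqrtPow_zero]
  congr 4
  linear_combination -(s : ℂ) * I_sq

lemma moeb_of_slOneZero_eq_zero (hc : γ 1 0 = 0) (u z : ℂ) : moeb γ (u + z) = moeb γ u + z := by
  have h := det_cast γ
  rw [hc] at h
  have hd : ((γ 1 1 : ℤ) : ℂ) ≠ 0 := by
    intro h0; simp [h0] at h
  have had : ((γ 0 0 : ℤ) : ℂ) = ((γ 1 1 : ℤ) : ℂ) := by
    have h1 : (γ 0 0 : ℤ) * γ 1 1 = 1 := by
      have h2 : ((γ 0 0 : ℤ) : ℂ) * ((γ 1 1 : ℤ) : ℂ) = 1 := by simpa using h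
      exact_mod_cast h2
    rcases Int.mul_eq_one_iff_eq_one_or_neg_one.1 h1 with ⟨h2, h3⟩ | ⟨h2, h3⟩ <;> simp [h2, h3]
  rw [moeb, moeb, den, den, hc, had]
  simp only [Int.cast_zero, zero_mul, zero_add]
  field_simp
  ring

/-- Here γ⁻¹∞ = ∞, so `eichlerVec_sub` does not apply. The map is an integral translation, under
which the whole path moves rigidly. -/
lemma eichlerVec_sub_of_slOneZero_eq_zero (hp : p ≠ 0) (hc : γ 1 0 = 0) (x : ℚ) :
    eichlerVec p x - (lowerRoot γ x)⁻¹ •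
        ((mult hp γ : Matrix (Fin (p - 1)) (Fin (p - 1)) ℂ) *ᵥ eichlerVec p (moeb γ x)) = 0 := by
  have hmul : ∀ s : ℝ, 0 < s →
      (mult hp γ : Matrix (Fin (p - 1)) (Fin (p - 1)) ℂ) *ᵥ thetaVec p (moeb γ x + I * s) =
        lowerRoot γ x • thetaVec p ((x : ℂ) + I * s) := by
    intro s hs
    have h1 := thetaLaw_mult hp γ ((x : ℂ) + I * s) (by simpa using hs)
    rw [moeb_of_slOneZero_eq_zero hc] at h1
    rw [← h1]
    congr 1
    rw [upperRoot_eq, lowerRoot_eq, if_neg (by simp [hc]), if_neg (by simp [hc]), den, den, hc]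
    have h := det_cast γ
    rw [hc] at h
    have h2 : (γ 0 0 : ℤ) * γ 1 1 = 1 := by
      have h2 : ((γ 0 0 : ℤ) : ℂ) * ((γ 1 1 : ℤ) : ℂ) = 1 := by simpa using h
      exact_mod_cast h2
    rcases Int.mul_eq_one_iff_eq_one_or_neg_one.1 h2 with ⟨_, h3⟩ | ⟨_, h3⟩
    · simp [h3]
    -- For d = -1 the upper root is -i and the lower root is i, and indeed (-i)³ = i.
    · have := cpow_half_neg_ofReal (r := 1) zero_le_one
      simp only [ofReal_one, Real.sqrt_one, mul_one] at this
      simp only [Int.cast_zero, zero_mul, zero_add, h3, Int.cast_neg, Int.cast_one, map_neg, map_one,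
        this, conj_I]
      rw [neg_pow, I_pow_three]; norm_num
  have hl : lowerRoot γ (x : ℂ) ≠ 0 := lowerRoot_ne_zero fun h => slOneZero_ne_zero_of_den h hc
  have hx : LowerPoint (x : ℂ) := Or.inr ⟨x, rfl⟩
  set L := LinearMap.toContinuousLinearMap
    (Matrix.mulVecLin (mult hp γ : Matrix (Fin (p - 1)) (Fin (p - 1)) ℂ))
  have h1 : (mult hp γ : Matrix (Fin (p - 1)) (Fin (p - 1)) ℂ) *ᵥ eichlerVec p (moeb γ (x : ℂ)) =
      lowerRoot γ (x : ℂ) • eichlerVec p x := by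
    change L (eichlerVec p (moeb γ (x : ℂ))) = _
    rw [eichlerVec, ← L.integral_comp_comm (integrableOn_kernelTheta hp hx.moeb), eichlerVec,
      ← integral_smul]
    refine setIntegral_congr_fun measurableSet_Ioi fun s hs => ?_
    change (mult hp γ : Matrix (Fin (p - 1)) (Fin (p - 1)) ℂ) *ᵥ _ = _
    rw [kernelTheta, kernelTheta, kernelTheta_vertical, kernelTheta_vertical, Matrix.mulVec_smul,
      moeb_ratCast, map_ratCast, map_ratCast, ← moeb_ratCast, hmul s hs, smul_comm]
    simp only [moeb_ratCast, Complex.ratCast_im]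
  rw [h1, smul_smul, inv_mul_cancel₀ hl, one_smul, sub_self]

/-- For c ≠ 0 the error is the cusp integral based at x₀ = -d/c = γ⁻¹∞, taken at x - x₀; its only
possible non-analytic point is x₀. For c = 0 it is zero. -/
lemma exists_error (hp : p ≠ 0) (γ : SL(2, ℤ)) : ∃ h : ℝ → Fin (p - 1) → ℂ,
    ContDiff ℝ ∞ h ∧ (∀ x : ℝ, den γ (x : ℂ) ≠ 0 → AnalyticAt ℝ h x) ∧
    ∀ x y : ℚ, den γ (x : ℂ) ≠ 0 → (y : ℂ) = moeb γ (x : ℂ) →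
      vecF p x - (autFactor (1 / 2) γ (x : ℂ))⁻¹ •
        ((mult hp γ : Matrix (Fin (p - 1)) (Fin (p - 1)) ℂ) *ᵥ vecF p y) = h (x : ℝ) := by
  have hF : ∀ x y : ℚ, (y : ℂ) = moeb γ (x : ℂ) → vecF p x - (autFactor (1 / 2) γ (x : ℂ))⁻¹ •
        ((mult hp γ : Matrix (Fin (p - 1)) (Fin (p - 1)) ℂ) *ᵥ vecF p y) =
      (Real.sqrt (2 * p) : ℝ) • (eichlerVec p x - (lowerRoot γ (x : ℂ))⁻¹ •
        ((mult hp γ : Matrix (Fin (p - 1)) (Fin (p - 1)) ℂ) *ᵥ eichlerVec p (moeb γ (x : ℂ)))) := by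
    intro x y hy
    rw [vecF_ratCast hp, vecF_ratCast hp, hy, smul_sub, Matrix.mulVec_smul, smul_comm _ (Real.sqrt _)]
    rfl
  by_cases hc : γ 1 0 = 0
  · refine ⟨0, contDiff_const, fun x _ => analyticAt_const, fun x y _ hy => ?_⟩
    have := eichlerVec_sub_of_slOneZero_eq_zero hp hc x
    rw [hF x y hy, this, smul_zero]; rfl
  · set x₀ : ℚ := -(γ 1 1 : ℤ) / (γ 1 0 : ℤ) with hx₀
    have hc' : ((γ 1 0 : ℤ) : ℂ) ≠ 0 := by exact_mod_cast hc
    have hd₀ : den γ (x₀ : ℂ) = 0 := by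
      rw [den, hx₀]; push_cast; field_simp; ring
    have hφ := rapidDecay_thetaVec hp x₀
    have hφc := continuousOn_thetaVec_vertical hp (w := (x₀ : ℂ)) (by simp)
    refine ⟨fun x => (Real.sqrt (2 * p) : ℝ) • cuspIntegral
      (fun s : ℝ => thetaVec p ((x₀ : ℂ) + I * s)) 0 ((x - (x₀ : ℝ) : ℝ) : ℂ), ?_, ?_, ?_⟩
    · exact ((hφ.contDiff_cuspIntegral hφc).comp
        (contDiff_id.sub contDiff_const : ContDiff ℝ ∞ fun x : ℝ => x - (x₀ : ℝ))).const_smul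
          (Real.sqrt (2 * p) : ℝ)
    · intro x hx
      have hne : x - (x₀ : ℝ) ≠ 0 := by
        intro h
        rw [sub_eq_zero] at h
        rw [h, Complex.ofReal_ratCast] at hx
        exact hx hd₀
      have h1 : AnalyticAt ℝ (fun x : ℝ => x - (x₀ : ℝ)) x := by fun_prop
      exact ((hφ.analyticAt_cuspIntegral hφc hne).comp_of_eq h1 rfl).const_smul
        (c := (Real.sqrt (2 * p) : ℝ))
    · intro x y hx hy
      rw [hF x y hy, eichlerVec_sub hp (Or.inr ⟨x, rfl⟩) hx hd₀, integral_kernelTheta]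
      simp

lemma isQuantumModularForm_vecF (hp : p ≠ 0) :
    IsQuantumModularForm (1 / 2) (mult hp) (fun x : ℚ => vecF p (x : ℂ)) :=
  ⟨isMultiplierSystem_mult hp, exists_error hp⟩

/-- Reconciles the root √(wi) with the automorphy root at S. The constant e^{πi/4} is the one
cancelled by that of `multS`. -/
lemma cpow_half_mul_I (hw : w.im ≤ 0) :
    (w * I) ^ (1 / 2 : ℂ) = lowerRoot ModularGroup.S w * cexp (Real.pi * I / 4) := by
  have harg : (-I * (starRingEnd ℂ) w).arg ≠ Real.pi := by
    rw [Ne, Complex.arg_eq_pi_iff]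
    simp [not_lt.2 hw]
  have h1 : (w * I) ^ (1 / 2 : ℂ) =
      (starRingEnd ℂ) ((-I * (starRingEnd ℂ) w) ^ (1 / 2 : ℂ)) := by
    have := Complex.conj_cpow (-I * (starRingEnd ℂ) w) (1 / 2) harg
    rw [map_mul, map_neg, conj_I, neg_neg, Complex.conj_conj, map_div₀, map_one,
      Complex.conj_ofNat] at this
    rw [mul_comm w, this]
  have h2 : lowerRoot ModularGroup.S w = (starRingEnd ℂ) (((starRingEnd ℂ) w) ^ (1 / 2 : ℂ)) := by
    rw [lowerRoot_eq, if_pos (by simp [ModularGroup.S]), den_S]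
  have h3 := cpow_half_eq_I_mul (z := (starRingEnd ℂ) w) (by simpa using hw)
  rw [h1, h2, h3, map_mul, I_cpow_half, ← Complex.exp_conj, mul_right_comm, ← Complex.exp_add]
  have : (starRingEnd ℂ) (Real.pi * I / 4) + Real.pi * I / 4 = 0 := by
    simp only [map_div₀, map_mul, Complex.conj_ofReal, conj_I, Complex.conj_ofNat]; ring
  rw [this, Complex.exp_zero, one_mul]

/-- This is `eichlerVec_sub` for the matrix S with cusp 0, multiplied by S(p), which is its own
inverse. -/
lemma vecF_neg_inv_lower (hp : p ≠ 0) (hw : LowerPoint w) (h0 : w ≠ 0) :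
    (1 / (w * I) ^ (1 / 2 : ℂ)) • vecF p (-1 / w) + matS p *ᵥ vecF p w =
      -(matS p *ᵥ errorG p w) := by
  have hm : LowerPoint (-1 / w) := by rw [← moeb_S]; exact hw.moeb
  have h := eichlerVec_sub (γ := ModularGroup.S) hp hw (by rwa [den_S]) (x := 0)
    (by rw [den_S]; simp)
  rw [integral_kernelTheta, moeb_S, mult_S] at h
  simp only [Rat.cast_zero, zero_add, sub_zero] at h
  rw [errorG_eq hp, ← h, hw.vecF_eq hp, hm.vecF_eq hp, cpow_half_mul_I hw.im_nonpos]
  simp only [multS, Matrix.smul_mulVec, Matrix.mulVec_smul, Matrix.mulVec_sub,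
    Matrix.mulVec_mulVec, matS_mul_self hp, Matrix.one_mulVec]
  have hl : lowerRoot ModularGroup.S w ≠ 0 := lowerRoot_ne_zero (by rwa [den_S])
  ext j
  simp only [Pi.add_apply, Pi.smul_apply, Pi.neg_apply, Pi.sub_apply, smul_eq_mul, Complex.real_smul,
    Complex.exp_neg]
  field_simp
  ring

end ErrorOfModularity

/-! ### The transformation law on the upper half-plane -/

section StarPrimitive

variable {E : Type*} [NormedAddCommGroup E] [NormedSpace ℂ E] [CompleteSpace E]

/-- A holomorphic function on an open set that is star-shaped about `0` has a primitive. -/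
lemma exists_primitive_of_starConvex {U : Set ℂ} (hU : IsOpen U) (hs : StarConvex ℝ 0 U)
    {H : ℂ → E} (hH : DifferentiableOn ℂ H U) :
    ∃ P : ℂ → E, ∀ ζ ∈ U, HasDerivAt P (H ζ) ζ := by
  have hstar : ∀ ζ ∈ U, ∀ t ∈ Set.Icc (0 : ℝ) 1, (t : ℂ) * ζ ∈ U := by
    intro ζ hζ t ht
    have := hs hζ (sub_nonneg.2 ht.2) ht.1 (by ring)
    simpa using this
  have hH' : ContinuousOn (deriv H) U := (hH.deriv hU).continuousOn
  refine ⟨fun ζ => ∫ t in (0 : ℝ)..1, ζ • H ((t : ℂ) * ζ), fun ζ hζ => ?_⟩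
  set F' : ℂ → ℝ → E := fun ζ t => H ((t : ℂ) * ζ) + ζ • (t : ℂ) • deriv H ((t : ℂ) * ζ) with hF'
  obtain ⟨ε, hε, hball⟩ := Metric.nhds_basis_closedBall.mem_iff.1 (hU.mem_nhds hζ)
  have hderiv : ∀ z ∈ U, HasDerivAt H (deriv H z) z := fun z hz =>
    (hH.differentiableAt (hU.mem_nhds hz)).hasDerivAt
  have hcF' : ContinuousOn (fun x : ℂ × ℝ => F' x.1 x.2)
      (Metric.closedBall ζ ε ×ˢ Set.Icc (0 : ℝ) 1) := by
    have hm : Set.MapsTo (fun x : ℂ × ℝ => (x.2 : ℂ) * x.1)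
        (Metric.closedBall ζ ε ×ˢ Set.Icc (0 : ℝ) 1) U :=
      fun x hx => hstar x.1 (hball hx.1) x.2 hx.2
    have hc : ContinuousOn (fun x : ℂ × ℝ => (x.2 : ℂ) * x.1)
        (Metric.closedBall ζ ε ×ˢ Set.Icc (0 : ℝ) 1) := by fun_prop
    exact (hH.continuousOn.comp hc hm).add (continuous_fst.continuousOn.smul
      ((by fun_prop : Continuous fun x : ℂ × ℝ => (x.2 : ℂ)).continuousOn.smul (hH'.comp hc hm)))
  obtain ⟨B, hB⟩ := ((isCompact_closedBall ζ ε).prod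
    isCompact_Icc).exists_bound_of_continuousOn hcF'
  have hcF : ∀ z ∈ U, ContinuousOn (fun t : ℝ => z • H ((t : ℂ) * z)) (Set.Icc 0 1) := fun z hz =>
    continuousOn_const.smul (hH.continuousOn.comp (by fun_prop) fun t ht => hstar z hz t ht)
  have hcF'ζ : ContinuousOn (F' ζ) (Set.Icc 0 1) :=
    hcF'.comp (f := fun t : ℝ => (ζ, t)) (by fun_prop)
      fun t ht => ⟨Metric.mem_closedBall_self hε.le, ht⟩
  have hIoc : Set.uIoc (0 : ℝ) 1 ⊆ Set.Icc 0 1 := by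
    rw [Set.uIoc_of_le zero_le_one]; exact Set.Ioc_subset_Icc_self
  have hmeas : ∀ {f : ℝ → E}, ContinuousOn f (Set.Icc 0 1) →
      AEStronglyMeasurable f (volume.restrict (Set.uIoc (0 : ℝ) 1)) := fun hf =>
    (hf.mono hIoc).aestronglyMeasurable measurableSet_uIoc
  have key := intervalIntegral.hasDerivAt_integral_of_dominated_loc_of_deriv_le (𝕜 := ℂ)
    (μ := volume) (a := 0) (b := 1) (bound := fun _ => B) (x₀ := ζ) (s := Metric.closedBall ζ ε)
    (F := fun z t => z • H ((t : ℂ) * z)) (F' := F')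
    (Metric.closedBall_mem_nhds ζ hε)
    (by filter_upwards [hU.mem_nhds hζ] with z hz using hmeas (hcF z hz))
    (ContinuousOn.intervalIntegrable_of_Icc zero_le_one (hcF ζ hζ)) (hmeas hcF'ζ)
    (Eventually.of_forall fun t ht z hz => hB (z, t) ⟨hz, hIoc ht⟩) intervalIntegrable_const
    (Eventually.of_forall fun t ht z hz => by
      have h1 := (hderiv _ (hstar z (hball hz) t (hIoc ht))).scomp z
        ((hasDerivAt_id z).const_mul (t : ℂ))
      refine ((hasDerivAt_id z).smul h1).congr_deriv ?_
      simp [hF', add_comm])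
  refine key.2.congr_deriv ?_
  -- The differentiated integrand H(tζ) + tζ H'(tζ) is the t-derivative of t H(tζ), so it integrates
  -- to H(ζ).
  have hd : ∀ t ∈ Set.uIcc (0 : ℝ) 1, HasDerivAt (fun t : ℝ => (t : ℂ) • H ((t : ℂ) * ζ)) (F' ζ t) t := by
    intro t ht
    rw [Set.uIcc_of_le zero_le_one] at ht
    have h0 : HasDerivAt (fun t : ℝ => (t : ℂ)) 1 t := Complex.ofRealCLM.hasDerivAt
    have h1 := (hderiv _ (hstar ζ hζ t ht)).scomp t (h0.mul_const ζ)
    refine (h0.smul h1).congr_deriv ?_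
    simp only [hF', one_smul, one_mul, smul_smul]
    rw [add_comm, mul_comm (t : ℂ) ζ]
    simp only [Function.comp_apply, mul_comm]
  rw [intervalIntegral.integral_eq_sub_of_hasDerivAt hd
    (ContinuousOn.intervalIntegrable_of_Icc zero_le_one hcF'ζ)]
  simp

end StarPrimitive

/-! ### The substitution u = w + iζ² at the branch point -/

section UpperLaw

variable {p : ℕ} {w : ℂ} {P : ℂ → Fin (p - 1) → ℂ}

/-- With -i(u - w) = ζ² and du = 2iζ dζ the kernel loses its singularity. The domain Im w + Re ζ² >
0 is star-shaped about 0, so a primitive exists on both branches at once. -/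
lemma exists_primitive_square (hp : p ≠ 0) (hw : 0 < w.im) :
    ∃ P : ℂ → Fin (p - 1) → ℂ, ∀ ζ : ℂ, 0 < (w + I * ζ ^ 2).im →
      HasDerivAt P ((2 : ℂ) • thetaVec p (w + I * ζ ^ 2)) ζ := by
  refine exists_primitive_of_starConvex (U := {ζ : ℂ | 0 < (w + I * ζ ^ 2).im})
    (isOpen_lt continuous_const (by fun_prop)) ?_ ?_
  · intro ζ hζ a b ha hb hab
    have h1 : 0 < (w + I * ζ ^ 2).im := hζ
    have e : w + I * (a • (0 : ℂ) + b • ζ) ^ 2 = w + ((b ^ 2 : ℝ) : ℂ) * (I * ζ ^ 2) := by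
      simp only [smul_zero, zero_add, Complex.real_smul]; push_cast; ring
    rw [Set.mem_ofPred_eq, e, add_im, Complex.im_ofReal_mul]
    rw [add_im] at h1
    have hb1 : b ^ 2 ≤ 1 := pow_le_one₀ hb (by linarith)
    rcases le_total 0 (I * ζ ^ 2).im with h | h
    · have := mul_nonneg (sq_nonneg b) h
      linarith
    · nlinarith
  · have h1 : DifferentiableOn ℂ (fun ζ : ℂ => w + I * ζ ^ 2) {ζ : ℂ | 0 < (w + I * ζ ^ 2).im} := by
      fun_prop
    exact ((differentiableOn_thetaVec hp).comp h1 fun ζ hζ => hζ).const_smul (2 : ℂ)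

lemma hasDerivAt_primitive_cpow_half
    (hP : ∀ ζ : ℂ, 0 < (w + I * ζ ^ 2).im → HasDerivAt P ((2 : ℂ) • thetaVec p (w + I * ζ ^ 2)) ζ)
    {z : ℝ → ℂ} {z' : ℂ} {t : ℝ} (hz : HasDerivAt z z' t) (hs : z t ∈ slitPlane)
    (hi : 0 < (w + I * z t).im) :
    HasDerivAt (fun t => P (z t ^ (1 / 2 : ℂ)))
      ((z' * (z t ^ (1 / 2 : ℂ))⁻¹) • thetaVec p (w + I * z t)) t := by
  have h1 := (hasDerivAt_cpow_half hs).comp t hz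
  have h2 := hP (z t ^ (1 / 2 : ℂ)) (by rwa [cpow_half_sq])
  rw [cpow_half_sq] at h2
  refine (h2.scomp t h1).congr_deriv ?_
  rw [smul_smul]
  congr 1; ring

/-- The root tends to 0 in norm whichever side of the cut z approaches from, so all paths from w
share the starting value P 0. -/
lemma tendsto_primitive_zero (hw : 0 < w.im)
    (hP : ∀ ζ : ℂ, 0 < (w + I * ζ ^ 2).im → HasDerivAt P ((2 : ℂ) • thetaVec p (w + I * ζ ^ 2)) ζ)
    {z : ℝ → ℂ} {l : Filter ℝ} (hz : Tendsto z l (𝓝 0)) :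
    Tendsto (fun t => P (z t ^ (1 / 2 : ℂ))) l (𝓝 (P 0)) := by
  refine ((hP 0 (by simpa using hw)).continuousAt.tendsto).comp ?_
  rw [tendsto_zero_iff_norm_tendsto_zero]
  simp_rw [norm_cpow_half]
  exact (Real.continuous_sqrt.tendsto' 0 0 Real.sqrt_zero).comp
    (tendsto_zero_iff_norm_tendsto_zero.1 hz)

lemma norm_primitive_sub_le
    (hP : ∀ ζ : ℂ, 0 < (w + I * ζ ^ 2).im → HasDerivAt P ((2 : ℂ) • thetaVec p (w + I * ζ ^ 2)) ζ)
    {z z' : ℝ → ℂ} (hz : ∀ t ∈ Set.Icc (0 : ℝ) 1, HasDerivAt z (z' t) t)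
    (hs : ∀ t ∈ Set.Icc (0 : ℝ) 1, z t ∈ slitPlane)
    (hi : ∀ t ∈ Set.Icc (0 : ℝ) 1, 0 < (w + I * z t).im) {C : ℝ}
    (hC : ∀ t ∈ Set.Icc (0 : ℝ) 1,
      ‖z' t‖ * (Real.sqrt ‖z t‖)⁻¹ * ‖thetaVec p (w + I * z t)‖ ≤ C) :
    ‖P (z 1 ^ (1 / 2 : ℂ)) - P (z 0 ^ (1 / 2 : ℂ))‖ ≤ C := by
  refine norm_image_sub_le_of_norm_deriv_le_segment_01' (f := fun t => P (z t ^ (1 / 2 : ℂ)))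
    (fun t ht => (hasDerivAt_primitive_cpow_half hP (hz t ht) (hs t ht)
      (hi t ht)).hasDerivWithinAt) fun t ht => ?_
  have h := hC t ⟨ht.1, ht.2.le⟩
  rwa [norm_smul, norm_mul, norm_inv, norm_cpow_half]

lemma sq_mem_slitPlane {s : ℂ} (hs : 0 < s.re) : s ^ 2 ∈ slitPlane := by
  rw [Complex.mem_slitPlane_iff, sq, Complex.mul_re, Complex.mul_im]
  by_cases h : s.im = 0
  · left; rw [h]; nlinarith
  · right
    have := mul_ne_zero hs.ne' h
    intro h2; apply this; linarith

/-- The point `w + i z` with `w` off the imaginary axis moves from `w` to `0` along a geodesic: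
the square root of `z = i w + i / v` with `v = -1/w + i s`. -/
lemma cpow_half_geodesic (hw : 0 < w.im) (hre : w.re ≠ 0) {s : ℝ} (hs : 0 < s) :
    0 < (-1 / w + I * s).im ∧
    I * w + I / (-1 / w + I * s) ∈ slitPlane ∧
    (I * w + I / (-1 / w + I * s)) ^ (1 / 2 : ℂ) =
      (Real.sqrt s : ℂ) * (w * I) ^ (1 / 2 : ℂ) * ((-I * (-1 / w + I * s)) ^ (1 / 2 : ℂ))⁻¹ := by
  have hw0 : w ≠ 0 := by rintro rfl; simp at hw
  set v := -1 / w + I * s with hv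
  have hvi : 0 < v.im := by
    have := im_neg_one_div_pos hw
    rw [hv, add_im, Complex.im_mul_ofReal, I_im, one_mul]
    linarith
  clear_value v
  have hv0 : v ≠ 0 := by rintro h; rw [h] at hvi; simp at hvi
  have hs0 : 0 < Real.sqrt s := Real.sqrt_pos.2 hs
  have hvre : v.re = -w.re / Complex.normSq w := by
    rw [hv, neg_div, one_div]; simp [Complex.inv_re, neg_div]
  have hinv : -I * (-1 / v) = (-I * v)⁻¹ := neg_I_mul_neg_one_div v
  have hsq : ((Real.sqrt s : ℂ) * (w * I) ^ (1 / 2 : ℂ) * ((-I * v) ^ (1 / 2 : ℂ))⁻¹) ^ 2 =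
      I * w + I / v := by
    rw [mul_pow, mul_pow, inv_pow, cpow_half_sq, cpow_half_sq, ← Complex.ofReal_pow,
      Real.sq_sqrt hs.le]
    have e : w * v = -1 + I * s * w := by rw [hv]; field_simp
    field_simp
    linear_combination -I * e - s * w * I_sq
  -- The numbers wi and -i(-1/v) have imaginary parts of opposite signs. Their roots lie in the
  -- right half-plane on opposite sides of the real axis, so the product has positive real part.
  have hpos : 0 < ((Real.sqrt s : ℂ) * (w * I) ^ (1 / 2 : ℂ) * ((-I * v) ^ (1 / 2 : ℂ))⁻¹).re := by
    rw [← cpow_half_neg_I_inv hvi, ← hinv, mul_assoc, Complex.re_ofReal_mul]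
    refine mul_pos hs0 ?_
    have him1 : (w * I).im = w.re := by simp
    have him2 : (-I * (-1 / v)).im = v.re / Complex.normSq v := by
      rw [neg_div, one_div]; simp [Complex.inv_re]
    have hnw : 0 < Complex.normSq w := Complex.normSq_pos.2 hw0
    have hnv : 0 < Complex.normSq v := Complex.normSq_pos.2 hv0
    rw [Complex.mul_re]
    rcases hre.lt_or_gt with h | h
    · have h1 : 0 < (-I * (-1 / v)).im := by
        rw [him2, hvre]; exact div_pos (div_pos (by linarith) hnw) hnv
      have h2 : (w * I).im < 0 := by rwa [him1]
      have a1 := cpow_half_re_pos (z := w * I) (Or.inr h2.ne)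
      have a2 := cpow_half_re_pos (z := -I * (-1 / v)) (Or.inr h1.ne')
      have a3 := cpow_half_im_neg h2
      have a4 := cpow_half_im_pos h1
      nlinarith [mul_pos a1 a2, mul_pos (neg_pos.2 a3) a4]
    · have h1 : (-I * (-1 / v)).im < 0 := by
        rw [him2, hvre]
        exact div_neg_of_neg_of_pos (div_neg_of_neg_of_pos (by linarith) hnw) hnv
      have h2 : 0 < (w * I).im := by rwa [him1]
      have a1 := cpow_half_re_pos (z := w * I) (Or.inr h2.ne')
      have a2 := cpow_half_re_pos (z := -I * (-1 / v)) (Or.inr h1.ne)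
      have a3 := cpow_half_im_pos h2
      have a4 := cpow_half_im_neg h1
      nlinarith [mul_pos a1 a2, mul_pos a3 (neg_pos.2 a4)]
  refine ⟨hvi, ?_, ?_⟩
  · rw [← hsq]; exact sq_mem_slitPlane hpos
  · exact cpow_half_eq_of_re_pos hsq hpos

end UpperLaw

/-! ### Comparison of the three paths from w, 0 and i∞ -/

section UpperLawProof

variable {p : ℕ} {w : ℂ} {P : ℂ → Fin (p - 1) → ℂ}

lemma tendsto_exp_neg_decayRate (hp : p ≠ 0) :
    Tendsto (fun y : ℝ => Real.exp (-decayRate p * y)) atTop (𝓝 0) :=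
  Real.tendsto_exp_atBot.comp (tendsto_id.const_mul_atTop_of_neg (neg_lt_zero.2 (decayRate_pos hp)))

/-- The points w + is and is are joined by a segment of fixed length |w|, on which the theta vector
is exponentially small in s. -/
lemma tendsto_primitive_sub_infty (hp : p ≠ 0) (hw : 0 < w.im)
    (hP : ∀ ζ : ℂ, 0 < (w + I * ζ ^ 2).im →
      HasDerivAt P ((2 : ℂ) • thetaVec p (w + I * ζ ^ 2)) ζ) :
    Tendsto (fun s : ℝ => P (((s : ℂ) + I * w) ^ (1 / 2 : ℂ)) - P ((s : ℂ) ^ (1 / 2 : ℂ)))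
      atTop (𝓝 0) := by
  obtain ⟨K, hK, hKf⟩ := exists_norm_thetaVec_le hp zero_lt_one
  have hlim : Tendsto (fun s : ℝ => ‖w‖ * (K * Real.exp (-decayRate p * s))) atTop (𝓝 0) := by
    simpa using ((tendsto_exp_neg_decayRate hp).const_mul K).const_mul ‖w‖
  refine squeeze_zero_norm' ?_ hlim
  filter_upwards [eventually_ge_atTop (‖w‖ + 1)] with s hs
  have hwn := Complex.im_le_norm w
  have hs1 : 1 ≤ s := by linarith [norm_nonneg w]
  have hre : ∀ t ∈ Set.Icc (0 : ℝ) 1, 1 ≤ ((s : ℂ) + I * w * t).re := by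
    intro t ht
    have e : ((s : ℂ) + I * w * t).re = s - w.im * t := by simp; ring
    rw [e]
    nlinarith [ht.1, ht.2]
  have him : ∀ t ∈ Set.Icc (0 : ℝ) 1, s ≤ (w + I * ((s : ℂ) + I * w * t)).im := by
    intro t ht
    have e : w + I * ((s : ℂ) + I * w * t) = ((1 - t : ℝ) : ℂ) * w + I * s := by
      push_cast; linear_combination (w * t) * I_sq
    rw [e, add_im, Complex.im_ofReal_mul, Complex.im_mul_ofReal, I_im, one_mul]
    nlinarith [ht.2]
  have h := norm_primitive_sub_le hP (z := fun t : ℝ => (s : ℂ) + I * w * t) (z' := fun _ => I * w)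
    (C := ‖w‖ * (K * Real.exp (-decayRate p * s)))
    (fun t _ => by
      have h0 : HasDerivAt (fun t : ℝ => (t : ℂ)) 1 t := Complex.ofRealCLM.hasDerivAt
      simpa using (h0.const_mul (I * w)).const_add (s : ℂ))
    (fun t ht => Or.inl (zero_lt_one.trans_le (hre t ht)))
    (fun t ht => by linarith [him t ht])
    (fun t ht => by
      rw [norm_mul, Complex.norm_I, one_mul]
      have h1 : (Real.sqrt ‖(s : ℂ) + I * w * t‖)⁻¹ ≤ 1 :=
        inv_le_one_of_one_le₀ (Real.one_le_sqrt.2 ((hre t ht).trans (Complex.re_le_norm _)))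
      have h2 := hKf _ (hs1.trans (him t ht))
      calc _ ≤ ‖w‖ * 1 * (K * Real.exp (-decayRate p * s)) := by
            gcongr
            refine h2.trans ?_
            have := decayRate_pos hp
            have := him t ht
            gcongr ?_ * Real.exp ?_
            nlinarith
        _ = _ := by ring)
  simpa using h

/-- Near the cusp 0 the connecting path is u = -1/v, with v on the segment from iy to -1/w + iy. The
growth |v|^{3/2} from the inversion law is compensated by |v|⁻² from the differential, and
exponential decay in y remains. -/
lemma tendsto_primitive_sub_cusp (hp : p ≠ 0) (hw : 0 < w.im) (hre : w.re ≠ 0)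
    (hP : ∀ ζ : ℂ, 0 < (w + I * ζ ^ 2).im →
      HasDerivAt P ((2 : ℂ) • thetaVec p (w + I * ζ ^ 2)) ζ) :
    Tendsto (fun y : ℝ => P ((I * w + I / (-1 / w + I * y)) ^ (1 / 2 : ℂ)) -
      P (((y⁻¹ : ℝ) + I * w) ^ (1 / 2 : ℂ))) atTop (𝓝 0) := by
  have hw0 : w ≠ 0 := by rintro rfl; simp at hw
  obtain ⟨K, hK, hKf⟩ := exists_norm_thetaVec_le hp zero_lt_one
  obtain ⟨B, hB, hBf⟩ := exists_norm_mulVec_le (matS p)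
  -- For |v| ≥ 1/ρ the term i/v cannot bring the imaginary part of iw + i/v below ρ in absolute
  -- value, so the path avoids the cut and the root is bounded below.
  set ρ : ℝ := |w.re| / 2 with hρ
  have hρ0 : 0 < ρ := by have := abs_pos.2 hre; positivity
  have hlim : Tendsto (fun y : ℝ => ‖w‖⁻¹ * (Real.sqrt ρ)⁻¹ * (B * (K * Real.exp (-decayRate p * y))))
      atTop (𝓝 0) := by
    simpa using (((tendsto_exp_neg_decayRate hp).const_mul K).const_mul B).const_mul
      (‖w‖⁻¹ * (Real.sqrt ρ)⁻¹)
  refine squeeze_zero_norm' ?_ hlim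
  filter_upwards [eventually_ge_atTop (1 : ℝ), eventually_ge_atTop ρ⁻¹] with y hy1 hy2
  have hy0 : 0 < y := by linarith
  set v : ℝ → ℂ := fun t => (-1 / w) * t + I * y with hv
  have him : ∀ t ∈ Set.Icc (0 : ℝ) 1, y ≤ (v t).im := by
    intro t ht
    have := im_neg_one_div_pos hw
    simp only [hv]
    rw [add_im, Complex.im_mul_ofReal, Complex.im_mul_ofReal, I_im, one_mul]
    nlinarith [ht.1]
  have hvn : ∀ t ∈ Set.Icc (0 : ℝ) 1, y ≤ ‖v t‖ := fun t ht =>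
    (him t ht).trans (Complex.im_le_norm _)
  have hv0 : ∀ t ∈ Set.Icc (0 : ℝ) 1, v t ≠ 0 := fun t ht h => by
    have := hvn t ht
    rw [h, norm_zero] at this; linarith
  have hzim : ∀ t ∈ Set.Icc (0 : ℝ) 1, ρ ≤ |(I * w + I / v t).im| := by
    intro t ht
    have h1 : |(I / v t).im| ≤ ρ := by
      refine (Complex.abs_im_le_norm _).trans ?_
      rw [norm_div, Complex.norm_I, one_div]
      exact inv_le_of_inv_le₀ hρ0 (hy2.trans (hvn t ht))
    have h2 : (I * w + I / v t).im = w.re + (I / v t).im := by rw [add_im]; simp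
    rw [h2]
    have h3 := abs_sub_abs_le_abs_sub w.re (-(I / v t).im)
    rw [sub_neg_eq_add, abs_neg] at h3
    have : |w.re| = 2 * ρ := by rw [hρ]; ring
    linarith
  have hwz : ∀ t : ℝ, w + I * (I * w + I / v t) = -1 / v t := fun t => by
    rw [div_eq_mul_inv, div_eq_mul_inv]
    linear_combination (w + (v t)⁻¹) * I_sq
  have h := norm_primitive_sub_le hP (z := fun t : ℝ => I * w + I / v t)
    (z' := fun t => I / (w * v t ^ 2))
    (C := ‖w‖⁻¹ * (Real.sqrt ρ)⁻¹ * (B * (K * Real.exp (-decayRate p * y))))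
    (fun t ht => by
      have h1 : HasDerivAt v (-1 / w) t := by
        have h0 : HasDerivAt (fun t : ℝ => (t : ℂ)) 1 t := Complex.ofRealCLM.hasDerivAt
        exact ((h0.const_mul (-1 / w)).add_const (I * (y : ℂ))).congr_deriv (mul_one _)
      have h2 := ((h1.fun_inv (hv0 t ht)).const_mul I).const_add (I * w)
      simp only [← div_eq_mul_inv] at h2
      refine h2.congr_deriv ?_
      have := hv0 t ht
      field_simp)
    (fun t ht => Or.inr (abs_pos.1 (hρ0.trans_le (hzim t ht))))
    (fun t ht => by
      simp only [hwz]
      exact im_neg_one_div_pos (hy0.trans_le (him t ht)))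
    (fun t ht => by
      simp only [hwz]
      have hvi : 0 < (v t).im := hy0.trans_le (him t ht)
      have hn := hvn t ht
      have h1 : (Real.sqrt ‖I * w + I / v t‖)⁻¹ ≤ (Real.sqrt ρ)⁻¹ := by
        have := Real.sqrt_pos.2 hρ0
        gcongr
        exact (hzim t ht).trans (Complex.abs_im_le_norm _)
      have h2 := hKf (v t) (hy1.trans (him t ht))
      have h3 : ‖thetaVec p (v t)‖ ≤ K * Real.exp (-decayRate p * y) := by
        refine h2.trans ?_
        have := decayRate_pos hp
        have := him t ht
        gcongr ?_ * Real.exp ?_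
        nlinarith
      have h4 : ‖thetaVec p (-1 / v t)‖ ≤ ‖v t‖ ^ 2 * (B * (K * Real.exp (-decayRate p * y))) := by
        rw [thetaVec_neg_inv hp hvi, norm_smul, norm_mul, norm_cpow_half, norm_mul, norm_neg,
          Complex.norm_I, one_mul, sq]
        have h5 : Real.sqrt ‖v t‖ ≤ ‖v t‖ := by
          rw [Real.sqrt_le_left (by positivity)]; nlinarith
        have h6 := hBf (thetaVec p (v t))
        gcongr
        exact h6.trans (by gcongr)
      have hvpos : 0 < ‖v t‖ := hy0.trans_le hn
      have hwpos : 0 < ‖w‖ := norm_pos_iff.2 hw0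
      rw [norm_div, norm_mul, norm_pow, Complex.norm_I]
      calc 1 / (‖w‖ * ‖v t‖ ^ 2) * (Real.sqrt ‖I * w + I / v t‖)⁻¹ * ‖thetaVec p (-1 / v t)‖
          ≤ 1 / (‖w‖ * ‖v t‖ ^ 2) * (Real.sqrt ρ)⁻¹ *
            (‖v t‖ ^ 2 * (B * (K * Real.exp (-decayRate p * y)))) := by gcongr
        _ = _ := by field_simp)
  have e0 : I * w + I / v 0 = ((y⁻¹ : ℝ) : ℂ) + I * w := by
    have : (y : ℂ) ≠ 0 := by exact_mod_cast hy0.ne'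
    simp only [hv]
    rw [ofReal_zero, mul_zero, zero_add, ofReal_inv, div_eq_mul_inv, mul_inv, mul_inv_cancel_left₀ I_ne_zero,
      add_comm]
  have e1 : v 1 = -1 / w + I * y := by simp [hv]
  simp only [e0, e1] at h
  exact h

/-- Let L and M be the limits of P at i∞ and at the cusp 0. Up to constants, F(w) is L - P 0,
F(-1/w) is the image of M - P 0 under S(p), and g(w) is L - M. Off the imaginary axis the principal
roots stay off the cut along all three paths. -/
lemma vecF_neg_inv_upper_of_re_ne_zero (hp : p ≠ 0) (hw : 0 < w.im) (hre : w.re ≠ 0) :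
    (1 / (w * I) ^ (1 / 2 : ℂ)) • vecF p (-1 / w) + matS p *ᵥ vecF p w =
      -(matS p *ᵥ errorG p w) := by
  have hw0 : w ≠ 0 := by rintro rfl; simp at hw
  have hwi := im_neg_one_div_pos hw
  obtain ⟨P, hP⟩ := exists_primitive_square hp hw
  set a := (w * I) ^ (1 / 2 : ℂ) with ha
  have ha0 : a ≠ 0 := cpow_half_ne_zero (mul_ne_zero hw0 I_ne_zero)
  -- the vertical path from `w`
  have hA : ∀ s : ℝ, 0 < s → HasDerivAt (fun s : ℝ => P ((s : ℂ) ^ (1 / 2 : ℂ)))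
      ((Real.sqrt s)⁻¹ • thetaVec p (w + I * s)) s := fun s hs => by
    refine (hasDerivAt_primitive_cpow_half hP (z := fun s : ℝ => (s : ℂ))
      (Complex.ofRealCLM.hasDerivAt (x := s)) (Or.inl (by simpa using hs)) ?_).congr_deriv ?_
    · simp; linarith
    · rw [cpow_half_ofReal hs.le, ← Complex.ofReal_inv]
      simp only [ofRealCLM_apply, ofReal_one, one_mul]
      rfl
  have hAi := integrableOn_inv_sqrt_smul_thetaVec hp hw
  have hA1 := tendsto_limUnder_of_hasDerivAt_of_integrableOn_Ioi (a := 0) hA hAi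
  set L := limUnder atTop (fun s : ℝ => P ((s : ℂ) ^ (1 / 2 : ℂ)))
  have hofReal : Tendsto (fun s : ℝ => (s : ℂ)) (𝓝[>] 0) (𝓝 0) := by
    have : Tendsto (fun s : ℝ => (s : ℂ)) (𝓝 0) (𝓝 0) := Complex.continuous_ofReal.tendsto' 0 0 (by simp)
    exact this.mono_left nhdsWithin_le_nhds
  have hAint := integral_Ioi_of_tendsto hA hAi (tendsto_primitive_zero hw hP hofReal) hA1
  -- the geodesic from `w` to `0`
  have hC : ∀ s : ℝ, 0 < s → HasDerivAt (fun s : ℝ => P ((I * w + I / (-1 / w + I * s)) ^ (1 / 2 : ℂ)))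
      ((-a⁻¹) • (matS p *ᵥ ((Real.sqrt s)⁻¹ • thetaVec p (-1 / w + I * s)))) s := fun s hs => by
    obtain ⟨hvi, hslit, hroot⟩ := cpow_half_geodesic hw hre hs
    have hv0 : -1 / w + I * s ≠ 0 := by intro h; rw [h] at hvi; simp at hvi
    have hwz : w + I * (I * w + I / (-1 / w + I * s)) = -1 / (-1 / w + I * s) := by
      rw [div_eq_mul_inv _ (-1 / w + I * s), div_eq_mul_inv _ (-1 / w + I * s)]
      linear_combination (w + (-1 / w + I * (s : ℂ))⁻¹) * I_sq
    have hz : HasDerivAt (fun s : ℝ => I * w + I / (-1 / w + I * (s : ℂ)))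
        (((-1 / w + I * s) ^ 2)⁻¹) s := by
      have h2 := (((hasDerivAt_vertical (-1 / w) s).fun_inv hv0).const_mul I).const_add (I * w)
      simp only [← div_eq_mul_inv] at h2
      refine h2.congr_deriv ?_
      rw [div_eq_mul_inv]
      linear_combination (-((-1 / w + I * (s : ℂ)) ^ 2)⁻¹) * I_sq
    refine (hasDerivAt_primitive_cpow_half hP hz hslit (by
      simp only [hwz]; exact im_neg_one_div_pos hvi)).congr_deriv ?_
    simp only [hwz]
    rw [hroot, thetaVec_neg_inv hp hvi, Matrix.mulVec_smul, ← ha]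
    set v := -1 / w + I * (s : ℂ)
    have hb0 : (-I * v) ^ (1 / 2 : ℂ) ≠ 0 :=
      cpow_half_ne_zero (mul_ne_zero (neg_ne_zero.2 I_ne_zero) hv0)
    have hb2 := cpow_half_sq (-I * v)
    set b := (-I * v) ^ (1 / 2 : ℂ)
    have hs0 : ((Real.sqrt s : ℝ) : ℂ) ≠ 0 := by exact_mod_cast (Real.sqrt_pos.2 hs).ne'
    ext j
    simp only [Pi.smul_apply, smul_eq_mul, Complex.real_smul]
    push_cast
    clear_value a b v
    field_simp
    rw [hb2]
    linear_combination v * (matS p *ᵥ thetaVec p v) j * I_sq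
  have hCi := integrableOn_inv_sqrt_smul_thetaVec hp hwi
  set T := LinearMap.toContinuousLinearMap (Matrix.mulVecLin (matS p))
  have hCi' : IntegrableOn (fun s : ℝ => (-a⁻¹) •
      (matS p *ᵥ ((Real.sqrt s)⁻¹ • thetaVec p (-1 / w + I * s)))) (Set.Ioi 0) :=
    (T.integrable_comp hCi).smul (-a⁻¹)
  have hC1 := tendsto_limUnder_of_hasDerivAt_of_integrableOn_Ioi (a := 0) hC hCi'
  set M := limUnder atTop (fun s : ℝ => P ((I * w + I / (-1 / w + I * s)) ^ (1 / 2 : ℂ)))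
  have hC0 : Tendsto (fun s : ℝ => I * w + I / (-1 / w + I * (s : ℂ))) (𝓝[>] 0) (𝓝 0) := by
    have hc : ContinuousAt (fun s : ℝ => I * w + I / (-1 / w + I * (s : ℂ))) 0 := by
      refine ContinuousAt.add continuousAt_const (ContinuousAt.div continuousAt_const (by fun_prop) ?_)
      simp [hw0]
    have := hc.tendsto
    simp only [ofReal_zero, mul_zero, add_zero] at this
    have e : I * w + I / (-1 / w) = 0 := by field_simp; ring
    rw [e] at this
    exact this.mono_left nhdsWithin_le_nhds
  have hCint := integral_Ioi_of_tendsto hC hCi' (tendsto_primitive_zero hw hP hC0) hC1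
  -- the imaginary axis
  have hB : ∀ s : ℝ, 0 < s → HasDerivAt (fun s : ℝ => P (((s : ℂ) + I * w) ^ (1 / 2 : ℂ)))
      (invSqrtPow 0 ((s : ℂ) + I * w) • thetaVec p (I * s)) s := fun s hs => by
    have e : w + I * ((s : ℂ) + I * w) = I * s := by linear_combination w * I_sq
    have hz : HasDerivAt (fun s : ℝ => (s : ℂ) + I * w) 1 s :=
      (Complex.ofRealCLM.hasDerivAt (x := s)).add_const (I * w)
    refine (hasDerivAt_primitive_cpow_half hP hz
      (add_I_mul_mem_slitPlane (Or.inl hre) hs) (by rw [e]; simpa using hs)).congr_deriv ?_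
    rw [e, one_mul, invSqrtPow_zero]
  have hBi := (rapidDecay_thetaVec_zero hp).integrableOn_invSqrt_smul
    (continuousOn_thetaVec_I_mul hp) w
  have hB1 : Tendsto (fun s : ℝ => P (((s : ℂ) + I * w) ^ (1 / 2 : ℂ))) atTop (𝓝 L) := by
    simpa using (tendsto_primitive_sub_infty hp hw hP).add hA1
  have hB0 : Tendsto (fun s : ℝ => P (((s : ℂ) + I * w) ^ (1 / 2 : ℂ))) (𝓝[>] 0) (𝓝 M) := by
    have h1 : Tendsto (fun y : ℝ => P (((y⁻¹ : ℝ) + I * w) ^ (1 / 2 : ℂ))) atTop (𝓝 M) := by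
      simpa using hC1.sub (tendsto_primitive_sub_cusp hp hw hre hP)
    simpa [Function.comp_def] using h1.comp tendsto_inv_nhdsGT_zero
  have hBint := integral_Ioi_of_tendsto hB hBi hB0 hB1
  -- comparison
  have hCint' : matS p *ᵥ (∫ s in Set.Ioi (0 : ℝ), (Real.sqrt s)⁻¹ • thetaVec p (-1 / w + I * s)) =
      (-a) • (M - P 0) := by
    rw [← hCint, integral_smul, smul_smul]
    change T _ = _ • ∫ s in Set.Ioi (0 : ℝ), T _
    rw [T.integral_comp_comm hCi, neg_mul_neg, mul_inv_cancel₀ ha0, one_smul]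
  have hCint2 : ∫ s in Set.Ioi (0 : ℝ), (Real.sqrt s)⁻¹ • thetaVec p (-1 / w + I * s) =
      (-a) • (matS p *ᵥ (M - P 0)) := by
    rw [← Matrix.mulVec_smul, ← hCint', Matrix.mulVec_mulVec, matS_mul_self hp, Matrix.one_mulVec]
  rw [vecF_of_pos hp hw, vecF_of_pos hp hwi, hAint, hCint2, errorG_eq hp, cuspIntegral, hBint]
  simp only [Matrix.mulVec_smul, Matrix.mulVec_sub]
  ext j
  simp only [Pi.add_apply, Pi.smul_apply, Pi.neg_apply, Pi.sub_apply, smul_eq_mul, Complex.real_smul]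
  field_simp
  ring

end UpperLawProof

/-! ### Extension to the imaginary axis -/

section UpperLawOnAxis

variable {p : ℕ} {w : ℂ}

lemma differentiableOn_vecF (hp : p ≠ 0) : DifferentiableOn ℂ (vecF p) {w : ℂ | 0 < w.im} := by
  rw [differentiableOn_pi]
  intro j
  refine (differentiableOn_falseTheta (j := j + 1) hp).congr fun w hw => ?_
  have : 0 < w.im := hw
  rw [vecF, extF, if_pos this]

lemma continuousAt_vecF (hp : p ≠ 0) (hw : 0 < w.im) : ContinuousAt (vecF p) w :=
  (differentiableOn_vecF hp).continuousOn.continuousAt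
    ((isOpen_lt continuous_const Complex.continuous_im).mem_nhds hw)

/-- On the axis both √(wi) and the kernel of g meet their cuts, but the principal values are the
limits from Re w > 0. The law therefore passes to the limit from that side. -/
lemma vecF_neg_inv_upper (hp : p ≠ 0) (hw : 0 < w.im) :
    (1 / (w * I) ^ (1 / 2 : ℂ)) • vecF p (-1 / w) + matS p *ᵥ vecF p w =
      -(matS p *ᵥ errorG p w) := by
  by_cases hre : w.re = 0
  swap
  · exact vecF_neg_inv_upper_of_re_ne_zero hp hw hre
  obtain ⟨t, ht, rfl⟩ : ∃ t : ℝ, 0 < t ∧ w = I * t :=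
    ⟨w.im, hw, by apply Complex.ext <;> simp [hre]⟩
  have ht0 : (t : ℂ) ≠ 0 := by exact_mod_cast ht.ne'
  have hpath : Tendsto (fun ε : ℝ => (ε : ℂ) + I * t) (𝓝[>] 0) (𝓝 (I * t)) := by
    have : Tendsto (fun ε : ℝ => (ε : ℂ) + I * t) (𝓝 0) (𝓝 (I * t)) :=
      Continuous.tendsto' (by fun_prop) _ _ (by simp)
    exact this.mono_left nhdsWithin_le_nhds
  have hroot : Tendsto (fun ε : ℝ => (((ε : ℂ) + I * t) * I) ^ (1 / 2 : ℂ)) (𝓝[>] 0)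
      (𝓝 ((I * t * I) ^ (1 / 2 : ℂ))) := by
    have e1 : ∀ ε : ℝ, 0 ≤ ε → (((ε : ℂ) + I * t) * I) ^ (1 / 2 : ℂ) =
        I ^ (1 / 2 : ℂ) * ((ε : ℂ) + I * t) ^ (1 / 2 : ℂ) := fun ε hε => by
      rw [cpow_half_eq_I_mul (z := ((ε : ℂ) + I * t) * I) (by simpa using hε)]
      congr 2
      linear_combination (-((ε : ℂ) + I * t)) * I_sq
    have e0 := e1 0 le_rfl
    simp only [ofReal_zero, zero_add] at e0
    rw [e0]
    have hslit : I * (t : ℂ) ∈ slitPlane := Or.inr (by simpa using ht.ne')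
    refine ((((differentiableAt_cpow_half hslit).continuousAt.tendsto).comp hpath).const_mul
      (I ^ (1 / 2 : ℂ))).congr' ?_
    filter_upwards [self_mem_nhdsWithin] with ε hε
    exact (e1 ε (le_of_lt hε)).symm
  have hroot0 : (I * t * I) ^ (1 / 2 : ℂ) ≠ 0 :=
    cpow_half_ne_zero (mul_ne_zero (mul_ne_zero I_ne_zero ht0) I_ne_zero)
  have hinv : Tendsto (fun ε : ℝ => -1 / ((ε : ℂ) + I * t)) (𝓝[>] 0) (𝓝 (-1 / (I * t))) :=
    tendsto_const_nhds.div hpath (mul_ne_zero I_ne_zero ht0)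
  have hmul : Continuous (fun v : Fin (p - 1) → ℂ => matS p *ᵥ v) :=
    (LinearMap.toContinuousLinearMap (Matrix.mulVecLin (matS p))).continuous
  have hL := (((tendsto_const_nhds (x := (1 : ℂ))).div hroot hroot0).smul ((continuousAt_vecF hp
    (im_neg_one_div_pos hw)).tendsto.comp hinv)).add
    ((hmul.tendsto _).comp ((continuousAt_vecF hp hw).tendsto.comp hpath))
  have hG : Tendsto (fun ε : ℝ => errorG p ((ε : ℂ) + I * t)) (𝓝[>] 0) (𝓝 (errorG p (I * t))) := by
    simp_rw [errorG_eq hp]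
    exact ((rapidDecay_thetaVec_zero hp).tendsto_cuspIntegral
      (continuousOn_thetaVec_I_mul hp) t).const_smul _
  refine tendsto_nhds_unique hL ((((hmul.tendsto _).comp hG).neg).congr' ?_)
  filter_upwards [self_mem_nhdsWithin] with ε hε
  have hε0 : (0 : ℝ) < ε := hε
  exact (vecF_neg_inv_upper_of_re_ne_zero hp (by simpa using ht) (by simpa using hε0.ne')).symm

end UpperLawOnAxis

/-! ### Real-analyticity on the lower half-plane -/

section BoundedFamilies

open BoundedContinuousFunction

variable {X : Type*} [TopologicalSpace X]

/-- A uniformly bounded family of holomorphic functions that depends continuously on a parameter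
`x` is analytic as a function with values in the bounded continuous functions of `x`. -/
lemma exists_analyticOnNhd_boundedContinuousFunction {U : Set ℂ} (hU : IsOpen U) {g : ℂ → X → ℂ}
    (hc : ∀ a ∈ U, Continuous (g a)) {M : ℝ} (hM : ∀ a ∈ U, ∀ x, ‖g a x‖ ≤ M)
    (hd : ∀ x, DifferentiableOn ℂ (fun a => g a x) U) :
    ∃ G : ℂ → X →ᵇ ℂ, (∀ a ∈ U, ∀ x, G a x = g a x) ∧ AnalyticOnNhd ℂ G U := by
  classical
  refine ⟨fun a => if h : a ∈ U then ofNormedAddCommGroup (g a) (hc a h) M (hM a h) else 0,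
    fun a ha x => by simp [ha], ?_⟩
  set G : ℂ → X →ᵇ ℂ := fun a =>
    if h : a ∈ U then ofNormedAddCommGroup (g a) (hc a h) M (hM a h) else 0 with hG
  have hGg : ∀ a ∈ U, ∀ x, G a x = g a x := fun a ha x => by simp [hG, ha]
  -- The Schwarz lemma bounds the difference quotients of all g(·, x) by one constant, so G is
  -- continuous in the supremum norm.
  have hcont : ContinuousOn G U := by
    intro a ha
    obtain ⟨ε, hε, hball⟩ := Metric.nhds_basis_ball.mem_iff.1 (hU.mem_nhds ha)
    have hle : ∀ b ∈ Metric.ball a ε, ‖G b - G a‖ ≤ (2 * |M|) / ε * ‖b - a‖ := by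
      intro b hb
      rw [BoundedContinuousFunction.norm_le (by positivity)]
      intro x
      have hmaps : Set.MapsTo (fun a => g a x) (Metric.ball a ε)
          (Metric.closedBall (g a x) (2 * |M|)) := by
        intro c hc
        rw [mem_closedBall_iff_norm]
        have h1 := hM c (hball hc) x
        have h2 := hM a ha x
        have h3 := le_abs_self M
        linarith [norm_sub_le (g c x) (g a x)]
      have h := Complex.dist_le_div_mul_dist_of_mapsTo_ball
        ((hd x).mono hball) hmaps hb
      rw [BoundedContinuousFunction.sub_apply, hGg b (hball hb), hGg a ha]
      simpa [dist_eq_norm] using h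
    refine ContinuousAt.continuousWithinAt ?_
    rw [ContinuousAt, tendsto_iff_norm_sub_tendsto_zero]
    have hlim : Tendsto (fun b : ℂ => (2 * |M|) / ε * ‖b - a‖) (𝓝 a) (𝓝 0) :=
      Continuous.tendsto' (by fun_prop) _ _ (by simp)
    refine squeeze_zero' (Eventually.of_forall fun _ => norm_nonneg _) ?_ hlim
    filter_upwards [Metric.ball_mem_nhds a hε] with b hb using hle b hb
  intro a ha
  obtain ⟨ε, hε, hball⟩ := Metric.nhds_basis_closedBall.mem_iff.1 (hU.mem_nhds ha)
  lift ε to NNReal using hε.le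
  have hci : CircleIntegrable G a ε :=
    (hcont.mono (Metric.sphere_subset_closedBall.trans hball)).circleIntegrable ε.2
  -- The Cauchy integral of a continuous function is a power series. Evaluating at each x, where
  -- Cauchy's formula holds, shows that it equals G.
  refine (hasFPowerSeriesOn_cauchy_integral hci (by exact_mod_cast hε)).analyticAt.congr ?_
  filter_upwards [Metric.ball_mem_nhds a hε] with b hb
  ext x
  have hbU : b ∈ U := hball (Metric.ball_subset_closedBall hb)
  have hdx : DiffContOnCl ℂ (fun a => g a x) (Metric.ball a ε) :=
    ((hd x).mono hball).diffContOnCl_ball subset_rfl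
  have hne : ∀ θ : ℝ, circleMap a ε θ - b ≠ 0 := fun θ => by
    rw [sub_ne_zero]
    exact circleMap_ne_mem_ball hb θ
  have hmem : ∀ θ : ℝ, circleMap a ε θ ∈ U := fun θ =>
    hball (Metric.sphere_subset_closedBall (circleMap_mem_sphere a ε.2 θ))
  have hint : IntervalIntegrable (fun θ : ℝ => deriv (circleMap a ε) θ •
      ((circleMap a ε θ - b)⁻¹ • G (circleMap a ε θ))) volume 0 (2 * Real.pi) := by
    refine Continuous.intervalIntegrable ?_ _ _
    simp only [deriv_circleMap]
    have h1 : Continuous fun θ : ℝ => G (circleMap a ε θ) :=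
      hcont.comp_continuous (continuous_circleMap a ε) hmem
    have h2 : Continuous fun θ : ℝ => (circleMap a ε θ - b)⁻¹ :=
      ((continuous_circleMap a ε).sub continuous_const).inv₀ hne
    exact ((continuous_circleMap 0 ε).mul continuous_const).smul (h2.smul h1)
  rw [hGg b hbU, ← hdx.two_pi_i_inv_smul_circleIntegral_sub_inv_smul hb]
  change (2 * (Real.pi : ℂ) * I)⁻¹ • evalCLM ℂ x (∮ z in C(a, ε), (z - b)⁻¹ • G z) = _
  congr 1
  rw [circleIntegral, ← ContinuousLinearMap.intervalIntegral_comp_comm _ hint, circleIntegral]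
  refine intervalIntegral.integral_congr fun θ _ => ?_
  simp [hGg _ (hmem θ)]

/-- Integration against `e ^ (-κ s)` on `(0, ∞)`. -/
noncomputable def laplaceCLM {κ : ℝ} (hκ : 0 < κ) : (ℝ →ᵇ ℂ) →L[ℝ] ℂ :=
  LinearMap.mkContinuous
    { toFun := fun u => ∫ s in Set.Ioi (0 : ℝ), Real.exp (-κ * s) • u s
      map_add' := fun u v => by
        have hi : ∀ u : ℝ →ᵇ ℂ, IntegrableOn (fun s : ℝ => Real.exp (-κ * s) • u s) (Set.Ioi 0) :=
          fun u => (integrableOn_exp_mul_Ioi (neg_neg_iff_pos.2 hκ) 0).smul_bdd ‖u‖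
            u.continuous.aestronglyMeasurable (Eventually.of_forall u.norm_coe_le_norm)
        simp_rw [BoundedContinuousFunction.add_apply, smul_add]
        exact integral_add (hi u) (hi v)
      map_smul' := fun c u => by
        simp_rw [BoundedContinuousFunction.smul_apply, smul_comm _ c]
        exact integral_smul c _ }
    (∫ s in Set.Ioi (0 : ℝ), Real.exp (-κ * s)) fun u => by
      refine (norm_integral_le_of_norm_le ((integrableOn_exp_mul_Ioi (neg_neg_iff_pos.2 hκ) 0).mul_const
        ‖u‖) (Eventually.of_forall fun s => ?_)).trans_eq (integral_mul_const _ _)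
      rw [norm_smul, Real.norm_of_nonneg (Real.exp_pos _).le]
      gcongr
      exact u.norm_coe_le_norm s

lemma laplaceCLM_apply {κ : ℝ} (hκ : 0 < κ) (u : ℝ →ᵇ ℂ) :
    laplaceCLM hκ u = ∫ s in Set.Ioi (0 : ℝ), Real.exp (-κ * s) • u s := rfl

end BoundedFamilies

section LowerAnalytic

variable {p : ℕ}

/-- The integrand is a product of a function holomorphic in a = conj w and one holomorphic in b = -2
Im w, and a and b are real-analytic in w. Multiplying the theta factor by e^{κs} leaves it bounded,
and `laplaceCLM` restores the exponential. The variable enters as |s| so that both factors live on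
all of ℝ. -/
lemma analyticOnNhd_vecF_lower (hp : p ≠ 0) : AnalyticOnNhd ℝ (vecF p) {w : ℂ | w.im < 0} := by
  intro w₀ hw₀
  have hw₀' : w₀.im < 0 := hw₀
  set δ : ℝ := -w₀.im / 2 with hδ
  have hδ0 : 0 < δ := by rw [hδ]; linarith
  obtain ⟨K, hK, hKf⟩ := exists_norm_thetaVec_le hp hδ0
  have hκ := decayRate_pos hp
  have hUA : IsOpen {a : ℂ | δ < a.im} := isOpen_lt continuous_const Complex.continuous_im
  have hUB : IsOpen {b : ℂ | δ < b.re} := isOpen_lt continuous_const Complex.continuous_re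
  have himA : ∀ (a : ℂ) (s : ℝ), (a + I * (|s| : ℝ)).im = a.im + |s| := fun a s => by simp
  have hreB : ∀ (b : ℂ) (s : ℝ), (((|s| : ℝ) : ℂ) + b).re = |s| + b.re := fun b s => by simp
  obtain ⟨B, hBg, hB⟩ := exists_analyticOnNhd_boundedContinuousFunction (X := ℝ) hUB
    (g := fun b s => ((((|s| : ℝ) : ℂ) + b) ^ (1 / 2 : ℂ))⁻¹) (M := (Real.sqrt δ)⁻¹)
    (fun b hb => by
      have hb' : δ < b.re := hb
      refine continuous_iff_continuousAt.2 fun s => ContinuousAt.inv₀ ?_ ?_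
      · refine ContinuousAt.comp (f := fun s : ℝ => ((|s| : ℝ) : ℂ) + b)
          (differentiableAt_cpow_half (Or.inl ?_)).continuousAt (by fun_prop)
        rw [hreB]; linarith [abs_nonneg s]
      · refine cpow_half_ne_zero fun h => ?_
        have := hreB b s
        rw [h, zero_re] at this
        linarith [abs_nonneg s])
    (fun b hb s => by
      have hb' : δ < b.re := hb
      rw [norm_inv, norm_cpow_half]
      have := Real.sqrt_pos.2 hδ0
      gcongr
      refine le_trans ?_ (Complex.re_le_norm _)
      rw [hreB]; linarith [abs_nonneg s])
    (fun s b hb => by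
      have hb' : δ < b.re := hb
      have hsl : ((|s| : ℝ) : ℂ) + b ∈ slitPlane := Or.inl (by rw [hreB]; linarith [abs_nonneg s])
      have h1 : DifferentiableAt ℂ (fun b : ℂ => (((|s| : ℝ) : ℂ) + b) ^ (1 / 2 : ℂ)) b :=
        (differentiableAt_cpow_half hsl).comp (f := fun b : ℂ => ((|s| : ℝ) : ℂ) + b) b
          (by fun_prop)
      exact (h1.fun_inv (cpow_half_ne_zero (slitPlane_ne_zero hsl))).differentiableWithinAt)
  have hA : ∀ j : Fin (p - 1), ∃ A : ℂ → BoundedContinuousFunction ℝ ℂ,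
      (∀ a ∈ {a : ℂ | δ < a.im}, ∀ s, A a s = (Real.exp (decayRate p * |s|) : ℂ) *
        thetaVec p (a + I * (|s| : ℝ)) j) ∧ AnalyticOnNhd ℂ A {a : ℂ | δ < a.im} := fun j =>
    exists_analyticOnNhd_boundedContinuousFunction (X := ℝ) hUA (M := K)
      (fun a ha => by
        have ha' : δ < a.im := ha
        refine Continuous.mul (by fun_prop) ?_
        have h : Continuous (fun s : ℝ => thetaVec p (a + I * (|s| : ℝ))) := by
          refine (continuousOn_thetaVec hp).comp_continuous (by fun_prop) fun s => ?_
          change 0 < (a + I * (|s| : ℝ)).im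
          rw [himA]; linarith [abs_nonneg s]
        exact continuous_pi_iff.1 h j)
      (fun a ha s => by
        have ha' : δ < a.im := ha
        have h1 := (norm_le_pi_norm (thetaVec p (a + I * (|s| : ℝ))) j).trans
          (hKf (a + I * (|s| : ℝ)) (by rw [himA]; linarith [abs_nonneg s]))
        rw [himA] at h1
        rw [norm_mul, Complex.norm_real, Real.norm_of_nonneg (Real.exp_pos _).le]
        calc _ ≤ Real.exp (decayRate p * |s|) * (K * Real.exp (-decayRate p * (a.im + |s|))) := by
              gcongr
          _ = K * Real.exp (-(decayRate p * a.im)) := by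
              rw [mul_left_comm, ← Real.exp_add]; congr 2; ring
          _ ≤ K * 1 := by
              gcongr
              rw [Real.exp_le_one_iff, neg_nonpos]
              have : 0 < a.im := hδ0.trans ha'
              positivity
          _ = K := mul_one K)
      (fun s a ha => by
        have ha' : δ < a.im := ha
        have h2 : DifferentiableAt ℂ (thetaVec p) (a + I * (|s| : ℝ)) :=
          (differentiableOn_thetaVec hp).differentiableAt
            ((isOpen_lt continuous_const Complex.continuous_im).mem_nhds (by
              change 0 < (a + I * (|s| : ℝ)).im
              rw [himA]; linarith [abs_nonneg s]))
        have h3 := differentiableAt_pi.1 (h2.comp (f := fun a : ℂ => a + I * (|s| : ℝ)) a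
          (by fun_prop)) j
        exact (h3.const_mul _).differentiableWithinAt)
  choose A hAg hAan using hA
  have hconj : AnalyticAt ℝ (fun w : ℂ => (starRingEnd ℂ) w) w₀ :=
    (Complex.conjCLE : ℂ →L[ℝ] ℂ).analyticAt w₀
  have him : AnalyticAt ℝ (fun w : ℂ => ((-2 * w.im : ℝ) : ℂ)) w₀ := by
    have h1 : AnalyticAt ℝ (fun w : ℂ => -2 * w.im) w₀ :=
      analyticAt_const.mul (Complex.imCLM.analyticAt w₀)
    exact (Complex.ofRealCLM.analyticAt _).fun_comp h1
  have hF : ∀ j, AnalyticAt ℝ (fun w : ℂ => (Real.sqrt (2 * p) : ℝ) •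
      laplaceCLM hκ (B ((-2 * w.im : ℝ) : ℂ) * A j ((starRingEnd ℂ) w))) w₀ := fun j => by
    have h1 : AnalyticAt ℝ (fun w : ℂ => B ((-2 * w.im : ℝ) : ℂ)) w₀ := by
      refine ((hB _ ?_).restrictScalars (𝕜 := ℝ)).fun_comp him
      change δ < (((-2 * w₀.im : ℝ) : ℂ)).re
      rw [ofReal_re, hδ]; linarith
    have h2 : AnalyticAt ℝ (fun w : ℂ => A j ((starRingEnd ℂ) w)) w₀ := by
      refine ((hAan j _ ?_).restrictScalars (𝕜 := ℝ)).fun_comp hconj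
      change δ < ((starRingEnd ℂ) w₀).im
      rw [conj_im, hδ]; linarith
    exact (((laplaceCLM hκ).analyticAt _).fun_comp (h1.fun_mul h2)).fun_const_smul
  refine (analyticAt_pi_iff.2 hF).congr ?_
  have hnhds : ∀ᶠ w : ℂ in 𝓝 w₀, w.im < -δ := 
    (isOpen_lt Complex.continuous_im continuous_const).mem_nhds (by
      change w₀.im < -δ
      rw [hδ]; linarith)
  filter_upwards [hnhds] with w hw
  have hw' : w.im < 0 := by linarith
  ext j
  rw [vecF_of_neg hp hw', Pi.smul_apply, eichlerVec, eval_integral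
    (fun i => (integrableOn_kernelTheta hp (Or.inl hw')).integrable.eval i), laplaceCLM_apply]
  congr 1
  refine setIntegral_congr_fun measurableSet_Ioi fun s hs => ?_
  have hs0 : 0 < s := hs
  have hb : ((-2 * w.im : ℝ) : ℂ) ∈ {b : ℂ | δ < b.re} := by
    change δ < (((-2 * w.im : ℝ) : ℂ)).re
    rw [ofReal_re]; linarith
  have ha : (starRingEnd ℂ) w ∈ {a : ℂ | δ < a.im} := by
    change δ < ((starRingEnd ℂ) w).im
    rw [conj_im]; linarith
  rw [BoundedContinuousFunction.mul_apply, hBg _ hb, hAg j _ ha, abs_of_pos hs0, kernelTheta,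
    kernelTheta_vertical, Pi.smul_apply, smul_eq_mul, Complex.real_smul]
  have e1 : ((s - 2 * w.im : ℝ) : ℂ) = (s : ℂ) + ((-2 * w.im : ℝ) : ℂ) := by push_cast; ring
  have e2 : (Real.exp (-decayRate p * s) : ℂ) * (Real.exp (decayRate p * s) : ℂ) = 1 := by
    rw [← Complex.ofReal_mul, ← Real.exp_add]; simp
  rw [e1]
  linear_combination (((s : ℂ) + ((-2 * w.im : ℝ) : ℂ)) ^ (1 / 2 : ℂ))⁻¹ *
    thetaVec p ((starRingEnd ℂ) w + I * s) j * e2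

end LowerAnalytic

/-! ### Characters of `A_1^{(1)}` -/

section Characters

variable {p : ℕ} {τ : ℂ}

/-- With k + 2 = p the numerator index a + 1 + 2np is 2p times the index shifted by (a + 1)/(2p). -/
lemma affineChar_eq (hp : 2 ≤ p) (a : ℕ) (τ : ℂ) :
    affineChar (p - 2) a τ = 2 * p * unaryTheta p (a + 1) τ / ModularForm.eta τ ^ 3 := by
  have hp0 : (p : ℂ) ≠ 0 := by exact_mod_cast (by omega : p ≠ 0)
  have hk : ((p - 2 : ℕ) : ℂ) + 2 = p := by
    rw [Nat.cast_sub hp]; push_cast; ring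
  rw [affineChar, unaryTheta, ← tsum_mul_left, hk]
  congr 2; ext n
  have e : (a : ℂ) + 1 + 2 * n * p = 2 * p * shift p (a + 1) n := by
    rw [shift]; push_cast; field_simp; ring
  rw [e, qTerm, mul_assoc (2 * (p : ℂ))]
  congr 3
  field_simp
  ring

/-- The factor is the one in `thetaVec_neg_inv`, so the quotients have weight 0 and only S(p)
remains. -/
lemma eta_neg_inv_pow_three (hτ : 0 < τ.im) :
    ModularForm.eta (-1 / τ) ^ 3 =
      (-I * τ * (-I * τ) ^ (1 / 2 : ℂ)) * ModularForm.eta τ ^ 3 := by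
  have h := ModularForm.eta_comp_eq_csqrt_I_inv (show τ ∈ UpperHalfPlane.upperHalfPlaneSet from hτ)
  simp only [Function.comp_apply, Pi.smul_apply, Pi.mul_apply, smul_eq_mul, Complex.sqrt] at h
  rw [show (2⁻¹ : ℂ) = 1 / 2 by norm_num, cpow_half_eq_I_mul hτ.le, mul_assoc,
    inv_mul_cancel_left₀ (cpow_half_ne_zero I_ne_zero)] at h
  rw [h, mul_pow, pow_succ, cpow_half_sq]

lemma isAffineSMatrix_matS (hp : 2 ≤ p) : IsAffineSMatrix (p - 2) (p - 1) (matS p) := by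
  have hp0 : p ≠ 0 := by omega
  refine ⟨by omega, fun a τ hτ => ?_⟩
  have h := congrFun (thetaVec_neg_inv hp0 hτ) a
  have hτ0 : τ ≠ 0 := by rintro rfl; simp at hτ
  have hJ : -I * τ * (-I * τ) ^ (1 / 2 : ℂ) ≠ 0 := by
    have : -I * τ ≠ 0 := mul_ne_zero (neg_ne_zero.2 I_ne_zero) hτ0
    exact mul_ne_zero this (cpow_half_ne_zero this)
  rw [Pi.smul_apply, smul_eq_mul] at h
  simp only [affineChar_eq hp]
  change 2 * (p : ℂ) * thetaVec p (-1 / τ) a / _ = _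
  rw [h, eta_neg_inv_pow_three hτ, mul_left_comm, mul_div_mul_left _ _ hJ, Matrix.mulVec, dotProduct,
    Finset.mul_sum, Finset.sum_div]
  refine Finset.sum_congr rfl fun b _ => ?_
  rw [thetaVec]
  ring

end Characters

end QMF
theorem mainTheorem10 (p : ℕ) (hp : 2 ≤ p) :
    -- the series and integrals in the definitions converge
    (∀ j : ℕ, 1 ≤ j → j ≤ p - 1 →
      (∀ τ : ℂ, 0 < τ.im → Summable (fun n : ℤ => QMF.sgn n * QMF.qTerm p j τ n) ∧
        Summable (fun n : ℤ => QMF.shift p j n * QMF.qTerm p j τ n)) ∧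
      (∀ τ : ℂ, τ.im < 0 → IntegrableOn (QMF.eichlerIntegrand p j τ) (Set.Ioi (0 : ℝ))) ∧
      (∀ w : ℂ, IntegrableOn (QMF.errorIntegrand p j w) (Set.Ioi (0 : ℝ)))) ∧
    -- the vector is a strong quantum modular form of weight `1/2` with quantum set `ℚ`, and
    -- the multiplier at `w ↦ -1/w` is a constant multiple of `S(p)`
    (∃ E : SL(2, ℤ) → GL (Fin (p - 1)) ℂ,
      QMF.IsStrongQuantumModularForm (1 / 2) E (QMF.vecF p) ∧
      (E ModularGroup.S : Matrix (Fin (p - 1)) (Fin (p - 1)) ℂ) =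
        (-cexp (-((Real.pi : ℂ) * I / 4))) • QMF.matS p) ∧
    -- the transformation law under `w ↦ -1/w` on `ℍ ∪ ℍ⁻ ∪ ℚ`
    (∀ w : ℂ, (0 < w.im ∨ w.im < 0 ∨ ∃ x : ℚ, x ≠ 0 ∧ w = (x : ℂ)) →
      (1 / (w * I) ^ (1 / 2 : ℂ)) • QMF.vecF p (-1 / w) + QMF.matS p *ᵥ QMF.vecF p w =
        -(QMF.matS p *ᵥ QMF.errorG p w)) ∧
    -- analyticity and smoothness of the error integral
    DifferentiableOn ℂ (QMF.errorG p) {w : ℂ | w.re ≠ 0 ∨ w.im < 0} ∧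
    ContDiff ℝ ∞ (fun x : ℝ => QMF.errorG p (x : ℂ)) ∧
    (∀ x : ℝ, x ≠ 0 → AnalyticAt ℝ (fun x : ℝ => QMF.errorG p (x : ℂ)) x) ∧
    -- `S(p)` is the `S`-matrix of `A_1^{(1)}` at level `p - 2`
    QMF.IsAffineSMatrix (p - 2) (p - 1) (QMF.matS p) := by
  have hp0 : p ≠ 0 := by omega
  refine ⟨fun j hj hj' => ?_, ⟨QMF.mult hp0, ⟨QMF.isQuantumModularForm_vecF hp0,
    QMF.differentiableOn_vecF hp0, QMF.analyticOnNhd_vecF_lower hp0, fun x => ?_⟩, ?_⟩,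
    fun w hw => ?_, QMF.differentiableOn_errorG hp0, QMF.contDiff_errorG hp0,
    fun x hx => QMF.analyticAt_errorG hp0 hx, QMF.isAffineSMatrix_matS hp⟩
  · obtain ⟨i, rfl⟩ : ∃ i : Fin (p - 1), j = i + 1 := ⟨⟨j - 1, by omega⟩, by simp; omega⟩
    exact ⟨fun τ hτ => ⟨QMF.summable_sgn_mul_qTerm hp0 hτ, QMF.summable_shift_mul_qTerm hp0 hτ⟩,
      fun τ hτ => QMF.integrableOn_eichlerIntegrand hp0 hτ i,
      fun w => QMF.integrableOn_errorIntegrand hp0 w i⟩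
  · rw [QMF.vecF_ratCast hp0]
    exact QMF.exists_vecF_expansion hp0 x
  · rw [QMF.mult_S]; rfl
  · rcases hw with h | h | ⟨x, hx, rfl⟩
    · exact QMF.vecF_neg_inv_upper hp0 h
    · exact QMF.vecF_neg_inv_lower hp0 (Or.inl h) (by rintro rfl; simp at h)
    · exact QMF.vecF_neg_inv_lower hp0 (Or.inr ⟨x, rfl⟩) (by exact_mod_cast hx)
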